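/- Let $n\ge 1$, and write $\mathbb R_+=[0,\infty)$, $H^s=H^s(\mathbb R^n)$. **Colombeau spaces.** A net $(f_\varepsilon)_{\varepsilon\in(0,1]}\subset C^\infty(\mathbb R_+)$ is *moderate* if for every compact $K\subset\mathbb R_+$ and every $k\in\mathbb N_0$ there are $N\in\mathbb N_0$, $c>0$ with $\sup_{t\in K}|\partial_t^k f_\varepsilon(t)|\le c\,\varepsilon^{-N-k}$ for all $\varepsilon\in(0,1]$, and *negligible* if for every compact $K\subset\mathbb R_+$ and all $k,p\in\mathbb N_0$ there is $c>0$ with $\sup_{t\in K}|\partial_t^k f_\varepsilon(t)|\le c\,\varepsilon^{p}$ for all $\varepsilon\in(0,1]$. The algebra $\mathcal G(\mathbb R_+)$ is the quotient of moderate by negligible nets. Likewise $\mathcal G(\mathbb R_+;H^s)$ is the quotient of the moderate by the negligible nets $(u_\varepsilon)_{\varepsilon\in(0,1]}\subset\bigcap_{k\in\mathbb N_0}C^k(\mathbb R_+;H^{s-k})$, where $|\partial_t^kf_\varepsilon(t)|$ is replaced by $\|\partial_t^k u_\varepsilon(t,\cdot)\|_{H^{s-k}}$. **Regularising embeddings.**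 Let $\mathcal D_1$ be the space of distributions on $(0,\infty)$ of the form $f+g'$ with $f,g\in L^1_{\mathrm{loc}}([0,\infty))$ and $g'$ the distributional derivative. For $\psi\in C_0^\infty(\mathbb R)$ with $\psi\ge0$, $\int\psi=1$ and $\operatorname{supp}\psi\subset(-\infty,0)$, put $\psi_\varepsilon(t)=\varepsilon^{-1}\psi(t/\varepsilon)$ and $(T*\psi_\varepsilon)(t)=\langle T,\psi_\varepsilon(t-\cdot)\rangle$ for $t\ge0$. A *regularising embedding* is an injective linear map $\iota:\mathcal D_1\to\mathcal G(\mathbb R_+)$ of the form $\iota(T)=[(T*\psi_\varepsilon)_\varepsilon]$ for some such $\psi$. **Solutions.** Let $B,B'\in\mathcal G(\mathbb R_+)$ and $(u_0,u_1)\in H^s\times H^{s-1}$. An element $u\in\mathcal G(\mathbb R_+;H^s)$ is a solution of the Cauchy problem $$\partial_t^2u-\Delta_xu+\frac{b'(t)}{b(t)}\,\partial_tu=0,\qquad u(0,\cdot)=u_0,\quad \partial_tu(0,\cdot)=u_1 \qquad(\ast)$$ with $b,b'$ embedded as $B,B'$, if there are representatives $(\beta_\varepsilon)$ of $B$ without zeros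 on $\mathbb R_+$, $(\beta'_\varepsilon)$ of $B'$ and $(u_\varepsilon)$ of $u$ such that for every $\varepsilon\in(0,1]$ and every $t\ge 0$ $$\partial_t^2u_\varepsilon-\Delta_xu_\varepsilon+\frac{\beta'_\varepsilon(t)}{\beta_\varepsilon(t)}\,\partial_tu_\varepsilon=0,\qquad u_\varepsilon(0,\cdot)=u_0,\quad \partial_tu_\varepsilon(0,\cdot)=u_1 .$$ **Theorem (Uniqueness).** Let $b:[0,\infty)\to\mathbb R$ be piecewise continuous (finitely many discontinuities in every bounded interval, with finite one-sided limits) and increasing, with $b\ge b_0$ for some constant $b_0>0$, and suppose that its distributional derivative on $(0,\infty)$ satisfies $b'\ge b_0'$ for some constant $b_0'>0$, i.e. $\langle b',\varphi\rangle\ge b_0'\int\varphi$ for all $0\le\varphi\in C_0^\infty((0,\infty))$. Let $s\in\mathbb R$ and $(u_0,u_1)\in H^s\times H^{s-1}$. Then there is a regularising embedding $\iota$ such that the Cauchy problem $(\ast)$, with the coefficients $b,b'$ embedded as $\iota(b),\iota(b')$, has a unique solution $u\in\mathcal G(\mathbb R_+;H^s)$. -/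

import Mathlib

open Set Filter Topology MeasureTheory TopologicalSpace
open scoped ContDiff Distributions SchwartzMap LineDeriv Laplacian ENNReal

noncomputable section

namespace VeryWeak

/-! ### Distributions on the open half line and the coefficient -/

/-- The open half line `(0, ∞)`. -/
def halfLine : Opens ℝ := ⟨Ioi 0, isOpen_Ioi⟩

/-- The distribution `φ ↦ ∫ φ f` on `(0, ∞)` given by a locally integrable function `f`. -/
def distOf (f : ℝ → ℝ) : 𝓓'(halfLine, ℝ) :=
  (TestFunction.integralAgainstBilinCLM (ContinuousLinearMap.mul ℝ ℝ) volume f :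
    𝓓(halfLine, ℝ) →L[ℝ] ℝ)

theorem distOf_apply {f : ℝ → ℝ} (hf : LocallyIntegrableOn f (Ici 0)) (φ : 𝓓(halfLine, ℝ)) :
    distOf f φ = ∫ x, φ x * f x :=
  TestFunction.integralAgainstBilinCLM_eq_integral
    (B := ContinuousLinearMap.mul ℝ ℝ) (hf.mono_set Ioi_subset_Ici_self)

theorem distOf_add {f g : ℝ → ℝ} (hf : LocallyIntegrableOn f (Ici 0))
    (hg : LocallyIntegrableOn g (Ici 0)) : distOf (f + g) = distOf f + distOf g := by
  ext φ
  have h1 : Integrable (fun x ↦ φ x * f x) := TestFunction.integrable_bilin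
    (ContinuousLinearMap.mul ℝ ℝ) (hf.mono_set Ioi_subset_Ici_self) φ
  have h2 : Integrable (fun x ↦ φ x * g x) := TestFunction.integrable_bilin
    (ContinuousLinearMap.mul ℝ ℝ) (hg.mono_set Ioi_subset_Ici_self) φ
  change distOf (f + g) φ = distOf f φ + distOf g φ
  rw [distOf_apply hf, distOf_apply hg, distOf_apply (hf.add hg), ← integral_add h1 h2]
  simp [mul_add]

theorem distOf_smul (c : ℝ) {f : ℝ → ℝ} (hf : LocallyIntegrableOn f (Ici 0)) :
    distOf (c • f) = c • distOf f := by
  ext φ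
  change distOf (c • f) φ = c * distOf f φ
  rw [distOf_apply hf, distOf_apply (hf.smul c), ← integral_const_mul]
  simp [mul_left_comm]

/-- The distributional derivative on `(0, ∞)`. -/
def distDeriv (T : 𝓓'(halfLine, ℝ)) : 𝓓'(halfLine, ℝ) := ∂_{(1 : ℝ)} T

/-- `T ≥ c` in the sense of distributions on `(0, ∞)`. -/
def DistGE (T : 𝓓'(halfLine, ℝ)) (c : ℝ) : Prop :=
  ∀ φ : 𝓓(halfLine, ℝ), (∀ x, 0 ≤ φ x) → c * ∫ x, φ x ≤ T φ

/-- `b` is piecewise continuous on `[0, ∞)`: on bounded intervals it has only finitely many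
discontinuities, and it has finite one-sided limits everywhere. -/
def PiecewiseContinuous (b : ℝ → ℝ) : Prop :=
  (∃ S : Set ℝ, (∀ R : ℝ, (S ∩ Icc 0 R).Finite) ∧
    ∀ t ∈ Ici (0 : ℝ) \ S, ContinuousWithinAt b (Ici 0) t) ∧
  (∀ t, 0 ≤ t → ∃ l, Tendsto b (𝓝[>] t) (𝓝 l)) ∧
  (∀ t, 0 < t → ∃ l, Tendsto b (𝓝[<] t) (𝓝 l))

/-- The space of distributions `f + g'` on `(0, ∞)`, where `f` and `g` are locally integrable on
`[0, ∞)` and `g'` is the distributional derivative. -/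
def DistSpace : Submodule ℝ 𝓓'(halfLine, ℝ) where
  carrier := {T | ∃ f g : ℝ → ℝ, LocallyIntegrableOn f (Ici 0) ∧ LocallyIntegrableOn g (Ici 0) ∧
    T = distOf f + distDeriv (distOf g)}
  zero_mem' := by
    have h0 : LocallyIntegrableOn (0 : ℝ → ℝ) (Ici 0) :=
      locallyIntegrable_zero.locallyIntegrableOn _
    have : distOf 0 = 0 := by simpa using distOf_smul 0 h0
    exact ⟨0, 0, h0, h0, by simp [this, distDeriv]⟩
  add_mem' := by
    rintro _ _ ⟨f, g, hf, hg, rfl⟩ ⟨f', g', hf', hg', rfl⟩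
    refine ⟨f + f', g + g', hf.add hf', hg.add hg', ?_⟩
    rw [distOf_add hf hf', distOf_add hg hg', distDeriv, distDeriv, distDeriv,
      LineDeriv.lineDerivOp_add]
    abel
  smul_mem' := by
    rintro c _ ⟨f, g, hf, hg, rfl⟩
    refine ⟨c • f, c • g, hf.smul c, hg.smul c, ?_⟩
    rw [distOf_smul c hf, distOf_smul c hg, distDeriv, distDeriv,
      LineDeriv.lineDerivOp_smul, smul_add]

theorem locallyIntegrableOn_of_monotoneOn {b : ℝ → ℝ} (hb : MonotoneOn b (Ici 0)) :
    LocallyIntegrableOn b (Ici 0) := by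
  rw [locallyIntegrableOn_iff isClosed_Ici.isLocallyClosed]
  exact fun K hK0 hK ↦ (hb.mono hK0).integrableOn_isCompact hK

theorem distOf_mem {b : ℝ → ℝ} (hb : MonotoneOn b (Ici 0)) : distOf b ∈ DistSpace := by
  have h0 : LocallyIntegrableOn (0 : ℝ → ℝ) (Ici 0) :=
    locallyIntegrable_zero.locallyIntegrableOn _
  have : distOf 0 = 0 := by simpa using distOf_smul 0 h0
  exact ⟨b, 0, locallyIntegrableOn_of_monotoneOn hb, h0, by simp [this, distDeriv]⟩

theorem distDeriv_distOf_mem {b : ℝ → ℝ} (hb : MonotoneOn b (Ici 0)) :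
    distDeriv (distOf b) ∈ DistSpace := by
  have h0 : LocallyIntegrableOn (0 : ℝ → ℝ) (Ici 0) :=
    locallyIntegrable_zero.locallyIntegrableOn _
  have : distOf 0 = 0 := by simpa using distOf_smul 0 h0
  exact ⟨0, b, h0, locallyIntegrableOn_of_monotoneOn hb, by simp [this]⟩

/-! ### The Colombeau algebra on `[0, ∞)` -/

/-- The index set `(0, 1]` of nets. -/
abbrev Idx : Type := Ioc (0 : ℝ) 1

/-- Smooth nets on `[0, ∞)` (values at negative times are irrelevant and are divided out later)
that are `C^∞`-moderate. -/
def IsModerate (f : Idx → ℝ → ℝ) : Prop :=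
  (∀ ε, ContDiffOn ℝ ∞ (f ε) (Ici 0)) ∧
  ∀ K : Set ℝ, IsCompact K → K ⊆ Ici 0 → ∀ k : ℕ, ∃ N : ℕ, ∃ c : ℝ, 0 < c ∧
    ∀ ε : Idx, ∀ t ∈ K, |iteratedDerivWithin k (f ε) (Ici 0) t| ≤ c * ((ε : ℝ)⁻¹) ^ (N + k)

/-- `C^∞`-negligible nets on `[0, ∞)`. -/
def IsNegligible (f : Idx → ℝ → ℝ) : Prop :=
  ∀ K : Set ℝ, IsCompact K → K ⊆ Ici 0 → ∀ k p : ℕ, ∃ c : ℝ, 0 < c ∧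
    ∀ ε : Idx, ∀ t ∈ K, |iteratedDerivWithin k (f ε) (Ici 0) t| ≤ c * (ε : ℝ) ^ p

theorem one_le_inv (ε : Idx) : 1 ≤ ((ε : ℝ)⁻¹) := (one_le_inv₀ ε.2.1).2 ε.2.2

theorem inv_pow_mono (ε : Idx) {m n : ℕ} (h : m ≤ n) : ((ε : ℝ)⁻¹) ^ m ≤ ((ε : ℝ)⁻¹) ^ n :=
  pow_le_pow_right₀ (one_le_inv ε) h

theorem contDiffOn_nat {f : ℝ → ℝ} (h : ContDiffOn ℝ ∞ f (Ici 0)) (k : ℕ) :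
    ContDiffOn ℝ k f (Ici 0) := h.of_le (by exact_mod_cast le_top)

theorem abs_iteratedDerivWithin_mul_le {f g : ℝ → ℝ} (hf : ContDiffOn ℝ ∞ f (Ici 0))
    (hg : ContDiffOn ℝ ∞ g (Ici 0)) (k : ℕ) {t : ℝ} (ht : t ∈ Ici (0 : ℝ)) :
    |iteratedDerivWithin k (f * g) (Ici 0) t| ≤ ∑ i ∈ Finset.range (k + 1), (k.choose i : ℝ) *
      |iteratedDerivWithin i f (Ici 0) t| * |iteratedDerivWithin (k - i) g (Ici 0) t| := by
  have := norm_iteratedFDerivWithin_mul_le (contDiffOn_nat hf k) (contDiffOn_nat hg k)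
    (uniqueDiffOn_Ici 0) ht (n := k) le_rfl
  simpa only [norm_iteratedFDerivWithin_eq_norm_iteratedDerivWithin, Real.norm_eq_abs] using! this

theorem IsModerate.add {f g : Idx → ℝ → ℝ} (hf : IsModerate f) (hg : IsModerate g) :
    IsModerate (f + g) := by
  refine ⟨fun ε ↦ (hf.1 ε).add (hg.1 ε), fun K hK hK0 k ↦ ?_⟩
  obtain ⟨N, c, hc, h⟩ := hf.2 K hK hK0 k
  obtain ⟨M, d, hd, h'⟩ := hg.2 K hK hK0 k
  refine ⟨N + M, c + d, by positivity, fun ε t ht ↦ ?_⟩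
  rw [Pi.add_apply, iteratedDerivWithin_add (hK0 ht) (uniqueDiffOn_Ici 0)
    (contDiffOn_nat (hf.1 ε) k t (hK0 ht)) (contDiffOn_nat (hg.1 ε) k t (hK0 ht))]
  have h1 := inv_pow_mono ε (show N + k ≤ N + M + k by omega)
  have h2 := inv_pow_mono ε (show M + k ≤ N + M + k by omega)
  calc _ ≤ _ := abs_add_le _ _
    _ ≤ c * (ε : ℝ)⁻¹ ^ (N + k) + d * (ε : ℝ)⁻¹ ^ (M + k) := add_le_add (h ε t ht) (h' ε t ht)
    _ ≤ c * (ε : ℝ)⁻¹ ^ (N + M + k) + d * (ε : ℝ)⁻¹ ^ (N + M + k) := by gcongr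
    _ = _ := by ring

theorem IsModerate.mul {f g : Idx → ℝ → ℝ} (hf : IsModerate f) (hg : IsModerate g) :
    IsModerate (f * g) := by
  refine ⟨fun ε ↦ (hf.1 ε).mul (hg.1 ε), fun K hK hK0 k ↦ ?_⟩
  choose N c hc h using hf.2 K hK hK0
  choose M d hd h' using hg.2 K hK hK0
  refine ⟨∑ i ∈ Finset.range (k + 1), (N i + M (k - i)),
    ∑ i ∈ Finset.range (k + 1), (k.choose i : ℝ) * c i * d (k - i), ?_, fun ε t ht ↦ ?_⟩
  · refine Finset.sum_pos (fun i hi ↦ ?_) (by simp)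
    have : 0 < k.choose i := Nat.choose_pos (by simpa [Nat.lt_succ_iff] using hi)
    have := hc i
    have := hd (k - i)
    positivity
  · refine (abs_iteratedDerivWithin_mul_le (hf.1 ε) (hg.1 ε) k (hK0 ht)).trans ?_
    rw [Finset.sum_mul]
    refine Finset.sum_le_sum fun i hi ↦ ?_
    have hik : i ≤ k := by simpa [Nat.lt_succ_iff] using hi
    have hs : N i + M (k - i) ≤ ∑ i ∈ Finset.range (k + 1), (N i + M (k - i)) :=
      Finset.single_le_sum (f := fun i ↦ N i + M (k - i)) (fun _ _ ↦ Nat.zero_le _) hi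
    have he : 0 ≤ ((ε : ℝ)⁻¹) := zero_le_one.trans (one_le_inv ε)
    have := hc i
    have := hd (k - i)
    calc _ ≤ (k.choose i : ℝ) * (c i * (ε : ℝ)⁻¹ ^ (N i + i)) *
          (d (k - i) * (ε : ℝ)⁻¹ ^ (M (k - i) + (k - i))) := by
          gcongr
          · exact h i ε t ht
          · exact h' (k - i) ε t ht
      _ = (k.choose i : ℝ) * c i * d (k - i) *
          (ε : ℝ)⁻¹ ^ ((N i + i) + (M (k - i) + (k - i))) := by rw [pow_add]; ring
      _ ≤ _ := by
          gcongr ?_ * ?_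
          exact inv_pow_mono ε (by omega)

theorem isModerate_const (r : ℝ) : IsModerate (fun _ _ ↦ r) := by
  refine ⟨fun ε ↦ contDiffOn_const, fun K _ _ k ↦ ⟨0, |r| + 1, by positivity, fun ε t _ ↦ ?_⟩⟩
  have h1 : 1 ≤ ((ε : ℝ)⁻¹) ^ (0 + k) := one_le_pow₀ (one_le_inv ε)
  have h2 : |iteratedDerivWithin k (fun _ : ℝ ↦ r) (Ici 0) t| ≤ |r| := by
    rw [iteratedDerivWithin_const]
    split_ifs <;> simp
  nlinarith [abs_nonneg r]

/-- The algebra of `C^∞`-moderate nets on `[0, ∞)`. -/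
def Moderate : Subalgebra ℝ (Idx → ℝ → ℝ) where
  carrier := {f | IsModerate f}
  mul_mem' := IsModerate.mul
  add_mem' := IsModerate.add
  algebraMap_mem' := isModerate_const

/-- The ideal of `C^∞`-negligible nets in the algebra of moderate nets. -/
def Negligible : Ideal Moderate where
  carrier := {f | IsNegligible f}
  zero_mem' := fun K _ _ k p ↦ ⟨1, one_pos, fun ε t _ ↦ by
    have : 0 ≤ (ε : ℝ) ^ p := pow_nonneg ε.2.1.le p
    have h0 : iteratedDerivWithin k (fun _ : ℝ ↦ (0 : ℝ)) (Ici 0) t = 0 := by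
      rw [iteratedDerivWithin_const]; simp
    change |iteratedDerivWithin k (fun _ : ℝ ↦ (0 : ℝ)) (Ici 0) t| ≤ _
    rw [h0]
    simpa using this⟩
  add_mem' := by
    rintro ⟨f, hf⟩ ⟨g, hg⟩ h h' K hK hK0 k p
    obtain ⟨c, hc, h⟩ := h K hK hK0 k p
    obtain ⟨d, hd, h'⟩ := h' K hK hK0 k p
    refine ⟨c + d, by positivity, fun ε t ht ↦ ?_⟩
    change |iteratedDerivWithin k (f ε + g ε) (Ici 0) t| ≤ _
    rw [iteratedDerivWithin_add (hK0 ht) (uniqueDiffOn_Ici 0)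
      (contDiffOn_nat (hf.1 ε) k t (hK0 ht)) (contDiffOn_nat (hg.1 ε) k t (hK0 ht)), add_mul]
    exact (abs_add_le _ _).trans (add_le_add (h ε t ht) (h' ε t ht))
  smul_mem' := by
    rintro ⟨f, hf⟩ ⟨g, hg⟩ h' K hK hK0 k p
    choose N c hc h using hf.2 K hK hK0
    choose d hd h' using fun i q ↦ h' K hK hK0 i q
    refine ⟨∑ i ∈ Finset.range (k + 1), (k.choose i : ℝ) * c i * d (k - i) (p + (N i + i)), ?_,
      fun ε t ht ↦ ?_⟩
    · refine Finset.sum_pos (fun i hi ↦ ?_) (by simp)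
      have : 0 < k.choose i := Nat.choose_pos (by simpa [Nat.lt_succ_iff] using hi)
      have := hc i
      have := hd (k - i) (p + (N i + i))
      positivity
    · refine (abs_iteratedDerivWithin_mul_le (hf.1 ε) (hg.1 ε) k (hK0 ht)).trans ?_
      rw [Finset.sum_mul]
      refine Finset.sum_le_sum fun i hi ↦ ?_
      have he : (0 : ℝ) < ε := ε.2.1
      have := hc i
      have := hd (k - i) (p + (N i + i))
      calc _ ≤ (k.choose i : ℝ) * (c i * (ε : ℝ)⁻¹ ^ (N i + i)) *
            (d (k - i) (p + (N i + i)) * (ε : ℝ) ^ (p + (N i + i))) := by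
            gcongr
            · exact h i ε t ht
            · exact h' (k - i) (p + (N i + i)) ε t ht
        _ = (k.choose i : ℝ) * c i * d (k - i) (p + (N i + i)) * (ε : ℝ) ^ p *
            (((ε : ℝ)⁻¹ * ε) ^ (N i + i)) := by rw [pow_add _ p, mul_pow]; ring
        _ = _ := by rw [inv_mul_cancel₀ he.ne', one_pow, mul_one]

/-- The Colombeau algebra `𝒢(ℝ₊)`: moderate nets modulo negligible nets. -/
abbrev Colombeau : Type := Moderate ⧸ Negligible

/-- The class of a moderate net in `𝒢(ℝ₊)`. -/
def Colombeau.mk (f : Moderate) : Colombeau := Ideal.Quotient.mk Negligible f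

/-! ### Regularisation by convolution -/

/-- A Friedrichs mollifier supported in the open negative half line, so that for `t ≥ 0` the
convolution `(T * ψ_ε)(t)` only sees the values of `T` on `(0, ∞)`. -/
structure Mollifier where
  toFun : ℝ → ℝ
  contDiff : ContDiff ℝ ∞ toFun
  hasCompactSupport : HasCompactSupport toFun
  nonneg : ∀ x, 0 ≤ toFun x
  integral_eq_one : ∫ x, toFun x = 1
  tsupport_subset : tsupport toFun ⊆ Iio 0

/-- For `t ≥ 0` the test function `r ↦ ψ_ε(t - r) = ε⁻¹ ψ((t - r) / ε)` on `(0, ∞)`. -/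
def Mollifier.translate (ψ : Mollifier) (ε : Idx) (t : ℝ) (ht : 0 ≤ t) : 𝓓(halfLine, ℝ) where
  toFun r := (ε : ℝ)⁻¹ * ψ.toFun ((ε : ℝ)⁻¹ * (t - r))
  contDiff' := by
    have := ψ.contDiff
    have h : ContDiff ℝ ∞ fun r : ℝ ↦ (ε : ℝ)⁻¹ * ψ.toFun ((ε : ℝ)⁻¹ * (t - r)) :=
      contDiff_const.mul (this.comp (contDiff_const.mul (contDiff_const.sub contDiff_id)))
    exact h
  hasCompactSupport' := by
    have he : (ε : ℝ)⁻¹ ≠ 0 := inv_ne_zero ε.2.1.ne'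
    have h : HasCompactSupport (fun r : ℝ ↦ ψ.toFun ((ε : ℝ)⁻¹ * (t - r))) :=
      ψ.hasCompactSupport.comp_homeomorph
        ((Homeomorph.subLeft t).trans (Homeomorph.mulLeft₀ _ he))
    exact h.mul_left
  tsupport_subset' := by
    have hc : Continuous (fun r : ℝ ↦ (ε : ℝ)⁻¹ * (t - r)) := by fun_prop
    refine (tsupport_mul_subset_right (f := fun _ : ℝ ↦ (ε : ℝ)⁻¹)
      (g := fun r : ℝ ↦ ψ.toFun ((ε : ℝ)⁻¹ * (t - r)))).trans ?_
    refine (tsupport_comp_subset_preimage ψ.toFun hc).trans fun r hr ↦ ?_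
    have h : (ε : ℝ)⁻¹ * (t - r) < 0 := ψ.tsupport_subset hr
    have he : 0 < (ε : ℝ)⁻¹ := inv_pos.2 ε.2.1
    have : t - r < 0 := by
      by_contra hn
      exact absurd h (not_lt.2 (mul_nonneg he.le (not_lt.1 hn)))
    change 0 < r
    linarith

/-- `ι` is the embedding `T ↦ [(T * ψ_ε)_ε]` into `𝒢(ℝ₊)` by regularisation with `ψ`, where
`(T * ψ_ε)(t) = ⟨T, ψ_ε(t - ·)⟩` for `t ≥ 0`. -/
def IsRegularisingEmbedding (ψ : Mollifier) (ι : DistSpace →ₗ[ℝ] Colombeau) : Prop :=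
  Function.Injective ι ∧
  ∀ T : DistSpace, ∃ f : Moderate, ι T = Colombeau.mk f ∧
    ∀ (ε : Idx) (t : ℝ) (ht : 0 ≤ t), f.1 ε t = T.1 (ψ.translate ε t ht)

/-! ### Sobolev spaces -/

/-- The space `ℝⁿ` with its Euclidean structure. -/
abbrev Euc (n : ℕ) : Type := EuclideanSpace ℝ (Fin n)

/-- `H^s(ℝⁿ)`: the tempered distributions `f` with `⟨D⟩^s f ∈ L²`. -/
structure Sobolev (n : ℕ) (s : ℝ) where
  toDist : 𝓢'(Euc n, ℂ)
  memSobolev : TemperedDistribution.MemSobolev s 2 toDist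

namespace Sobolev

variable {n : ℕ} {s : ℝ}

theorem toDist_injective : Function.Injective (toDist : Sobolev n s → 𝓢'(Euc n, ℂ)) := by
  rintro ⟨f, hf⟩ ⟨g, hg⟩ h
  cases h
  rfl

instance : Zero (Sobolev n s) := ⟨⟨0, TemperedDistribution.memSobolev_fun_zero _ _ s 2⟩⟩
instance : Add (Sobolev n s) := ⟨fun f g ↦ ⟨f.toDist + g.toDist, f.memSobolev.add g.memSobolev⟩⟩
instance : Neg (Sobolev n s) := ⟨fun f ↦ ⟨-f.toDist, f.memSobolev.neg⟩⟩
instance : Sub (Sobolev n s) := ⟨fun f g ↦ ⟨f.toDist - g.toDist, f.memSobolev.sub g.memSobolev⟩⟩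
instance : SMul ℂ (Sobolev n s) := ⟨fun c f ↦ ⟨c • f.toDist, f.memSobolev.smul c⟩⟩
instance : SMul ℕ (Sobolev n s) := ⟨fun m f ↦ ⟨m • f.toDist, by
  simpa [Nat.cast_smul_eq_nsmul] using f.memSobolev.smul (m : ℂ)⟩⟩
instance : SMul ℤ (Sobolev n s) := ⟨fun m f ↦ ⟨m • f.toDist, by
  simpa [Int.cast_smul_eq_zsmul] using f.memSobolev.smul (m : ℂ)⟩⟩

instance : AddCommGroup (Sobolev n s) :=
  toDist_injective.addCommGroup _ rfl (fun _ _ ↦ rfl) (fun _ ↦ rfl) (fun _ _ ↦ rfl)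
    (fun _ _ ↦ rfl) (fun _ _ ↦ rfl)

theorem toDist_add (f g : Sobolev n s) : (f + g).toDist = f.toDist + g.toDist := rfl

theorem toDist_smul (c : ℂ) (f : Sobolev n s) : (c • f).toDist = c • f.toDist := rfl

instance : Module ℂ (Sobolev n s) :=
  toDist_injective.module ℂ ⟨⟨toDist, rfl⟩, toDist_add⟩ toDist_smul

theorem toTemperedDistribution_injective :
    Function.Injective (MeasureTheory.Lp.toTemperedDistributionCLM ℂ
      (volume : Measure (Euc n)) 2) :=
  LinearMap.ker_eq_bot.1 MeasureTheory.Lp.ker_toTemperedDistributionCLM_eq_bot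

/-- The function `⟨D⟩^s f ∈ L²` for `f ∈ H^s`. -/
def toLpFun (f : Sobolev n s) : Lp ℂ 2 (volume : Measure (Euc n)) := f.memSobolev.choose

theorem toLpFun_spec (f : Sobolev n s) :
    TemperedDistribution.besselPotential (Euc n) ℂ s f.toDist =
      MeasureTheory.Lp.toTemperedDistributionCLM ℂ volume 2 f.toLpFun :=
  f.memSobolev.choose_spec

/-- The linear map `f ↦ ⟨D⟩^s f` from `H^s` to `L²`. -/
def toLp : Sobolev n s →ₗ[ℂ] Lp ℂ 2 (volume : Measure (Euc n)) where
  toFun := toLpFun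
  map_add' f g := toTemperedDistribution_injective <| by
    rw [map_add, ← toLpFun_spec, ← toLpFun_spec, ← toLpFun_spec, toDist_add, map_add]
  map_smul' c f := toTemperedDistribution_injective <| by
    rw [RingHom.id_apply, map_smul, ← toLpFun_spec, ← toLpFun_spec, toDist_smul, map_smul]

theorem besselPotential_toDist (f : Sobolev n s) :
    TemperedDistribution.besselPotential (Euc n) ℂ s f.toDist = (f.toLp : 𝓢'(Euc n, ℂ)) :=
  f.toLpFun_spec

theorem toLp_injective : Function.Injective (toLp : Sobolev n s → _) := by
  intro f g h
  apply toDist_injective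
  have hf := f.besselPotential_toDist
  rw [h, ← g.besselPotential_toDist] at hf
  have := congrArg (TemperedDistribution.besselPotential (Euc n) ℂ (-s)) hf
  simpa using this

/-- `H^s` carries the norm `‖f‖ = ‖⟨D⟩^s f‖_{L²}`. -/
instance : NormedAddCommGroup (Sobolev n s) :=
  NormedAddCommGroup.induced _ _ (toLp : Sobolev n s →ₗ[ℂ] _) toLp_injective

theorem norm_def (f : Sobolev n s) : ‖f‖ = ‖f.toLp‖ := rfl

instance : NormedSpace ℂ (Sobolev n s) :=
  NormedSpace.induced ℂ _ _ (toLp : Sobolev n s →ₗ[ℂ] _)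

/-- The inclusion `H^s ⊆ H^{s - k}`. -/
def incl (k : ℕ) : Sobolev n s →ₗ[ℂ] Sobolev n (s - k) where
  toFun f := ⟨f.toDist, f.memSobolev.mono (by simp)⟩
  map_add' f g := toDist_injective (by rw [toDist_add, toDist_add])
  map_smul' c f := toDist_injective (by rw [RingHom.id_apply, toDist_smul, toDist_smul])

theorem toDist_incl (k : ℕ) (f : Sobolev n s) : (incl k f).toDist = f.toDist := rfl

end Sobolev

/-- The `k`-th derivative `∂_t^k u(t) ∈ H^{s - k}` of a curve `u : [0, ∞) → H^s`, regarded as a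
curve in `H^{s - k}`. -/
def timeDeriv {n : ℕ} {s : ℝ} (k : ℕ) (u : ℝ → Sobolev n s) (t : ℝ) : Sobolev n (s - k) :=
  iteratedDerivWithin k (fun τ ↦ Sobolev.incl k (u τ)) (Ici 0) t

/-- Nets in `⋂_k C^k([0, ∞); H^{s - k})`. -/
def IsSmoothNet {n : ℕ} {s : ℝ} (u : Idx → ℝ → Sobolev n s) : Prop :=
  ∀ ε, ∀ k : ℕ, ContDiffOn ℝ k (fun t ↦ Sobolev.incl k (u ε t)) (Ici 0)

/-- `C^∞(ℝ₊; H^s)`-moderate nets. -/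
def IsModerateH {n : ℕ} {s : ℝ} (u : Idx → ℝ → Sobolev n s) : Prop :=
  IsSmoothNet u ∧
  ∀ K : Set ℝ, IsCompact K → K ⊆ Ici 0 → ∀ k : ℕ, ∃ N : ℕ, ∃ c : ℝ, 0 < c ∧
    ∀ ε : Idx, ∀ t ∈ K, ‖timeDeriv k (u ε) t‖ ≤ c * ((ε : ℝ)⁻¹) ^ (N + k)

/-- `C^∞(ℝ₊; H^s)`-negligible nets. -/
def IsNegligibleH {n : ℕ} {s : ℝ} (u : Idx → ℝ → Sobolev n s) : Prop :=
  ∀ K : Set ℝ, IsCompact K → K ⊆ Ici 0 → ∀ k p : ℕ, ∃ c : ℝ, 0 < c ∧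
    ∀ ε : Idx, ∀ t ∈ K, ‖timeDeriv k (u ε) t‖ ≤ c * (ε : ℝ) ^ p

theorem timeDeriv_add {n : ℕ} {s : ℝ} {u v : Idx → ℝ → Sobolev n s} (hu : IsSmoothNet u)
    (hv : IsSmoothNet v) (k : ℕ) (ε : Idx) {t : ℝ} (ht : t ∈ Ici (0 : ℝ)) :
    timeDeriv k (u ε + v ε) t = timeDeriv k (u ε) t + timeDeriv k (v ε) t := by
  have h := iteratedDerivWithin_add ht (uniqueDiffOn_Ici 0) (hu ε k t ht) (hv ε k t ht)
  have he : (fun τ ↦ Sobolev.incl k ((u ε + v ε) τ)) =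
      (fun τ ↦ Sobolev.incl k (u ε τ)) + fun τ ↦ Sobolev.incl k (v ε τ) :=
    funext fun τ ↦ by simp only [Pi.add_apply, map_add]
  rw [timeDeriv, timeDeriv, timeDeriv, ← h, he]

theorem timeDeriv_smul {n : ℕ} {s : ℝ} (a : ℂ) (u : ℝ → Sobolev n s) (k : ℕ) (t : ℝ) :
    timeDeriv k (a • u) t = a • timeDeriv k u t := by
  have he : (fun τ ↦ Sobolev.incl k ((a • u) τ)) = a • fun τ ↦ Sobolev.incl k (u τ) :=
    funext fun τ ↦ by simp only [Pi.smul_apply, map_smul]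
  rw [timeDeriv, timeDeriv, ← iteratedDerivWithin_const_smul_field, he]

theorem timeDeriv_zero {n : ℕ} {s : ℝ} (k : ℕ) (t : ℝ) :
    timeDeriv k (0 : ℝ → Sobolev n s) t = 0 := by
  simpa using timeDeriv_smul (0 : ℂ) (0 : ℝ → Sobolev n s) k t

/-- The space of `C^∞(ℝ₊; H^s)`-moderate nets. -/
def ModerateH (n : ℕ) (s : ℝ) : Submodule ℂ (Idx → ℝ → Sobolev n s) where
  carrier := {u | IsModerateH u}
  zero_mem' := by
    refine ⟨fun ε k ↦ ?_, fun K _ _ k ↦ ⟨0, 1, one_pos, fun ε t _ ↦ ?_⟩⟩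
    · simpa using contDiffOn_const
    · rw [Pi.zero_apply, timeDeriv_zero, norm_zero, one_mul]
      exact pow_nonneg (zero_le_one.trans (one_le_inv ε)) _
  add_mem' := by
    rintro u v ⟨hu, h⟩ ⟨hv, h'⟩
    refine ⟨fun ε k ↦ by simpa using (hu ε k).add (hv ε k), fun K hK hK0 k ↦ ?_⟩
    obtain ⟨N, c, hc, h⟩ := h K hK hK0 k
    obtain ⟨M, d, hd, h'⟩ := h' K hK hK0 k
    refine ⟨N + M, c + d, by positivity, fun ε t ht ↦ ?_⟩
    rw [Pi.add_apply, timeDeriv_add hu hv k ε (hK0 ht)]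
    have h1 := inv_pow_mono ε (show N + k ≤ N + M + k by omega)
    have h2 := inv_pow_mono ε (show M + k ≤ N + M + k by omega)
    calc _ ≤ _ := norm_add_le _ _
      _ ≤ c * (ε : ℝ)⁻¹ ^ (N + k) + d * (ε : ℝ)⁻¹ ^ (M + k) := add_le_add (h ε t ht) (h' ε t ht)
      _ ≤ c * (ε : ℝ)⁻¹ ^ (N + M + k) + d * (ε : ℝ)⁻¹ ^ (N + M + k) := by gcongr
      _ = _ := by ring
  smul_mem' := by
    rintro a u ⟨hu, h⟩
    refine ⟨fun ε k ↦ by simpa using (hu ε k).const_smul a, fun K hK hK0 k ↦ ?_⟩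
    obtain ⟨N, c, hc, h⟩ := h K hK hK0 k
    refine ⟨N, (‖a‖ + 1) * c, by positivity, fun ε t ht ↦ ?_⟩
    rw [Pi.smul_apply, timeDeriv_smul, norm_smul, mul_assoc]
    gcongr
    · linarith
    · exact h ε t ht

/-- The subspace of `C^∞(ℝ₊; H^s)`-negligible nets in the space of moderate nets. -/
def NegligibleH (n : ℕ) (s : ℝ) : Submodule ℂ (ModerateH n s) where
  carrier := {u | IsNegligibleH u.1}
  zero_mem' := fun K _ _ k p ↦ ⟨1, one_pos, fun ε t _ ↦ by
    change ‖timeDeriv k (0 : ℝ → Sobolev n s) t‖ ≤ _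
    rw [timeDeriv_zero, norm_zero, one_mul]
    exact pow_nonneg ε.2.1.le p⟩
  add_mem' := by
    rintro ⟨u, hu⟩ ⟨v, hv⟩ h h' K hK hK0 k p
    obtain ⟨c, hc, h⟩ := h K hK hK0 k p
    obtain ⟨d, hd, h'⟩ := h' K hK hK0 k p
    refine ⟨c + d, by positivity, fun ε t ht ↦ ?_⟩
    change ‖timeDeriv k (u ε + v ε) t‖ ≤ _
    rw [timeDeriv_add hu.1 hv.1 k ε (hK0 ht), add_mul]
    exact (norm_add_le _ _).trans (add_le_add (h ε t ht) (h' ε t ht))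
  smul_mem' := by
    rintro a ⟨u, hu⟩ h K hK hK0 k p
    obtain ⟨c, hc, h⟩ := h K hK hK0 k p
    refine ⟨(‖a‖ + 1) * c, by positivity, fun ε t ht ↦ ?_⟩
    change ‖timeDeriv k (a • u ε) t‖ ≤ _
    rw [timeDeriv_smul, norm_smul, mul_assoc]
    gcongr
    · linarith
    · exact h ε t ht

/-- The space `𝒢(ℝ₊; H^s)`: moderate nets modulo negligible nets. -/
abbrev ColombeauH (n : ℕ) (s : ℝ) : Type := ModerateH n s ⧸ NegligibleH n s

/-- The class of a moderate net in `𝒢(ℝ₊; H^s)`. -/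
def ColombeauH.mk {n : ℕ} {s : ℝ} (u : ModerateH n s) : ColombeauH n s :=
  Submodule.Quotient.mk u

/-! ### The Cauchy problem -/

/-- The curve `u : [0, ∞) → H^s` solves
`∂_t² u - Δ u + (β' / β) ∂_t u = 0`, `u(0) = u₀`, `∂_t u(0) = u₁` in the sense of tempered
distributions; `β` and `β'` are two given functions. -/
def SolvesCauchy {n : ℕ} {s : ℝ} (β β' : ℝ → ℝ) (u₀ : Sobolev n s) (u₁ : Sobolev n (s - 1))
    (u : ℝ → Sobolev n s) : Prop :=
  (∀ t : ℝ, 0 ≤ t →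
    (timeDeriv 2 u t).toDist - Δ (u t).toDist
      + ((β' t / β t : ℝ) : ℂ) • (timeDeriv 1 u t).toDist = 0) ∧
  u 0 = u₀ ∧ (timeDeriv 1 u 0).toDist = u₁.toDist

/-- `U ∈ 𝒢(ℝ₊; H^s)` solves the Cauchy problem with coefficients `B, B' ∈ 𝒢(ℝ₊)` in the places of
`b, b'`: on the level of representatives, for some representatives `β` (nowhere zero, so that
the quotient makes sense), `β'` and `u` of `B`, `B'` and `U`, the net `u` solves the Cauchy problem
for every `ε`. -/
def IsSolution {n : ℕ} {s : ℝ} (B B' : Colombeau) (u₀ : Sobolev n s) (u₁ : Sobolev n (s - 1))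
    (U : ColombeauH n s) : Prop :=
  ∃ (β β' : Moderate) (u : ModerateH n s),
    Colombeau.mk β = B ∧ Colombeau.mk β' = B' ∧ ColombeauH.mk u = U ∧
    (∀ ε : Idx, ∀ t : ℝ, 0 ≤ t → β.1 ε t ≠ 0) ∧
    ∀ ε : Idx, SolvesCauchy (β.1 ε) (β'.1 ε) u₀ u₁ (u.1 ε)

end VeryWeak

end

/-! The estimate behind the theorem is uniform in `ε` because the damping has a sign. A mollifier `ψ
≥ 0` of unit mass averages, so `β = b * ψ_ε ≥ b₀ > 0` and `β' = b' * ψ_ε ≥ b₀' > 0`. Hence `a = β' /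
β ≥ 0`, and in the energy identity for `‖∂ₜu‖² + ‖∇u‖²` in `H^{s-1}` the damping contributes
`-2a‖∂ₜu‖²`, which is discarded. However large `a` becomes as `ε → 0`, it does not enter the
constants.

The weighted Fourier transform identifies every `H^s` with `L²`. The inclusion `H^s ⊆ H^{s-1}` turns
into multiplication by `⟨ξ⟩⁻¹`, a contraction `M`, and `-Δ` into `κ (1 - M²)`, read two steps down
the scale, with `κ = (2π)²` (`sobDist_bracketInv`, `laplacian_sobDist`). The equation becomes a
first order system for `V` and `W = (M V)'` in one Hilbert space. Cutting off to `⟨ξ⟩ ≤ j + 1` makes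
`M` invertible and the system an ordinary differential equation with bounded operators. The energy
estimate `IsCutoff.exists_norm_le` survives the limit `j → ∞` and also gives convergence of the
cut-off solutions, hence existence (`IsCutoff.exists_isWaveSystem`).

Moderateness: `V` and `W` are bounded uniformly in `ε`, and higher time derivatives are controlled
recursively by differentiating the equation (`norm_curveDeriv_add_two_le`), each step costing only
derivatives of the moderate net `a`.

Uniqueness: a competing solution `v` may belong to other representatives `β₁, β₁'`, whose quotient
need not have a sign. The difference `v - u` has zero data and solves the equation with the good
damping `β' / β` and source `(β' / β - β₁' / β₁) ∂ₜv`. The bracket is negligible for small `ε`,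
where `β₁` stays away from zero, and `∂ₜv` is moderate; the energy estimate and the recursion make
`v - u` negligible for small `ε`. For the remaining `ε` moderateness suffices (`NegO.of_small`).

Injectivity of the embedding holds because the regularisations converge to `T` weakly, while
negligible nets tend to zero. -/

namespace VeryWeak

/-! ### Linear differential equations in Banach spaces -/

section LinearODE

variable {E : Type*} [NormedAddCommGroup E] [NormedSpace ℝ E]

/-- The terms of the Picard series of the linear equation `y' = A(t) y`, `y(0) = y₀`. -/
noncomputable def picardTerm (A : ℝ → E →L[ℝ] E) (y₀ : E) : ℕ → ℝ → E
  | 0 => fun _ ↦ y₀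
  | n + 1 => fun t ↦ ∫ r in (0 : ℝ)..t, A r (picardTerm A y₀ n r)

theorem continuous_picardTerm {A : ℝ → E →L[ℝ] E} (hA : Continuous A) (y₀ : E) (n : ℕ) :
    Continuous (picardTerm A y₀ n) := by
  induction n with
  | zero => exact continuous_const
  | succ n ih =>
    exact intervalIntegral.continuous_primitive
      (fun a b ↦ (hA.clm_apply ih).intervalIntegrable a b) 0

theorem hasDerivAt_picardTerm [CompleteSpace E] {A : ℝ → E →L[ℝ] E} (hA : Continuous A)
    (y₀ : E) (n : ℕ) (t : ℝ) :
    HasDerivAt (picardTerm A y₀ (n + 1)) (A t (picardTerm A y₀ n t)) t :=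
  (hA.clm_apply (continuous_picardTerm hA y₀ n)).integral_hasStrictDerivAt 0 t |>.hasDerivAt

/-- Each integration of `C (C r)ⁿ / n!` produces the next term of the exponential series, which
makes the Picard series converge locally uniformly. -/
theorem norm_picardTerm_le {A : ℝ → E →L[ℝ] E} (y₀ : E) {C R : ℝ}
    (hC : ∀ t, |t| ≤ R → ‖A t‖ ≤ C) (n : ℕ) {t : ℝ} (ht : |t| ≤ R) :
    ‖picardTerm A y₀ n t‖ ≤ (C * |t|) ^ n / n.factorial * ‖y₀‖ := by
  have hC0 : 0 ≤ C := (norm_nonneg _).trans (hC t ht)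
  induction n generalizing t with
  | zero => simp [picardTerm]
  | succ n ih =>
    have hle : ∀ r, |r| ≤ |t| → ‖A r (picardTerm A y₀ n r)‖ ≤
        C * ((C * |r|) ^ n / n.factorial * ‖y₀‖) := fun r hr ↦
      ((A r).le_opNorm _).trans (mul_le_mul (hC r (hr.trans ht)) (ih (hr.trans ht))
        (norm_nonneg _) hC0)
    have hcont : Continuous fun r : ℝ ↦ C * ((C * |r|) ^ n / n.factorial * ‖y₀‖) := by fun_prop
    have key : ∀ r, 0 ≤ r → ∫ x in (0 : ℝ)..r, C * ((C * |x|) ^ n / n.factorial * ‖y₀‖) =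
        (C * r) ^ (n + 1) / (n + 1).factorial * ‖y₀‖ := by
      intro r hr
      have : ∀ x ∈ uIcc 0 r, C * ((C * |x|) ^ n / n.factorial * ‖y₀‖) =
          (C ^ (n + 1) / n.factorial * ‖y₀‖) * x ^ n := by
        intro x hx
        rw [uIcc_of_le hr] at hx
        rw [abs_of_nonneg hx.1]
        ring
      rw [intervalIntegral.integral_congr this, intervalIntegral.integral_const_mul, integral_pow,
        Nat.factorial_succ]
      push_cast
      field_simp
      ring
    rcases le_total 0 t with h0 | h0
    · rw [abs_of_nonneg h0, ← key t h0]
      refine intervalIntegral.norm_integral_le_of_norm_le h0 (ae_of_all _ fun r hr ↦ hle r ?_)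
        (hcont.intervalIntegrable _ _)
      rw [abs_of_nonneg h0, abs_of_pos hr.1]
      exact hr.2
    -- Negative times are reduced to positive ones by the reflection `r ↦ -r`.
    · have h1 : picardTerm A y₀ (n + 1) t =
          ∫ r in (0 : ℝ)..(-t), - A (-r) (picardTerm A y₀ n (-r)) := by
        rw [intervalIntegral.integral_neg,
          intervalIntegral.integral_comp_neg (fun r ↦ A r (picardTerm A y₀ n r)),
          neg_neg, neg_zero, ← intervalIntegral.integral_symm]
        rfl
      rw [abs_of_nonpos h0, ← key (-t) (by linarith), h1]
      refine intervalIntegral.norm_integral_le_of_norm_le (by linarith)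
        (ae_of_all _ fun r hr ↦ ?_) (hcont.intervalIntegrable _ _)
      rw [norm_neg]
      have := hle (-r) (by rw [abs_neg, abs_of_nonpos h0, abs_of_pos hr.1]; exact hr.2)
      rwa [abs_neg] at this

/-- Global existence for linear ordinary differential equations in Banach spaces. -/
theorem exists_forall_hasDerivAt_linear [CompleteSpace E] {A : ℝ → E →L[ℝ] E} (hA : Continuous A)
    (y₀ : E) :
    ∃ y : ℝ → E, y 0 = y₀ ∧ ∀ t, HasDerivAt y (A t (y t)) t := by
  have hbound : ∀ R : ℝ, 0 ≤ R → ∃ C, ∀ t, |t| ≤ R → ‖A t‖ ≤ C := by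
    intro R _
    obtain ⟨C, hC⟩ := isCompact_Icc.exists_bound_of_continuousOn (s := Icc (-R) R) hA.continuousOn
    exact ⟨C, fun t ht ↦ hC t (abs_le.1 ht)⟩
  have hsum : ∀ t, Summable fun n ↦ picardTerm A y₀ n t := by
    intro t
    obtain ⟨C, hC⟩ := hbound |t| (abs_nonneg t)
    refine Summable.of_norm_bounded ((Real.summable_pow_div_factorial (C * |t|)).mul_right ‖y₀‖)
      fun n ↦ norm_picardTerm_le y₀ hC n le_rfl
  refine ⟨fun t ↦ ∑' n, picardTerm A y₀ n t, ?_, fun t ↦ ?_⟩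
  · change ∑' n, picardTerm A y₀ n 0 = y₀
    rw [(hsum 0).tsum_eq_zero_add]
    simp [picardTerm]
  · obtain ⟨C, hC⟩ := hbound (|t| + 1) (by positivity)
    have hC0 : 0 ≤ C := (norm_nonneg _).trans (hC t (by linarith))
    have hu : Summable fun n : ℕ ↦ C * ((C * (|t| + 1)) ^ n / n.factorial * ‖y₀‖) :=
      ((Real.summable_pow_div_factorial (C * (|t| + 1))).mul_right ‖y₀‖).mul_left C
    -- The zeroth term is constant, so only the tail is differentiated; its termwise derivative is
    -- `A t` applied to the full series.
    have hd : HasDerivAt (fun z ↦ ∑' n, picardTerm A y₀ (n + 1) z)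
        (∑' n, A t (picardTerm A y₀ n t)) t := by
      refine hasDerivAt_tsum_of_isPreconnected
        (t := Ioo (-(|t| + 1)) (|t| + 1)) (y₀ := 0) hu isOpen_Ioo
        isPreconnected_Ioo (fun n r _ ↦ hasDerivAt_picardTerm hA y₀ n r) (fun n r hr ↦ ?_) ?_ ?_ ?_
      · have hr' : |r| ≤ |t| + 1 := (abs_lt.2 hr).le
        calc _ ≤ _ := (A r).le_opNorm _
          _ ≤ C * ((C * |r|) ^ n / n.factorial * ‖y₀‖) :=
            mul_le_mul (hC r hr') (norm_picardTerm_le y₀ hC n hr') (norm_nonneg _) hC0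
          _ ≤ _ := by gcongr
      · constructor <;> nlinarith [abs_nonneg t]
      · exact (summable_nat_add_iff 1).2 (hsum 0)
      · exact abs_lt.1 (by linarith)
    rw [(A t).map_tsum (hsum t)]
    have he : (fun z ↦ ∑' n, picardTerm A y₀ n z) =
        fun z ↦ y₀ + ∑' n, picardTerm A y₀ (n + 1) z :=
      funext fun z ↦ (hsum z).tsum_eq_zero_add
    rw [he]
    exact hd.const_add y₀

end LinearODE

/-! ### The damped wave equation as a first order system -/

section WaveSystem

open scoped RealInnerProductSpace

variable {H : Type*} [NormedAddCommGroup H] [InnerProductSpace ℝ H]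

/-- Spectral projections `P j` onto parts of `H` on which the contraction `M` has the bounded
inverse `B j`. -/
structure IsCutoff (M : H →L[ℝ] H) (P B : ℕ → H →L[ℝ] H) : Prop where
  norm_M_le : ∀ x, ‖M x‖ ≤ ‖x‖
  symm_P : ∀ j x y, ⟪P j x, y⟫ = ⟪x, P j y⟫
  symm_B : ∀ j x y, ⟪B j x, y⟫ = ⟪x, B j y⟫
  B_M : ∀ j x, B j (M x) = P j x
  M_B : ∀ j x, M (B j x) = P j x
  M_P : ∀ j x, M (P j x) = P j (M x)
  P_P : ∀ j x, P j (P j x) = P j x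
  P_B : ∀ j x, P j (B j x) = B j x
  tendsto_P : ∀ x, Tendsto (fun j ↦ P j x) atTop (𝓝 x)

/-- The first order system for `V` and `W = (M V)'` that corresponds to
`W' = - κ M⁻¹ (1 - M²) V - a W + g`. -/
structure IsWaveSystem (M : H →L[ℝ] H) (κ : ℝ) (a : ℝ → ℝ) (g V W : ℝ → H) : Prop where
  hasDeriv_V : ∀ t, 0 ≤ t → HasDerivWithinAt (fun r ↦ M (V r)) (W t) (Ici 0) t
  hasDeriv_W : ∀ t, 0 ≤ t → HasDerivWithinAt (fun r ↦ M (W r))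
    (-(κ • (V t - M (M (V t)))) - a t • M (W t) + M (g t)) (Ici 0) t

/-- The energy `‖W‖² + κ ⟨(1 - M²) V, V⟩` of a state. -/
def energy (M : H →L[ℝ] H) (κ : ℝ) (v w : H) : ℝ := ‖w‖ ^ 2 + κ * (‖v‖ ^ 2 - ‖M v‖ ^ 2)

variable {M : H →L[ℝ] H} {P B : ℕ → H →L[ℝ] H} {κ : ℝ} {a : ℝ → ℝ} {g V W : ℝ → H}

theorem IsWaveSystem.sub {g' V' W' : ℝ → H} (h : IsWaveSystem M κ a g V W)
    (h' : IsWaveSystem M κ a g' V' W') :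
    IsWaveSystem M κ a (fun t ↦ g t - g' t) (fun t ↦ V t - V' t) (fun t ↦ W t - W' t) := by
  constructor
  · intro t ht
    simpa only [map_sub] using! (h.hasDeriv_V t ht).sub (h'.hasDeriv_V t ht)
  · intro t ht
    have := (h.hasDeriv_W t ht).sub (h'.hasDeriv_W t ht)
    simp only [map_sub, smul_sub] at this ⊢
    convert! this using 1
    abel

namespace IsCutoff

/-- A symmetric idempotent is an orthogonal projection: `‖P x‖² = ⟪x, P x⟫`, and Cauchy–Schwarz
applies. -/
theorem norm_P_le (hc : IsCutoff M P B) (j : ℕ) (x : H) : ‖P j x‖ ≤ ‖x‖ := by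
  have h : ‖P j x‖ * ‖P j x‖ ≤ ‖x‖ * ‖P j x‖ := by
    rw [← real_inner_self_eq_norm_mul_norm, hc.symm_P, hc.P_P]
    exact real_inner_le_norm _ _
  by_contra hn
  push Not at hn
  have := (norm_nonneg x).trans_lt hn
  nlinarith

theorem energy_ge (hc : IsCutoff M P B) (hκ : 0 ≤ κ) (v w : H) : ‖w‖ ^ 2 ≤ energy M κ v w := by
  have : ‖M v‖ ^ 2 ≤ ‖v‖ ^ 2 := by gcongr; exact hc.norm_M_le v
  have := mul_nonneg hκ (sub_nonneg.2 this)
  unfold energy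
  linarith

/-- Only `M V` and `M W` are known to be differentiable, but `P j = B j M` transfers this to `P j V`
and `P j W`, which is why the energy identity is first proved after the cutoff. The `κ` terms cancel
by symmetry, so that only damping and source remain. -/
theorem hasDerivWithinAt_energy (hc : IsCutoff M P B) (h : IsWaveSystem M κ a g V W) (j : ℕ)
    {t : ℝ} (ht : 0 ≤ t) :
    HasDerivWithinAt (fun r ↦ energy M κ (P j (V r)) (P j (W r)))
      (-2 * a t * ‖P j (W t)‖ ^ 2 + 2 * ⟪P j (W t), P j (g t)⟫) (Ici 0) t := by
  have hV : HasDerivWithinAt (fun r ↦ P j (V r)) (B j (W t)) (Ici 0) t := by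
    simpa only [Function.comp_def, hc.B_M] using
      (B j).hasFDerivAt.comp_hasDerivWithinAt t (h.hasDeriv_V t ht)
  have hMV : HasDerivWithinAt (fun r ↦ M (P j (V r))) (P j (W t)) (Ici 0) t := by
    simpa only [Function.comp_def, hc.M_B] using M.hasFDerivAt.comp_hasDerivWithinAt t hV
  have hW : HasDerivWithinAt (fun r ↦ P j (W r))
      (-(κ • (B j (V t) - M (P j (V t)))) - a t • P j (W t) + P j (g t)) (Ici 0) t := by
    have := (B j).hasFDerivAt.comp_hasDerivWithinAt t (h.hasDeriv_W t ht)
    simpa only [Function.comp_def, hc.B_M, map_add, map_sub, map_neg, map_smul, ← hc.M_P] using this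
  have := hW.norm_sq.add ((hV.norm_sq.sub hMV.norm_sq).const_mul κ)
  refine this.congr_deriv ?_
  -- Both sides equal `⟪W, B j V⟫`.
  have e1 : ⟪P j (W t), B j (V t)⟫ = ⟪P j (V t), B j (W t)⟫ := by
    rw [hc.symm_P, hc.P_B, real_inner_comm, hc.symm_P, hc.P_B, hc.symm_B]
  have e2 : ⟪P j (W t), M (P j (V t))⟫ = ⟪M (P j (V t)), P j (W t)⟫ := real_inner_comm _ _
  simp only [inner_add_right, inner_sub_right, inner_neg_right, inner_smul_right,
    real_inner_self_eq_norm_sq, e1, e2]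
  ring

/-- This is Gronwall's argument for `E' ≤ E + G²`, where `a ≥ 0` removes the damping term and `2⟪w,
g⟫ ≤ ‖w‖² + ‖g‖²` absorbs the source. The bound does not depend on `j`, so the cutoff can be removed
in the limit. -/
theorem energy_le (hc : IsCutoff M P B) (hκ : 0 ≤ κ) (h : IsWaveSystem M κ a g V W) {T G : ℝ}
    (ha : ∀ t ∈ Icc 0 T, 0 ≤ a t) (hg : ∀ t ∈ Icc 0 T, ‖g t‖ ≤ G) {t : ℝ} (ht : t ∈ Icc 0 T) :
    energy M κ (V t) (W t) ≤ (energy M κ (V 0) (W 0) + G ^ 2 * T) * Real.exp T := by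
  have hT : 0 ≤ T := ht.1.trans ht.2
  have hj : ∀ j, energy M κ (P j (V t)) (P j (W t)) ≤
      (energy M κ (P j (V 0)) (P j (W 0)) + G ^ 2 * T) * Real.exp T := by
    intro j
    -- The function `E(r) e^{-r} - G² r` is shown to decrease on `[0, T]`.
    have hd : ∀ r ∈ Icc 0 T, HasDerivWithinAt
        (fun r ↦ energy M κ (P j (V r)) (P j (W r)) * Real.exp (-r) - G ^ 2 * r)
        ((-2 * a r * ‖P j (W r)‖ ^ 2 + 2 * ⟪P j (W r), P j (g r)⟫) * Real.exp (-r) +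
          energy M κ (P j (V r)) (P j (W r)) * (Real.exp (-r) * (-1)) - G ^ 2 * 1) (Ici 0) r :=
      fun r hr ↦ ((hc.hasDerivWithinAt_energy h j hr.1).mul
        (hasDerivAt_neg r).exp.hasDerivWithinAt).sub
        ((hasDerivAt_id r).const_mul _).hasDerivWithinAt
    have hanti := antitoneOn_of_hasDerivWithinAt_nonpos (convex_Icc 0 T)
      (fun r hr ↦ ((hd r hr).continuousWithinAt.mono Icc_subset_Ici_self))
      (fun r hr ↦ (hd r (interior_subset hr)).mono
        (interior_subset.trans Icc_subset_Ici_self)) (fun r hr ↦ by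
        have hr' : r ∈ Icc 0 T := interior_subset hr
        have h1 := hc.energy_ge hκ (P j (V r)) (P j (W r))
        have h2 := abs_le.1 (abs_real_inner_le_norm (P j (W r)) (P j (g r)))
        have h3 : ‖P j (g r)‖ ≤ G := (hc.norm_P_le j _).trans (hg r hr')
        have h3' : ‖P j (g r)‖ ^ 2 ≤ G ^ 2 := by gcongr
        have h4 := mul_nonneg (ha r hr') (sq_nonneg ‖P j (W r)‖)
        have h5 : Real.exp (-r) ≤ 1 := Real.exp_le_one_iff.2 (by linarith [hr'.1])
        have h6 := Real.exp_pos (-r)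
        have h7 : -2 * a r * ‖P j (W r)‖ ^ 2 + 2 * ⟪P j (W r), P j (g r)⟫ -
            energy M κ (P j (V r)) (P j (W r)) ≤ G ^ 2 := by
          nlinarith [sq_nonneg (‖P j (W r)‖ - ‖P j (g r)‖)]
        nlinarith [sq_nonneg G, mul_le_mul_of_nonneg_right h7 h6.le])
    have := hanti ⟨le_rfl, hT⟩ ht ht.1
    simp only [neg_zero, Real.exp_zero, mul_one, mul_zero, sub_zero] at this
    have h0 := (sq_nonneg _).trans (hc.energy_ge hκ (P j (V 0)) (P j (W 0)))
    calc energy M κ (P j (V t)) (P j (W t))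
        = energy M κ (P j (V t)) (P j (W t)) * Real.exp (-t) * Real.exp t := by
          rw [mul_assoc, ← Real.exp_add]; simp
      _ ≤ (energy M κ (P j (V 0)) (P j (W 0)) + G ^ 2 * T) * Real.exp T := by
          have h1 : G ^ 2 * t ≤ G ^ 2 * T := by gcongr; exact ht.2
          gcongr
          · linarith
          · exact ht.2
  have hlim : ∀ v w : H, Tendsto (fun j ↦ energy M κ (P j v) (P j w)) atTop
      (𝓝 (energy M κ v w)) := fun v w ↦
    ((hc.tendsto_P w).norm.pow 2).add ((((hc.tendsto_P v).norm.pow 2).sub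
      (((M.continuous.tendsto v).comp (hc.tendsto_P v)).norm.pow 2)).const_mul κ)
  exact le_of_tendsto_of_tendsto' (hlim _ _) (((hlim _ _).add_const _).mul_const _) hj

/-- The energy estimate for the wave system, uniform in the coefficient `a ≥ 0`. -/
theorem exists_norm_le (hc : IsCutoff M P B) (hκ : 0 < κ) (T : ℝ) :
    ∃ C, 0 < C ∧ ∀ (a : ℝ → ℝ) (g V W : ℝ → H) (G : ℝ), IsWaveSystem M κ a g V W →
      (∀ t ∈ Icc 0 T, 0 ≤ a t) → (∀ t ∈ Icc 0 T, ‖g t‖ ≤ G) → ∀ t ∈ Icc 0 T,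
      ‖V t‖ ≤ C * (‖V 0‖ + ‖W 0‖ + G) ∧ ‖W t‖ ≤ C * (‖V 0‖ + ‖W 0‖ + G) := by
  rcases lt_or_ge T 0 with hT | hT
  · exact ⟨1, one_pos, fun _ _ _ _ _ _ _ _ t ht ↦ absurd (ht.1.trans ht.2) (not_le.2 hT)⟩
  -- Chosen so that the energy stays below `(C₁ D)²`, where `D` is the sum of the norms of the data
  -- and of `G`: the initial energy is at most `(1 + κ) D²` and the source adds at most `T D²`.
  set C₁ : ℝ := Real.sqrt ((1 + κ + T) * Real.exp T) with hC₁
  have hC₁' : C₁ ^ 2 = (1 + κ + T) * Real.exp T := Real.sq_sqrt (by positivity)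
  have hC₁0 : 0 ≤ C₁ := Real.sqrt_nonneg _
  have hκi := inv_pos.2 hκ
  -- The energy does not control `V` at low frequencies. The part `1 + T * C₁` bounds `M V` by
  -- integrating its derivative `W`; the part `C₁ * (1 + κ⁻¹)` bounds the rest through `κ (‖V‖² - ‖M
  -- V‖²)`.
  refine ⟨1 + T * C₁ + C₁ * (1 + κ⁻¹), by positivity, fun a g V W G h ha hg ↦ ?_⟩
  have hG : 0 ≤ G := (norm_nonneg _).trans (hg 0 ⟨le_rfl, hT⟩)
  set D := ‖V 0‖ + ‖W 0‖ + G with hD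
  have hD0 : 0 ≤ D := by positivity
  have hE : ∀ t ∈ Icc 0 T, energy M κ (V t) (W t) ≤ (C₁ * D) ^ 2 := by
    intro t ht
    refine (hc.energy_le hκ.le h ha hg ht).trans ?_
    rw [mul_pow, hC₁', mul_right_comm]
    gcongr
    have h1 : ‖V 0‖ ^ 2 ≤ D ^ 2 := by gcongr; linarith [norm_nonneg (W 0)]
    have h2 : ‖W 0‖ ^ 2 ≤ D ^ 2 := by gcongr; linarith [norm_nonneg (V 0)]
    have h3 : G ^ 2 ≤ D ^ 2 := by gcongr; linarith [norm_nonneg (V 0), norm_nonneg (W 0)]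
    unfold energy
    nlinarith [mul_le_mul_of_nonneg_left h1 hκ.le, mul_le_mul_of_nonneg_right h3 hT,
      mul_nonneg hκ.le (sq_nonneg ‖M (V 0)‖)]
  have hW : ∀ t ∈ Icc 0 T, ‖W t‖ ≤ C₁ * D := fun t ht ↦
    abs_le_of_sq_le_sq' ((hc.energy_ge hκ.le _ _).trans (hE t ht)) (by positivity) |>.2
  intro t ht
  have hMV : ‖M (V t)‖ ≤ ‖V 0‖ + T * (C₁ * D) := by
    have := (convex_Icc 0 T).norm_image_sub_le_of_norm_hasDerivWithin_le
      (fun r hr ↦ (h.hasDeriv_V r hr.1).mono Icc_subset_Ici_self) hW ⟨le_rfl, hT⟩ ht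
    rw [sub_zero, Real.norm_of_nonneg ht.1] at this
    have h1 := norm_le_norm_add_norm_sub' (M (V t)) (M (V 0))
    have h2 := hc.norm_M_le (V 0)
    have h3 : C₁ * D * t ≤ T * (C₁ * D) := by
      rw [mul_comm]; gcongr; exact ht.2
    linarith
  constructor
  · have h1 : ‖V t‖ ^ 2 ≤ ‖M (V t)‖ ^ 2 + κ⁻¹ * (C₁ * D) ^ 2 := by
      have := hE t ht
      unfold energy at this
      have h2 : κ * (‖V t‖ ^ 2 - ‖M (V t)‖ ^ 2) ≤ (C₁ * D) ^ 2 := by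
        linarith [sq_nonneg ‖W t‖]
      have h3 := mul_le_mul_of_nonneg_left h2 hκi.le
      rw [← mul_assoc, inv_mul_cancel₀ hκ.ne', one_mul] at h3
      linarith
    have h2 : ‖M (V t)‖ ≤ (1 + T * C₁) * D := by
      have : ‖V 0‖ ≤ D := by linarith [norm_nonneg (W 0)]
      linarith
    refine abs_le_of_sq_le_sq' (h1.trans ?_) (by positivity) |>.2
    -- `κ⁻¹ ≤ (1 + κ⁻¹)²` replaces the square root of `κ⁻¹`, and `x² + y² ≤ (x + y)²` for
    -- nonnegative `x, y` closes the estimate.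
    calc _ ≤ ((1 + T * C₁) * D) ^ 2 + (1 + κ⁻¹) ^ 2 * (C₁ * D) ^ 2 := by
          gcongr
          nlinarith
      _ ≤ _ := by
          have : 0 ≤ ((1 + T * C₁) * D) * (C₁ * (1 + κ⁻¹) * D) := by positivity
          linarith
  · refine (hW t ht).trans ?_
    gcongr
    nlinarith [mul_nonneg hT hC₁0, mul_nonneg hC₁0 hκi.le]

end IsCutoff

/-- Uniform limits of solutions of the wave system are solutions. -/
theorem IsWaveSystem.of_tendstoUniformlyOn {V W : ℕ → ℝ → H} {v w : ℝ → H}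
    (ha : ContinuousOn a (Ici 0))
    (h : ∀ j, IsWaveSystem M κ a 0 (V j) (W j))
    (hVc : ∀ j, ContinuousOn (V j) (Ici 0)) (hWc : ∀ j, ContinuousOn (W j) (Ici 0))
    (hV : ∀ T, TendstoUniformlyOn V v atTop (Icc 0 T))
    (hW : ∀ T, TendstoUniformlyOn W w atTop (Icc 0 T)) :
    IsWaveSystem M κ a 0 v w ∧ ContinuousOn v (Ici 0) ∧ ContinuousOn w (Ici 0) := by
  have hcont : ∀ {F : ℕ → ℝ → H} {f : ℝ → H}, (∀ j, ContinuousOn (F j) (Ici 0)) →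
      (∀ T, TendstoUniformlyOn F f atTop (Icc 0 T)) → ContinuousOn f (Ici 0) := by
    intro F f hF hu t ht
    have h1 : ContinuousOn f (Icc 0 (t + 1)) := (hu (t + 1)).continuousOn
      (Frequently.of_forall fun j ↦ (hF j).mono Icc_subset_Ici_self)
    refine (h1 t ⟨ht, by linarith⟩).mono_of_mem_nhdsWithin ?_
    rw [← Ici_inter_Iic]
    exact inter_mem_nhdsWithin _ (Iic_mem_nhds (by linarith))
  have hvc := hcont hVc hV
  have hwc := hcont hWc hW
  have hderiv : ∀ {F F' : ℕ → ℝ → H} {f f' : ℝ → H},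
      (∀ j t, 0 ≤ t → HasDerivWithinAt (F j) (F' j t) (Ici 0) t) →
      (∀ T, TendstoUniformlyOn F f atTop (Icc 0 T)) →
      (∀ T, TendstoUniformlyOn F' f' atTop (Icc 0 T)) → ContinuousOn f' (Ici 0) →
      ∀ t, 0 ≤ t → HasDerivWithinAt f (f' t) (Ici 0) t := by
    intro F F' f f' hd hF hF' hc
    have hpos : ∀ t, 0 < t → HasDerivAt f (f' t) t := fun t ht ↦
      hasDerivAt_of_tendstoUniformlyOn isOpen_Ioo
        ((hF' (t + 1)).mono Ioo_subset_Icc_self)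
        (Eventually.of_forall fun j r hr ↦ (hd j r hr.1.le).hasDerivAt (Ici_mem_nhds hr.1))
        (fun r hr ↦ (hF (t + 1)).tendsto_at (Ioo_subset_Icc_self hr)) ⟨ht, by linarith⟩
    intro t ht
    -- The theorem on limits of derivatives needs an open interval, so the one-sided derivative at
    -- `0` is recovered as the limit of the derivatives at positive times.
    rcases ht.eq_or_lt with rfl | ht
    · have hfc : ContinuousOn f (Ici 0) :=
        hcont (fun j t ht ↦ (hd j t ht).continuousWithinAt) hF
      refine hasDerivWithinAt_Ici_of_tendsto_deriv (s := Ioi 0)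
        (fun r hr ↦ (hpos r hr).differentiableAt.differentiableWithinAt)
        ((hfc 0 self_mem_Ici).mono Ioi_subset_Ici_self) self_mem_nhdsWithin ?_
      refine Tendsto.congr' (f₁ := f') ?_ ((hc 0 self_mem_Ici).mono Ioi_subset_Ici_self)
      filter_upwards [self_mem_nhdsWithin] with r hr
      exact (hpos r hr).deriv.symm
    · exact (hpos t ht).hasDerivWithinAt
  have hM : ∀ {F : ℕ → ℝ → H} {f : ℝ → H} {T : ℝ}, TendstoUniformlyOn F f atTop (Icc 0 T) →
      TendstoUniformlyOn (fun j t ↦ M (F j t)) (fun t ↦ M (f t)) atTop (Icc 0 T) :=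
    fun hF ↦ M.uniformContinuous.comp_tendstoUniformlyOn hF
  refine ⟨⟨?_, ?_⟩, hvc, hwc⟩
  · exact hderiv (fun j ↦ (h j).hasDeriv_V) (fun T ↦ hM (hV T)) hW hwc
  · refine hderiv (fun j ↦ (h j).hasDeriv_W) (fun T ↦ hM (hW T)) (fun T ↦ ?_) ?_
    · simp only [Pi.zero_apply, map_zero, add_zero]
      obtain ⟨C, hC⟩ := isCompact_Icc.exists_bound_of_continuousOn
        (ha.mono (show Icc 0 T ⊆ Ici 0 from Icc_subset_Ici_self))
      have h1 : TendstoUniformlyOn (fun j t ↦ κ • (V j t - M (M (V j t))))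
          (fun t ↦ κ • (v t - M (M (v t)))) atTop (Icc 0 T) :=
        (uniformContinuous_const_smul κ).comp_tendstoUniformlyOn ((hV T).sub (hM (hM (hV T))))
      have h2 : TendstoUniformlyOn (fun j t ↦ a t • M (W j t)) (fun t ↦ a t • M (w t)) atTop
          (Icc 0 T) := by
        have := hM (hW T)
        rw [Metric.tendstoUniformlyOn_iff] at this ⊢
        intro δ hδ
        filter_upwards [this (δ / (|C| + 1)) (by positivity)] with j hj t ht
        have h3 := hj t ht
        rw [dist_eq_norm] at h3 ⊢
        rw [← smul_sub, norm_smul]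
        rw [lt_div_iff₀ (by positivity)] at h3
        calc _ ≤ (|C| + 1) * ‖M (w t) - M (W j t)‖ := by
              gcongr
              exact (hC t ht).trans ((le_abs_self C).trans (by linarith))
          _ < δ := by linarith
      simpa only [neg_sub] using! (h1.neg).sub h2
    · simp only [Pi.zero_apply, map_zero, add_zero]
      have h1 := M.continuous.comp_continuousOn (M.continuous.comp_continuousOn hvc)
      have h2 := M.continuous.comp_continuousOn hwc
      exact ((hvc.sub h1).const_smul κ).neg.sub (ha.smul h2)

/-- On the range of `P j` the inverse of `M` is the bounded operator `B j`, so the system is an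
ordinary differential equation `y' = A(t) y` with continuous `A`. Its solution never leaves this
range, and there the equation for `y` is the wave system. -/
theorem IsCutoff.exists_isWaveSystem_of_P [CompleteSpace H] (hc : IsCutoff M P B)
    (ha : ContinuousOn a (Ici 0)) (j : ℕ) {v₀ w₀ : H} (hv₀ : P j v₀ = v₀) (hw₀ : P j w₀ = w₀) :
    ∃ V W : ℝ → H, V 0 = v₀ ∧ W 0 = w₀ ∧ Continuous V ∧ Continuous W ∧
      IsWaveSystem M κ a 0 V W := by
  -- The coefficient is extended to negative times by its value at `0`, since the linear theory
  -- works on all of `ℝ`.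
  set a' : ℝ → ℝ := fun t ↦ a (max 0 t) with ha'
  have hac : Continuous a' :=
    ha.comp_continuous (by fun_prop) fun t ↦ le_max_left 0 t
  set F := ContinuousLinearMap.fst ℝ H H
  set S := ContinuousLinearMap.snd ℝ H H
  set A : ℝ → H × H →L[ℝ] H × H := fun t ↦
    (B j ∘L S).prod (-(κ • ((B j - M ∘L P j) ∘L F)) - a' t • (P j ∘L S)) with hA
  have hAc : Continuous A := by
    have : A = fun t ↦ (B j ∘L S).prod (-(κ • ((B j - M ∘L P j) ∘L F))) -
        a' t • (0 : H × H →L[ℝ] H).prod (P j ∘L S) := by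
      ext t x <;> simp [hA]
    rw [this]
    fun_prop
  obtain ⟨y, hy0, hy⟩ := exists_forall_hasDerivAt_linear hAc (v₀, w₀)
  have hyc : Continuous y := continuous_iff_continuousAt.2 fun t ↦ (hy t).continuousAt
  have hV : ∀ t, HasDerivAt (fun r ↦ (y r).1) (B j (y t).2) t := fun t ↦
    F.hasFDerivAt.comp_hasDerivAt t (hy t)
  have hW : ∀ t, HasDerivAt (fun r ↦ (y r).2)
      (-(κ • (B j (y t).1 - M (P j (y t).1))) - a' t • P j (y t).2) t := fun t ↦
    S.hasFDerivAt.comp_hasDerivAt t (hy t)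
  -- Invariance of the range of `P j`: `P j f - f` has zero derivative and vanishes at `0`.
  have hconst : ∀ {f f' : ℝ → H}, (∀ t, HasDerivAt f (f' t) t) → (∀ t, P j (f' t) = f' t) →
      P j (f 0) = f 0 → ∀ t, P j (f t) = f t := by
    intro f f' hf hf' h0 t
    have hd : ∀ t, HasDerivAt (fun r ↦ P j (f r) - f r) 0 t := fun t ↦ by
      simpa [hf'] using! ((P j).hasFDerivAt.comp_hasDerivAt t (hf t)).sub (hf t)
    have := is_const_of_deriv_eq_zero (fun t ↦ (hd t).differentiableAt) (fun t ↦ (hd t).deriv) t 0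
    rw [h0, sub_self] at this
    exact sub_eq_zero.1 this
  have hPV : ∀ t, P j (y t).1 = (y t).1 :=
    hconst hV (fun t ↦ hc.P_B j _) (by rw [hy0]; exact hv₀)
  have hPW : ∀ t, P j (y t).2 = (y t).2 :=
    hconst hW (fun t ↦ by simp only [map_sub, map_neg, map_smul, hc.P_B, hc.P_P, ← hc.M_P])
      (by rw [hy0]; exact hw₀)
  refine ⟨fun t ↦ (y t).1, fun t ↦ (y t).2, congrArg Prod.fst hy0, congrArg Prod.snd hy0, hyc.fst,
    hyc.snd,
    fun t _ ↦ ?_, fun t ht ↦ ?_⟩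
  · have := M.hasFDerivAt.comp_hasDerivAt t (hV t)
    simp only [hc.M_B, hPW] at this
    exact this.hasDerivWithinAt
  · have := M.hasFDerivAt.comp_hasDerivAt t (hW t)
    simp only [map_sub, map_neg, map_smul, hc.M_B, hPV, hPW, ha', max_eq_right ht] at this
    simpa only [Pi.zero_apply, map_zero, add_zero] using! this.hasDerivWithinAt

/-- Existence for the wave system. -/
theorem IsCutoff.exists_isWaveSystem [CompleteSpace H] (hc : IsCutoff M P B) (hκ : 0 < κ)
    (ha : ContinuousOn a (Ici 0)) (ha0 : ∀ t, 0 ≤ t → 0 ≤ a t) (v₀ w₀ : H) :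
    ∃ V W : ℝ → H, V 0 = v₀ ∧ W 0 = w₀ ∧ ContinuousOn V (Ici 0) ∧ ContinuousOn W (Ici 0) ∧
      IsWaveSystem M κ a 0 V W := by
  choose V W hV0 hW0 hVc hWc hs using fun j ↦
    hc.exists_isWaveSystem_of_P (κ := κ) ha j (hc.P_P j v₀) (hc.P_P j w₀)
  -- The difference of two cut-off solutions solves the same homogeneous system, so the energy
  -- estimate reduces its size to that of the difference of the cut-off data.
  have hcauchy : ∀ T, UniformCauchySeqOn V atTop (Icc 0 T) ∧
      UniformCauchySeqOn W atTop (Icc 0 T) := by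
    intro T
    obtain ⟨C, hC, hest⟩ := hc.exists_norm_le hκ T
    have hd : ∀ i j, ∀ t ∈ Icc 0 T,
        dist (V i t) (V j t) ≤ C * (dist (P i v₀) (P j v₀) + dist (P i w₀) (P j w₀)) ∧
        dist (W i t) (W j t) ≤ C * (dist (P i v₀) (P j v₀) + dist (P i w₀) (P j w₀)) := by
      intro i j t ht
      have := hest a _ _ _ 0 ((hs i).sub (hs j)) (fun t ht ↦ ha0 t ht.1) (fun t _ ↦ by simp) t ht
      simpa only [dist_eq_norm, hV0, hW0, add_zero] using this
    have hlim : Tendsto (fun p : ℕ × ℕ ↦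
        C * (dist (P p.1 v₀) (P p.2 v₀) + dist (P p.1 w₀) (P p.2 w₀))) atTop (𝓝 0) := by
      have h1 := (cauchySeq_iff_tendsto_dist_atTop_0.1 (hc.tendsto_P v₀).cauchySeq)
      have h2 := (cauchySeq_iff_tendsto_dist_atTop_0.1 (hc.tendsto_P w₀).cauchySeq)
      simpa using (h1.add h2).const_mul C
    rw [Metric.uniformCauchySeqOn_iff, Metric.uniformCauchySeqOn_iff]
    have : ∀ δ > 0, ∃ N, ∀ m ≥ N, ∀ n ≥ N,
        C * (dist (P m v₀) (P n v₀) + dist (P m w₀) (P n w₀)) < δ := by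
      intro δ hδ
      obtain ⟨⟨N₁, N₂⟩, hN⟩ := eventually_atTop.1 (hlim.eventually (gt_mem_nhds hδ))
      exact ⟨max N₁ N₂, fun m hm n hn ↦ hN (m, n)
        ⟨(le_max_left _ _).trans hm, (le_max_right _ _).trans hn⟩⟩
    constructor
    all_goals
      intro δ hδ
      obtain ⟨N, hN⟩ := this δ hδ
      refine ⟨N, fun m hm n hn t ht ↦ lt_of_le_of_lt ?_ (hN m hm n hn)⟩
    · exact (hd m n t ht).1
    · exact (hd m n t ht).2
  have hex : ∀ F : ℕ → ℝ → H, (∀ T, UniformCauchySeqOn F atTop (Icc 0 T)) →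
      ∃ f : ℝ → H, ∀ T, TendstoUniformlyOn F f atTop (Icc 0 T) := by
    intro F hF
    have : ∀ t, ∃ l, 0 ≤ t → Tendsto (fun j ↦ F j t) atTop (𝓝 l) := by
      intro t
      by_cases ht : 0 ≤ t
      · obtain ⟨l, hl⟩ := cauchySeq_tendsto_of_complete ((hF t).cauchySeq ⟨ht, le_rfl⟩)
        exact ⟨l, fun _ ↦ hl⟩
      · exact ⟨0, fun h ↦ absurd h ht⟩
    choose f hf using this
    exact ⟨f, fun T ↦ (hF T).tendstoUniformlyOn_of_tendsto fun t ht ↦ hf t ht.1⟩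
  obtain ⟨v, hv⟩ := hex V fun T ↦ (hcauchy T).1
  obtain ⟨w, hw⟩ := hex W fun T ↦ (hcauchy T).2
  obtain ⟨h1, h2, h3⟩ := IsWaveSystem.of_tendstoUniformlyOn ha hs
    (fun j ↦ (hVc j).continuousOn) (fun j ↦ (hWc j).continuousOn) hv hw
  refine ⟨v, w, ?_, ?_, h2, h3, h1⟩
  · refine tendsto_nhds_unique ((hv 0).tendsto_at ⟨le_rfl, le_rfl⟩) ?_
    simpa only [hV0] using hc.tendsto_P v₀
  · refine tendsto_nhds_unique ((hw 0).tendsto_at ⟨le_rfl, le_rfl⟩) ?_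
    simpa only [hW0] using hc.tendsto_P w₀

end WaveSystem

/-! ### Curves that lose one step of a scale with every derivative -/

theorem iteratedDerivWithin_clm_comp {E F : Type*} [NormedAddCommGroup E] [NormedSpace ℝ E]
    [NormedAddCommGroup F] [NormedSpace ℝ F] (A : E →L[ℝ] F) {f : ℝ → E} {s : Set ℝ} {k : ℕ}
    {t : ℝ} (hf : ContDiffWithinAt ℝ k f s t) (hs : UniqueDiffOn ℝ s) (ht : t ∈ s) :
    iteratedDerivWithin k (fun r ↦ A (f r)) s t = A (iteratedDerivWithin k f s t) := by
  have := A.iteratedFDerivWithin_comp_left hf hs ht le_rfl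
  rw [iteratedDerivWithin_eq_iteratedFDerivWithin, iteratedDerivWithin_eq_iteratedFDerivWithin]
  exact congrArg (fun m ↦ m fun _ ↦ (1 : ℝ)) this

section Curve

variable {H : Type*} [NormedAddCommGroup H] [NormedSpace ℝ H]

/-- The `k`-th derivative of `M ^ k V`. If `M` is the isometry of the `k`-th on the `(k + 1)`-st
space of a scale, this is the `k`-th derivative of `V` as a curve in the `k`-th space. -/
noncomputable def curveDeriv (M : H →L[ℝ] H) (k : ℕ) (V : ℝ → H) (t : ℝ) : H :=
  iteratedDerivWithin k (fun r ↦ (M ^ k) (V r)) (Ici 0) t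

/-- Curves that are `k` times continuously differentiable in the `k`-th space of the scale
given by `M`, for every `k`. -/
def IsSmoothCurve (M : H →L[ℝ] H) (V : ℝ → H) : Prop :=
  ∀ k : ℕ, ContDiffOn ℝ k (fun r ↦ (M ^ k) (V r)) (Ici 0)

variable {M : H →L[ℝ] H} {V W : ℝ → H}

theorem pow_succ_apply' (M : H →L[ℝ] H) (k : ℕ) (x : H) : (M ^ (k + 1)) x = (M ^ k) (M x) := by
  rw [pow_succ]
  rfl

theorem pow_add_apply (M : H →L[ℝ] H) (j k : ℕ) (x : H) :
    (M ^ (j + k)) x = (M ^ j) ((M ^ k) x) := by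
  rw [pow_add]
  rfl

theorem norm_pow_apply_le (hM : ∀ x, ‖M x‖ ≤ ‖x‖) (k : ℕ) (x : H) : ‖(M ^ k) x‖ ≤ ‖x‖ := by
  induction k generalizing x with
  | zero => simp
  | succ k ih =>
    rw [pow_succ_apply']
    exact (ih _).trans (hM x)

theorem curveDeriv_zero : curveDeriv M 0 V = V := by
  ext t
  simp [curveDeriv]

theorem curveDeriv_congr (h : ∀ t, 0 ≤ t → V t = W t) (k : ℕ) {t : ℝ} (ht : 0 ≤ t) :
    curveDeriv M k V t = curveDeriv M k W t :=
  iteratedDerivWithin_congr (fun r hr ↦ by rw [h r hr]) ht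

namespace IsSmoothCurve

theorem sub (hV : IsSmoothCurve M V) (hW : IsSmoothCurve M W) :
    IsSmoothCurve M (fun t ↦ V t - W t) := fun k ↦ by
  simpa only [map_sub] using! (hV k).sub (hW k)

theorem contDiffOn_pow_add (hV : IsSmoothCurve M V) (j k : ℕ) :
    ContDiffOn ℝ k (fun r ↦ (M ^ (j + k)) (V r)) (Ici 0) := by
  simpa only [pow_add_apply] using! (M ^ j).contDiff.comp_contDiffOn (hV k)

theorem map (hV : IsSmoothCurve M V) : IsSmoothCurve M (fun t ↦ M (V t)) := fun k ↦ by
  simpa only [← pow_succ_apply', add_comm] using hV.contDiffOn_pow_add 1 k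

theorem iteratedDerivWithin_pow_add (hV : IsSmoothCurve M V) (j k : ℕ) {t : ℝ} (ht : 0 ≤ t) :
    iteratedDerivWithin k (fun r ↦ (M ^ (j + k)) (V r)) (Ici 0) t =
      (M ^ j) (curveDeriv M k V t) := by
  simp only [pow_add_apply]
  exact iteratedDerivWithin_clm_comp _ (hV k t ht) (uniqueDiffOn_Ici 0) ht

theorem curveDeriv_sub (hV : IsSmoothCurve M V) (hW : IsSmoothCurve M W) (k : ℕ) {t : ℝ}
    (ht : 0 ≤ t) :
    curveDeriv M k (fun r ↦ V r - W r) t = curveDeriv M k V t - curveDeriv M k W t := by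
  simp only [curveDeriv, map_sub]
  exact iteratedDerivWithin_sub ht (uniqueDiffOn_Ici 0) (hV k t ht) (hW k t ht)

theorem curveDeriv_map (hV : IsSmoothCurve M V) (k : ℕ) {t : ℝ} (ht : 0 ≤ t) :
    curveDeriv M k (fun r ↦ M (V r)) t = M (curveDeriv M k V t) := by
  have := hV.iteratedDerivWithin_pow_add 1 k ht
  simpa only [add_comm 1 k, pow_succ_apply', pow_one] using! this

theorem const_smul (hV : IsSmoothCurve M V) (c : ℝ) : IsSmoothCurve M (fun t ↦ c • V t) :=
  fun k ↦ by simpa only [map_smul] using! (hV k).const_smul c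

theorem curveDeriv_const_smul (c : ℝ) (k : ℕ) {t : ℝ} :
    curveDeriv M k (fun r ↦ c • V r) t = c • curveDeriv M k V t := by
  simp only [curveDeriv, map_smul]
  exact iteratedDerivWithin_fun_const_smul_field c _

theorem smul {a : ℝ → ℝ} (ha : ContDiffOn ℝ ∞ a (Ici 0)) (hV : IsSmoothCurve M V) :
    IsSmoothCurve M (fun t ↦ a t • V t) := fun k ↦ by
  simpa only [map_smul] using! (ha.of_le (by exact_mod_cast le_top)).smul (hV k)

/-- In the Leibniz formula for `a • (M ^ k) V`, the factor `V` receives only `k - i` derivatives. It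
is thus already differentiable after `M ^ (k - i)`; the surplus `M ^ i` comes out as a contraction.
-/
theorem norm_curveDeriv_smul_le (hM : ∀ x, ‖M x‖ ≤ ‖x‖) {a : ℝ → ℝ}
    (ha : ContDiffOn ℝ ∞ a (Ici 0)) (hV : IsSmoothCurve M V) (k : ℕ) {t : ℝ} (ht : 0 ≤ t) :
    ‖curveDeriv M k (fun r ↦ a r • V r) t‖ ≤ ∑ i ∈ Finset.range (k + 1), (k.choose i : ℝ) *
      |iteratedDerivWithin i a (Ici 0) t| * ‖curveDeriv M (k - i) V t‖ := by
  have hak : ContDiffOn ℝ k a (Ici 0) := ha.of_le (by exact_mod_cast le_top)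
  have : curveDeriv M k (fun r ↦ a r • V r) t = ∑ i ∈ Finset.range (k + 1),
      k.choose i • iteratedDerivWithin i a (Ici 0) t •
        iteratedDerivWithin (k - i) (fun r ↦ (M ^ k) (V r)) (Ici 0) t := by
    rw [← iteratedDerivWithin_smul (mem_Ici.2 ht) (uniqueDiffOn_Ici 0) (hak t ht) (hV k t ht)]
    simp only [curveDeriv, map_smul]
    rfl
  rw [this]
  refine (norm_sum_le _ _).trans (Finset.sum_le_sum fun i hi ↦ ?_)
  have hik : i ≤ k := by simpa [Nat.lt_succ_iff] using hi
  have h := hV.iteratedDerivWithin_pow_add i (k - i) ht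
  rw [Nat.add_sub_cancel' hik] at h
  rw [h, ← Nat.cast_smul_eq_nsmul ℝ, norm_smul, norm_smul, Real.norm_natCast, Real.norm_eq_abs,
    mul_assoc]
  gcongr
  exact norm_pow_apply_le hM i _

theorem hasDerivWithinAt_pow (hV : IsSmoothCurve M V) (k : ℕ) {t : ℝ} (ht : 0 ≤ t) :
    HasDerivWithinAt (fun r ↦ (M ^ (k + 1)) (V r)) ((M ^ k) (curveDeriv M 1 V t)) (Ici 0) t := by
  have h := hV.contDiffOn_pow_add k 1
  have h1 := ((h.differentiableOn (by simp)) t ht).hasDerivWithinAt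
  rwa [← iteratedDerivWithin_one, hV.iteratedDerivWithin_pow_add k 1 ht] at h1

theorem hasDerivWithinAt (hV : IsSmoothCurve M V) {t : ℝ} (ht : 0 ≤ t) :
    HasDerivWithinAt (fun r ↦ M (V r)) (curveDeriv M 1 V t) (Ici 0) t := by
  simpa using hV.hasDerivWithinAt_pow 0 ht

theorem curveDeriv_one (hV : IsSmoothCurve M V) : IsSmoothCurve M (curveDeriv M 1 V) := fun k ↦ by
  refine ((hV (k + 1)).derivWithin (m := k) (uniqueDiffOn_Ici 0) (by norm_cast)).congr
    fun t ht ↦ ?_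
  exact ((hV.hasDerivWithinAt_pow k ht).derivWithin (uniqueDiffOn_Ici 0 t ht)).symm

theorem curveDeriv_curveDeriv_one (hV : IsSmoothCurve M V) (k : ℕ) {t : ℝ} (ht : 0 ≤ t) :
    curveDeriv M k (curveDeriv M 1 V) t = curveDeriv M (k + 1) V t := by
  rw [curveDeriv, curveDeriv, iteratedDerivWithin_succ']
  exact iteratedDerivWithin_congr (fun r hr ↦ ((hV.hasDerivWithinAt_pow k hr).derivWithin
    (uniqueDiffOn_Ici 0 r hr)).symm) ht

end IsSmoothCurve

/-- A bootstrap: `(M ^ (k + 1)) V` has derivative `(M ^ k) F`, which is `C^k` once all the `(M ^ k)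
V` are. A family indexed by `i` is used so that the coupled unknowns of a system gain regularity
together. -/
theorem isSmoothCurve_of_hasDerivWithinAt {V : ℕ → ℝ → H} {F : ℕ → ℝ → H}
    (h0 : ∀ i, ContinuousOn (V i) (Ici 0))
    (hd : ∀ i, ∀ t, 0 ≤ t → HasDerivWithinAt (fun r ↦ M (V i r)) (F i t) (Ici 0) t)
    (hF : ∀ k : ℕ, (∀ i, ContDiffOn ℝ k (fun r ↦ (M ^ k) (V i r)) (Ici 0)) →
      ∀ i, ContDiffOn ℝ k (fun r ↦ (M ^ k) (F i r)) (Ici 0)) (i : ℕ) :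
    IsSmoothCurve M (V i) := by
  intro k
  induction k generalizing i with
  | zero => simpa using h0 i
  | succ k ih =>
    have h : ∀ t, 0 ≤ t → HasDerivWithinAt (fun r ↦ (M ^ (k + 1)) (V i r)) ((M ^ k) (F i t))
        (Ici 0) t := fun t ht ↦ by
      simpa only [pow_succ_apply'] using!
        (M ^ k).hasFDerivAt.comp_hasDerivWithinAt t (hd i t ht)
    rw [Nat.cast_succ]
    refine (contDiffOn_succ_iff_derivWithin (uniqueDiffOn_Ici 0)).2
      ⟨fun t ht ↦ (h t ht).differentiableWithinAt, by simp, ?_⟩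
    exact (hF k ih i).congr fun t ht ↦ (h t ht).derivWithin (uniqueDiffOn_Ici 0 t ht)

/-- The bound for the derivatives of a solution of the wave equation `V'' + A V + a V' = q U'` that
is obtained by differentiating the equation. -/
theorem norm_curveDeriv_add_two_le (hM : ∀ x, ‖M x‖ ≤ ‖x‖) {κ : ℝ} {a q : ℝ → ℝ}
    (ha : ContDiffOn ℝ ∞ a (Ici 0)) (hq : ContDiffOn ℝ ∞ q (Ici 0)) {U : ℝ → H}
    (hV : IsSmoothCurve M V) (hU : IsSmoothCurve M U)
    (h : ∀ t, 0 ≤ t → curveDeriv M 2 V t + κ • (V t - M (M (V t))) + a t • M (curveDeriv M 1 V t) =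
      q t • M (curveDeriv M 1 U t)) (k : ℕ) {t : ℝ} (ht : 0 ≤ t) :
    ‖curveDeriv M (k + 2) V t‖ ≤ 2 * |κ| * ‖curveDeriv M k V t‖ +
      (∑ i ∈ Finset.range (k + 1), (k.choose i : ℝ) *
        |iteratedDerivWithin i a (Ici 0) t| * ‖curveDeriv M (k - i + 1) V t‖) +
      ∑ i ∈ Finset.range (k + 1), (k.choose i : ℝ) *
        |iteratedDerivWithin i q (Ici 0) t| * ‖curveDeriv M (k - i + 1) U t‖ := by
  have hV1 := hV.curveDeriv_one
  have hU1 := hU.curveDeriv_one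
  have hs := (hV.sub hV.map.map).const_smul κ
  have e1 : curveDeriv M (k + 2) V t = curveDeriv M k (fun r ↦ (q r • M (curveDeriv M 1 U r) -
      a r • M (curveDeriv M 1 V r)) - κ • (V r - M (M (V r)))) t := by
    rw [← hV.curveDeriv_curveDeriv_one _ ht, ← hV1.curveDeriv_curveDeriv_one _ ht]
    refine curveDeriv_congr (fun r hr ↦ ?_) k ht
    -- The equation is solved for the second derivative and then differentiated `k` times.
    rw [hV.curveDeriv_curveDeriv_one _ hr, ← h r hr]
    abel
  have hbound : ∀ {b : ℝ → ℝ} {Z : ℝ → H}, ContDiffOn ℝ ∞ b (Ici 0) → IsSmoothCurve M Z →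
      ‖curveDeriv M k (fun r ↦ b r • M (curveDeriv M 1 Z r)) t‖ ≤
        ∑ i ∈ Finset.range (k + 1), (k.choose i : ℝ) *
          |iteratedDerivWithin i b (Ici 0) t| * ‖curveDeriv M (k - i + 1) Z t‖ := by
    intro b Z hb hZ
    refine (hZ.curveDeriv_one.map.norm_curveDeriv_smul_le hM hb k ht).trans
      (Finset.sum_le_sum fun i _ ↦ ?_)
    rw [hZ.curveDeriv_one.curveDeriv_map _ ht, hZ.curveDeriv_curveDeriv_one _ ht]
    gcongr
    exact hM _
  have hb1 := hbound ha hV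
  have hb2 := hbound hq hU
  have hb3 : ‖curveDeriv M k (fun r ↦ κ • (V r - M (M (V r)))) t‖ ≤
      2 * |κ| * ‖curveDeriv M k V t‖ := by
    rw [IsSmoothCurve.curveDeriv_const_smul, hV.curveDeriv_sub hV.map.map _ ht,
      hV.map.curveDeriv_map _ ht, hV.curveDeriv_map _ ht, norm_smul, Real.norm_eq_abs]
    have := norm_sub_le (curveDeriv M k V t) (M (M (curveDeriv M k V t)))
    have h2 := (hM (M (curveDeriv M k V t))).trans (hM _)
    rw [mul_comm 2, mul_assoc]
    gcongr
    linarith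
  rw [e1, ((hU1.map.smul hq).sub (hV1.map.smul ha)).curveDeriv_sub hs _ ht,
    (hU1.map.smul hq).curveDeriv_sub (hV1.map.smul ha) _ ht]
  refine (norm_sub_le _ _).trans ?_
  have := norm_sub_le (curveDeriv M k (fun r ↦ q r • M (curveDeriv M 1 U r)) t)
    (curveDeriv M k (fun r ↦ a r • M (curveDeriv M 1 V r)) t)
  linarith

end Curve

/-! ### The first order system and the second order equation -/

section Wave

variable {H : Type*} [NormedAddCommGroup H] [InnerProductSpace ℝ H]
  {M : H →L[ℝ] H} {κ : ℝ} {a : ℝ → ℝ} {g V W : ℝ → H}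

theorem IsSmoothCurve.isWaveSystem (hV : IsSmoothCurve M V)
    (h : ∀ t, 0 ≤ t → curveDeriv M 2 V t + κ • (V t - M (M (V t))) + a t • M (curveDeriv M 1 V t) =
      M (g t)) : IsWaveSystem M κ a g V (curveDeriv M 1 V) := by
  refine ⟨fun t ht ↦ hV.hasDerivWithinAt ht, fun t ht ↦ ?_⟩
  have := hV.curveDeriv_one.hasDerivWithinAt ht
  rw [hV.curveDeriv_curveDeriv_one _ ht] at this
  refine this.congr_deriv ?_
  rw [← h t ht]
  simp only [Nat.reduceAdd]
  abel

theorem IsWaveSystem.isSmoothCurve (h : IsWaveSystem M κ a 0 V W)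
    (ha : ContDiffOn ℝ ∞ a (Ici 0)) (hV : ContinuousOn V (Ici 0)) (hW : ContinuousOn W (Ici 0)) :
    IsSmoothCurve M V ∧ (∀ t, 0 ≤ t → curveDeriv M 1 V t = W t) ∧
      ∀ t, 0 ≤ t → curveDeriv M 2 V t + κ • (V t - M (M (V t))) +
        a t • M (curveDeriv M 1 V t) = 0 := by
  set F : ℝ → H := fun t ↦ -(κ • (V t - M (M (V t)))) - a t • M (W t) with hF
  have hW' : ∀ t, 0 ≤ t → HasDerivWithinAt (fun r ↦ M (W r)) (F t) (Ici 0) t := fun t ht ↦ by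
    simpa only [Pi.zero_apply, map_zero, add_zero] using! h.hasDeriv_W t ht
  -- The pair `(V, W)` is encoded as a family with `V` at index `0` and `W` at every other index.
  have key := isSmoothCurve_of_hasDerivWithinAt (M := M) (V := fun i ↦ if i = 0 then V else W)
    (F := fun i ↦ if i = 0 then W else F) (fun i ↦ by split_ifs <;> assumption)
    (fun i t ht ↦ by
      split_ifs
      · exact h.hasDeriv_V t ht
      · exact hW' t ht)
    (fun k hk i ↦ by
      have hVk : ContDiffOn ℝ k (fun r ↦ (M ^ k) (V r)) (Ici 0) := by simpa using hk 0
      have hWk : ContDiffOn ℝ k (fun r ↦ (M ^ k) (W r)) (Ici 0) := by simpa using hk 1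
      have hak : ContDiffOn ℝ k a (Ici 0) := ha.of_le (by exact_mod_cast le_top)
      have hcomm : ∀ x, (M ^ k) (M x) = M ((M ^ k) x) := fun x ↦ by
        rw [← pow_succ_apply', pow_succ']
        rfl
      split_ifs
      · exact hWk
      · simp only [hF, map_sub, map_neg, map_smul, hcomm]
        exact ((hVk.sub (M.contDiff.comp_contDiffOn (M.contDiff.comp_contDiffOn hVk))).const_smul
          κ).neg.sub (hak.smul (M.contDiff.comp_contDiffOn hWk)))
  have hVs : IsSmoothCurve M V := by simpa using key 0
  have hWs : IsSmoothCurve M W := by simpa using key 1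
  have h1 : ∀ t, 0 ≤ t → curveDeriv M 1 V t = W t := fun t ht ↦
    (uniqueDiffOn_Ici (0 : ℝ) t ht).eq_deriv _ (hVs.hasDerivWithinAt ht) (h.hasDeriv_V t ht)
  refine ⟨hVs, h1, fun t ht ↦ ?_⟩
  have h2 : curveDeriv M 2 V t = F t := by
    rw [← hVs.curveDeriv_curveDeriv_one 1 ht, curveDeriv_congr h1 1 ht]
    exact (uniqueDiffOn_Ici (0 : ℝ) t ht).eq_deriv _ (hWs.hasDerivWithinAt ht) (hW' t ht)
  rw [h2, h1 t ht]
  simp only [hF]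
  abel

end Wave

/-! ### Moderate and negligible growth in `ε` -/

section Growth

open Asymptotics

variable {E F : Type*} [NormedAddCommGroup E] [NormedAddCommGroup F]

/-- Growth of at most a negative power of `ε` along the filter `l`. -/
def ModO (l : Filter (Idx × ℝ)) (f : Idx × ℝ → E) : Prop :=
  ∃ N : ℕ, f =O[l] fun p ↦ ((p.1 : ℝ)⁻¹) ^ N

/-- Decay faster than every power of `ε` along the filter `l`. -/
def NegO (l : Filter (Idx × ℝ)) (f : Idx × ℝ → E) : Prop :=
  ∀ N : ℕ, f =O[l] fun p ↦ (p.1 : ℝ) ^ N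

variable {l : Filter (Idx × ℝ)} {f : Idx × ℝ → E} {g : Idx × ℝ → F}

theorem isBigO_inv_pow {m n : ℕ} (h : m ≤ n) :
    (fun p : Idx × ℝ ↦ ((p.1 : ℝ)⁻¹) ^ m) =O[l] fun p ↦ ((p.1 : ℝ)⁻¹) ^ n :=
  .of_norm_le fun p ↦ by
    rw [Real.norm_of_nonneg (pow_nonneg (zero_le_one.trans (one_le_inv p.1)) _)]
    exact inv_pow_mono p.1 h

theorem isBigO_one_inv_pow (c : ℝ) (n : ℕ) :
    (fun _ : Idx × ℝ ↦ c) =O[l] fun p ↦ ((p.1 : ℝ)⁻¹) ^ n := by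
  have h := (isBigO_inv_pow (l := l) (Nat.zero_le n)).const_mul_left c
  simpa using h

theorem ModO.of_le (hg : ModO l g) (h : ∀ᶠ p in l, ‖f p‖ ≤ ‖g p‖) : ModO l f := by
  obtain ⟨N, hN⟩ := hg
  exact ⟨N, (IsBigO.of_bound' h).trans hN⟩

theorem NegO.of_le (hg : NegO l g) (h : ∀ᶠ p in l, ‖f p‖ ≤ ‖g p‖) : NegO l f :=
  fun N ↦ (IsBigO.of_bound' h).trans (hg N)

theorem ModO.mono {l' : Filter (Idx × ℝ)} (h : ModO l f) (hl : l' ≤ l) : ModO l' f :=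
  h.imp fun _ hN ↦ hN.mono hl

theorem NegO.mono {l' : Filter (Idx × ℝ)} (h : NegO l f) (hl : l' ≤ l) : NegO l' f :=
  fun N ↦ (h N).mono hl

theorem modO_const (c : ℝ) : ModO l fun _ ↦ c := ⟨0, isBigO_one_inv_pow c 0⟩

theorem ModO.norm (hf : ModO l f) : ModO l fun p ↦ ‖f p‖ := hf.of_le (by simp)

theorem NegO.norm (hf : NegO l f) : NegO l fun p ↦ ‖f p‖ := hf.of_le (by simp)

theorem NegO.modO (hf : NegO l f) : ModO l f := ⟨0, by simpa using hf 0⟩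

theorem negO_zero : NegO l fun _ ↦ (0 : E) := fun _ ↦ isBigO_zero _ _

theorem ModO.add {f' : Idx × ℝ → E} (hf : ModO l f) (hf' : ModO l f') :
    ModO l fun p ↦ f p + f' p := by
  obtain ⟨N, hN⟩ := hf
  obtain ⟨N', hN'⟩ := hf'
  exact ⟨N + N', (hN.trans (isBigO_inv_pow (Nat.le_add_right N N'))).add
    (hN'.trans (isBigO_inv_pow (Nat.le_add_left N' N)))⟩

theorem NegO.add {f' : Idx × ℝ → E} (hf : NegO l f) (hf' : NegO l f') :
    NegO l fun p ↦ f p + f' p := fun N ↦ (hf N).add (hf' N)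

theorem ModO.sum {ι : Type*} {s : Finset ι} {f : ι → Idx × ℝ → E}
    (h : ∀ i ∈ s, ModO l (f i)) : ModO l fun p ↦ ∑ i ∈ s, f i p := by
  classical
  induction s using Finset.induction_on with
  | empty => simpa using negO_zero.modO
  | insert i s hi ih =>
    simp only [Finset.sum_insert hi]
    exact (h i (by simp)).add (ih fun j hj ↦ h j (by simp [hj]))

theorem NegO.sum {ι : Type*} {s : Finset ι} {f : ι → Idx × ℝ → E}
    (h : ∀ i ∈ s, NegO l (f i)) : NegO l fun p ↦ ∑ i ∈ s, f i p :=
  fun N ↦ IsBigO.fun_sum fun i hi ↦ h i hi N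

theorem ModO.mul {f g : Idx × ℝ → ℝ} (hf : ModO l f) (hg : ModO l g) :
    ModO l fun p ↦ f p * g p := by
  obtain ⟨N, hN⟩ := hf
  obtain ⟨N', hN'⟩ := hg
  exact ⟨N + N', by simpa only [pow_add] using hN.mul hN'⟩

theorem NegO.mul_modO {f g : Idx × ℝ → ℝ} (hf : NegO l f) (hg : ModO l g) :
    NegO l fun p ↦ f p * g p := by
  obtain ⟨N, hN⟩ := hg
  intro m
  refine ((hf (m + N)).mul hN).congr_right fun p ↦ ?_
  have : (p.1 : ℝ) ≠ 0 := p.1.2.1.ne'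
  rw [pow_add, mul_assoc, ← mul_pow, mul_inv_cancel₀ this, one_pow, mul_one]

theorem ModO.mul_negO {f g : Idx × ℝ → ℝ} (hf : ModO l f) (hg : NegO l g) :
    NegO l fun p ↦ f p * g p := by
  simpa only [mul_comm] using hg.mul_modO hf

theorem modO_principal_iff {S : Set Idx} {K : Set ℝ} : ModO (𝓟 (S ×ˢ K)) f ↔
    ∃ N : ℕ, ∃ c : ℝ, 0 < c ∧ ∀ ε ∈ S, ∀ t ∈ K, ‖f (ε, t)‖ ≤ c * ((ε : ℝ)⁻¹) ^ N := by
  refine exists_congr fun N ↦ ?_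
  rw [isBigO_principal]
  constructor
  · rintro ⟨c, hc⟩
    refine ⟨max c 1, by positivity, fun ε hε t ht ↦ (hc (ε, t) ⟨hε, ht⟩).trans ?_⟩
    have h0 : 0 ≤ ((ε : ℝ)⁻¹) ^ N := pow_nonneg (zero_le_one.trans (one_le_inv ε)) _
    rw [Real.norm_of_nonneg h0]
    gcongr
    exact le_max_left _ _
  · rintro ⟨c, _, hc⟩
    refine ⟨c, fun p hp ↦ (hc p.1 hp.1 p.2 hp.2).trans_eq ?_⟩
    rw [Real.norm_of_nonneg (pow_nonneg (zero_le_one.trans (one_le_inv p.1)) _)]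

theorem negO_principal_iff {S : Set Idx} {K : Set ℝ} : NegO (𝓟 (S ×ˢ K)) f ↔
    ∀ N : ℕ, ∃ c : ℝ, 0 < c ∧ ∀ ε ∈ S, ∀ t ∈ K, ‖f (ε, t)‖ ≤ c * (ε : ℝ) ^ N := by
  refine forall_congr' fun N ↦ ?_
  rw [isBigO_principal]
  constructor
  · rintro ⟨c, hc⟩
    refine ⟨max c 1, by positivity, fun ε hε t ht ↦ (hc (ε, t) ⟨hε, ht⟩).trans ?_⟩
    have h0 : 0 ≤ (ε : ℝ) ^ N := pow_nonneg ε.2.1.le _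
    rw [Real.norm_of_nonneg h0]
    gcongr
    exact le_max_left _ _
  · rintro ⟨c, _, hc⟩
    refine ⟨c, fun p hp ↦ (hc p.1 hp.1 p.2 hp.2).trans_eq ?_⟩
    rw [Real.norm_of_nonneg (pow_nonneg p.1.2.1.le _)]

/-- A moderate function is negligible if it is so for small `ε`. -/
theorem NegO.of_small {K : Set ℝ} {ε₀ : ℝ} (hε₀ : 0 < ε₀) (hm : ModO (𝓟 (univ ×ˢ K)) f)
    (hn : NegO (𝓟 ({ε : Idx | (ε : ℝ) < ε₀} ×ˢ K)) f) : NegO (𝓟 (univ ×ˢ K)) f := by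
  rw [negO_principal_iff] at hn ⊢
  obtain ⟨m, d, hd, hm⟩ := modO_principal_iff.1 hm
  intro N
  obtain ⟨c, hc, hn⟩ := hn N
  -- For `ε ≥ ε₀` the moderate bound is at most `d ε₀⁻ᵐ`, and `1 ≤ (ε / ε₀) ^ N` inserts any
  -- required power of `ε`.
  refine ⟨c + d * (ε₀⁻¹) ^ m * (ε₀⁻¹) ^ N, by positivity, fun ε _ t ht ↦ ?_⟩
  have hε : 0 < (ε : ℝ) := ε.2.1
  rcases lt_or_ge (ε : ℝ) ε₀ with h | h
  · refine (hn ε h t ht).trans ?_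
    gcongr
    have : 0 ≤ d * (ε₀⁻¹) ^ m * (ε₀⁻¹) ^ N := by positivity
    linarith
  · have h1 : ((ε : ℝ)⁻¹) ^ m ≤ (ε₀⁻¹) ^ m := by gcongr
    have h2 : 1 ≤ (ε₀⁻¹) ^ N * (ε : ℝ) ^ N := by
      rw [← mul_pow]
      refine one_le_pow₀ ?_
      rw [inv_mul_eq_div]
      exact (one_le_div hε₀).2 h
    calc _ ≤ d * ((ε : ℝ)⁻¹) ^ m := hm ε trivial t ht
      _ ≤ d * (ε₀⁻¹) ^ m * 1 := by rw [mul_one]; gcongr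
      _ ≤ d * (ε₀⁻¹) ^ m * ((ε₀⁻¹) ^ N * (ε : ℝ) ^ N) := by gcongr
      _ ≤ _ := by
        rw [add_mul, ← mul_assoc]
        exact le_add_of_nonneg_left (by positivity)

/-! ### Nets of scalar functions -/

/-- All derivatives of the net `f` are moderate along `l`. -/
def ModD (l : Filter (Idx × ℝ)) (f : Idx → ℝ → ℝ) : Prop :=
  ∀ k, ModO l fun p ↦ iteratedDerivWithin k (f p.1) (Ici 0) p.2

/-- All derivatives of the net `f` are negligible along `l`. -/
def NegD (l : Filter (Idx × ℝ)) (f : Idx → ℝ → ℝ) : Prop :=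
  ∀ k, NegO l fun p ↦ iteratedDerivWithin k (f p.1) (Ici 0) p.2

variable {φ χ : Idx → ℝ → ℝ}

theorem NegD.add (hl : ∀ᶠ p in l, 0 ≤ p.2) (hφ : ∀ ε, ContDiffOn ℝ ∞ (φ ε) (Ici 0))
    (hχ : ∀ ε, ContDiffOn ℝ ∞ (χ ε) (Ici 0)) (h : NegD l φ) (h' : NegD l χ) :
    NegD l (φ + χ) := fun k ↦ ((h k).add (h' k)).of_le <| by
  filter_upwards [hl] with p hp
  rw [Pi.add_apply, iteratedDerivWithin_add (mem_Ici.2 hp) (uniqueDiffOn_Ici 0)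
    (contDiffOn_nat (hφ p.1) k _ hp) (contDiffOn_nat (hχ p.1) k _ hp)]

theorem ModD.mul (hl : ∀ᶠ p in l, 0 ≤ p.2) (hφ : ∀ ε, ContDiffOn ℝ ∞ (φ ε) (Ici 0))
    (hχ : ∀ ε, ContDiffOn ℝ ∞ (χ ε) (Ici 0)) (h : ModD l φ) (h' : ModD l χ) :
    ModD l (φ * χ) := fun k ↦
  (ModO.sum (s := Finset.range (k + 1)) fun i _ ↦
    ((modO_const (k.choose i : ℝ)).mul (h i).norm).mul (h' (k - i)).norm).of_le <| by
  filter_upwards [hl] with p hp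
  exact (abs_iteratedDerivWithin_mul_le (hφ p.1) (hχ p.1) k hp).trans (le_abs_self _)

theorem NegD.mul_modD (hl : ∀ᶠ p in l, 0 ≤ p.2) (hφ : ∀ ε, ContDiffOn ℝ ∞ (φ ε) (Ici 0))
    (hχ : ∀ ε, ContDiffOn ℝ ∞ (χ ε) (Ici 0)) (h : NegD l φ) (h' : ModD l χ) :
    NegD l (φ * χ) := fun k ↦
  (NegO.sum (s := Finset.range (k + 1)) fun i _ ↦
    ((modO_const (k.choose i : ℝ)).mul_negO (h i).norm).mul_modO (h' (k - i)).norm).of_le <| by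
  filter_upwards [hl] with p hp
  exact (abs_iteratedDerivWithin_mul_le (hφ p.1) (hχ p.1) k hp).trans (le_abs_self _)

/-- The inverse of a moderate net that is bounded from below is moderate. -/
theorem ModD.inv (hl : ∀ᶠ p in l, 0 ≤ p.2) (hφ : ∀ ε, ContDiffOn ℝ ∞ (φ ε) (Ici 0))
    (h0 : ∀ ε t, 0 ≤ t → φ ε t ≠ 0) {c : ℝ} (hc : 0 < c) (hb : ∀ᶠ p in l, c ≤ |φ p.1 p.2|)
    (h : ModD l φ) : ModD l (φ⁻¹) := by
  have hinv : ∀ ε, ContDiffOn ℝ ∞ (φ⁻¹ ε) (Ici 0) := fun ε ↦ (hφ ε).inv (h0 ε)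
  have hbd : ModO l fun p ↦ φ⁻¹ p.1 p.2 := (modO_const c⁻¹).of_le <| by
    filter_upwards [hb] with p hp
    simp only [Pi.inv_apply, norm_inv, Real.norm_eq_abs, abs_of_pos hc]
    gcongr
  intro k
  induction k using Nat.strong_induction_on with
  | _ k ih =>
    have hs : ModO l fun p ↦ ∑ i ∈ Finset.range k, (k.choose (i + 1) : ℝ) *
        iteratedDerivWithin (i + 1) (φ p.1) (Ici 0) p.2 *
          iteratedDerivWithin (k - (i + 1)) (φ⁻¹ p.1) (Ici 0) p.2 := by
      refine ModO.sum fun i hi ↦ ((modO_const _).mul (h (i + 1))).mul (ih _ ?_)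
      have := Finset.mem_range.1 hi
      omega
    -- The Leibniz formula for `φ φ⁻¹ = 1` is solved for the `k`-th derivative of `φ⁻¹`; the left
    -- side of that formula is `1` for `k = 0` and `0` otherwise, and all other derivatives of `φ⁻¹`
    -- in it have lower order.
    have hk : ModO l fun p ↦ φ⁻¹ p.1 p.2 * ((if k = 0 then 1 else 0) +
        -1 * ∑ i ∈ Finset.range k, (k.choose (i + 1) : ℝ) *
        iteratedDerivWithin (i + 1) (φ p.1) (Ici 0) p.2 *
          iteratedDerivWithin (k - (i + 1)) (φ⁻¹ p.1) (Ici 0) p.2) :=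
      hbd.mul ((modO_const _).add ((modO_const _).mul hs))
    refine hk.of_le ?_
    filter_upwards [hl] with p hp
    have h1 := iteratedDerivWithin_mul (mem_Ici.2 hp) (uniqueDiffOn_Ici 0)
      (contDiffOn_nat (hφ p.1) k _ hp) (contDiffOn_nat (hinv p.1) k _ hp)
    have h2 : iteratedDerivWithin k (φ p.1 * φ⁻¹ p.1) (Ici 0) p.2 = if k = 0 then 1 else 0 := by
      rw [← iteratedDerivWithin_const (𝕜 := ℝ) (s := Ici 0) (x := p.2)]
      exact iteratedDerivWithin_congr (fun t ht ↦ mul_inv_cancel₀ (h0 p.1 t ht)) hp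
    rw [Finset.sum_range_succ', h2] at h1
    have h3 := h0 p.1 p.2 hp
    simp only [Nat.choose_zero_right, Nat.cast_one, one_mul, iteratedDerivWithin_zero,
      Nat.sub_zero] at h1
    rw [h1, neg_one_mul, add_neg_cancel_comm, ← mul_assoc, Pi.inv_apply, Pi.inv_apply,
      inv_mul_cancel₀ h3, one_mul]

/-- The exponent `N + k` of the definition may be replaced by `N`, because `N` is allowed to depend
on `k`; compact sets may be replaced by intervals `[0, T]`. -/
theorem isModerate_iff : IsModerate φ ↔ (∀ ε, ContDiffOn ℝ ∞ (φ ε) (Ici 0)) ∧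
    ∀ T : ℝ, ModD (𝓟 (univ ×ˢ Icc 0 T)) φ := by
  refine and_congr_right fun _ ↦ ⟨fun h T k ↦ ?_, fun h K hK hK0 k ↦ ?_⟩
  · obtain ⟨N, c, hc, h⟩ := h (Icc 0 T) isCompact_Icc Icc_subset_Ici_self k
    exact modO_principal_iff.2 ⟨N + k, c, hc, fun ε _ t ht ↦ h ε t ht⟩
  · obtain ⟨T, hT⟩ := hK.bddAbove
    obtain ⟨N, c, hc, h⟩ := modO_principal_iff.1 (h T k)
    refine ⟨N, c, hc, fun ε t ht ↦ (h ε trivial t ⟨hK0 ht, hT ht⟩).trans ?_⟩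
    exact mul_le_mul_of_nonneg_left (inv_pow_mono ε (Nat.le_add_right N k)) hc.le

theorem IsNegligible.negD (h : IsNegligible φ) (T : ℝ) : NegD (𝓟 (univ ×ˢ Icc 0 T)) φ := by
  intro k
  refine negO_principal_iff.2 fun N ↦ ?_
  obtain ⟨c, hc, h⟩ := h (Icc 0 T) isCompact_Icc Icc_subset_Ici_self k N
  exact ⟨c, hc, fun ε _ t ht ↦ h ε t ht⟩

/-! ### Nets of curves -/

variable {n : ℕ} {s : ℝ} {u : Idx → ℝ → Sobolev n s}

theorem isModerateH_iff : IsModerateH u ↔ IsSmoothNet u ∧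
    ∀ (T : ℝ) (k : ℕ), ModO (𝓟 (univ ×ˢ Icc 0 T)) fun p ↦ timeDeriv k (u p.1) p.2 := by
  refine and_congr_right fun _ ↦ ⟨fun h T k ↦ ?_, fun h K hK hK0 k ↦ ?_⟩
  · obtain ⟨N, c, hc, h⟩ := h (Icc 0 T) isCompact_Icc Icc_subset_Ici_self k
    exact modO_principal_iff.2 ⟨N + k, c, hc, fun ε _ t ht ↦ h ε t ht⟩
  · obtain ⟨T, hT⟩ := hK.bddAbove
    obtain ⟨N, c, hc, h⟩ := modO_principal_iff.1 (h T k)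
    refine ⟨N, c, hc, fun ε t ht ↦ (h ε trivial t ⟨hK0 ht, hT ht⟩).trans ?_⟩
    exact mul_le_mul_of_nonneg_left (inv_pow_mono ε (Nat.le_add_right N k)) hc.le

theorem isNegligibleH_of_negO
    (h : ∀ (T : ℝ) (k : ℕ), NegO (𝓟 (univ ×ˢ Icc 0 T)) fun p ↦ timeDeriv k (u p.1) p.2) :
    IsNegligibleH u := by
  intro K hK hK0 k N
  obtain ⟨T, hT⟩ := hK.bddAbove
  obtain ⟨c, hc, h⟩ := negO_principal_iff.1 (h T k) N
  exact ⟨c, hc, fun ε t ht ↦ h ε trivial t ⟨hK0 ht, hT ht⟩⟩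

variable {H : Type*} [NormedAddCommGroup H] [NormedSpace ℝ H] {M : H →L[ℝ] H} {κ : ℝ}
  {a q : Idx → ℝ → ℝ} {V U : Idx → ℝ → H}

/-- The equation expresses the derivative of order `k + 2` by those of orders up to `k + 1`, with
moderate coefficients. So the bounds on `V` and its first derivative propagate to all orders. -/
theorem modO_curveDeriv (hM : ∀ x, ‖M x‖ ≤ ‖x‖) (hl : ∀ᶠ p in l, 0 ≤ p.2)
    (ha : ∀ ε, ContDiffOn ℝ ∞ (a ε) (Ici 0)) (hV : ∀ ε, IsSmoothCurve M (V ε))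
    (h : ∀ ε t, 0 ≤ t → curveDeriv M 2 (V ε) t + κ • (V ε t - M (M (V ε t))) +
      a ε t • M (curveDeriv M 1 (V ε) t) = 0)
    (hal : ModD l a) (h0 : ModO l fun p ↦ V p.1 p.2)
    (h1 : ModO l fun p ↦ curveDeriv M 1 (V p.1) p.2) (k : ℕ) :
    ModO l fun p ↦ curveDeriv M k (V p.1) p.2 := by
  induction k using Nat.strong_induction_on with
  | _ k ih =>
    match k with
    | 0 => simpa only [curveDeriv_zero] using h0
    | 1 => exact h1
    | k + 2 =>
      refine (((modO_const (2 * |κ|)).mul (ih k (by omega)).norm).add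
        (ModO.sum (s := Finset.range (k + 1)) fun i hi ↦ ((modO_const (k.choose i : ℝ)).mul
          (hal i).norm).mul (ih (k - i + 1) (by omega)).norm)).of_le ?_
      filter_upwards [hl] with p hp
      -- The homogeneous equation is the case of the source coefficient `0`.
      refine (norm_curveDeriv_add_two_le hM (ha p.1) contDiffOn_const (hV p.1) (hV p.1)
        (q := fun _ ↦ 0) (fun t ht ↦ by rw [h p.1 t ht, zero_smul]) k hp).trans ?_
      simp only [iteratedDerivWithin_fun_const_zero, abs_zero, mul_zero, zero_mul,
        Finset.sum_const_zero, add_zero]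
      exact le_abs_self _

/-- The recursion is the same as in the moderate case; the source is a negligible coefficient times
a moderate curve and hence stays negligible under differentiation. -/
theorem negO_curveDeriv (hM : ∀ x, ‖M x‖ ≤ ‖x‖) (hl : ∀ᶠ p in l, 0 ≤ p.2)
    (ha : ∀ ε, ContDiffOn ℝ ∞ (a ε) (Ici 0)) (hq : ∀ ε, ContDiffOn ℝ ∞ (q ε) (Ici 0))
    (hV : ∀ ε, IsSmoothCurve M (V ε)) (hU : ∀ ε, IsSmoothCurve M (U ε))
    (h : ∀ ε t, 0 ≤ t → curveDeriv M 2 (V ε) t + κ • (V ε t - M (M (V ε t))) +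
      a ε t • M (curveDeriv M 1 (V ε) t) = q ε t • M (curveDeriv M 1 (U ε) t))
    (hal : ModD l a) (hql : NegD l q) (hUl : ∀ k, ModO l fun p ↦ curveDeriv M k (U p.1) p.2)
    (h0 : NegO l fun p ↦ V p.1 p.2)
    (h1 : NegO l fun p ↦ curveDeriv M 1 (V p.1) p.2) (k : ℕ) :
    NegO l fun p ↦ curveDeriv M k (V p.1) p.2 := by
  induction k using Nat.strong_induction_on with
  | _ k ih =>
    match k with
    | 0 => simpa only [curveDeriv_zero] using h0
    | 1 => exact h1
    | k + 2 =>
      refine ((((modO_const (2 * |κ|)).mul_negO (ih k (by omega)).norm).add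
        (NegO.sum (s := Finset.range (k + 1)) fun i hi ↦ ((modO_const (k.choose i : ℝ)).mul
          (hal i).norm).mul_negO (ih (k - i + 1) (by omega)).norm)).add
        (NegO.sum (s := Finset.range (k + 1)) fun i hi ↦ ((modO_const (k.choose i : ℝ)).mul_negO
          (hql i).norm).mul_modO (hUl (k - i + 1)).norm)).of_le ?_
      filter_upwards [hl] with p hp
      exact (norm_curveDeriv_add_two_le hM (ha p.1) (hq p.1) (hV p.1) (hU p.1)
        (h p.1) k hp).trans (le_abs_self _)

end Growth

end VeryWeak

noncomputable section

namespace VeryWeak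

/-! ### Multiplication operators on `L²` and frequency cutoffs -/

section Multiplication

open scoped RealInnerProductSpace

variable {n : ℕ}

/-- The space `L²(ℝⁿ)`. -/
abbrev L2 (n : ℕ) : Type := Lp ℂ 2 (volume : Measure (Euc n))

/-- Multiplication by a bounded real function on `L²`. -/
def mulOp {m : Euc n → ℝ} (hm : MemLp (fun x ↦ (m x : ℂ)) ∞) : L2 n →L[ℝ] L2 n :=
  (ContinuousLinearMap.mul ℝ ℂ).holderL volume ∞ 2 2 (hm.toLp _)

variable {m m' m'' : Euc n → ℝ} (hm : MemLp (fun x ↦ (m x : ℂ)) ∞)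
  (hm' : MemLp (fun x ↦ (m' x : ℂ)) ∞) (hm'' : MemLp (fun x ↦ (m'' x : ℂ)) ∞)

theorem coeFn_mulOp (f : L2 n) : mulOp hm f =ᵐ[volume] fun x ↦ (m x : ℂ) * f x := by
  filter_upwards [(ContinuousLinearMap.mul ℝ ℂ).coeFn_holder (r := 2) (hm.toLp _) f,
    hm.coeFn_toLp] with x h1 h2
  refine h1.trans ?_
  rw [h2]
  rfl

theorem mulOp_eq_smul (f : L2 n) : mulOp hm f = hm.toLp _ • f := by
  ext1
  filter_upwards [Lp.coeFn_lpSMul (r := 2) (hm.toLp _) f, hm.coeFn_toLp, coeFn_mulOp hm f]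
    with x h1 h2 h3
  rw [h1, Pi.smul_apply', h2, h3, smul_eq_mul]

theorem mulOp_mulOp (h : ∀ x, m x * m' x = m'' x) (f : L2 n) :
    mulOp hm (mulOp hm' f) = mulOp hm'' f := by
  ext1
  filter_upwards [coeFn_mulOp hm (mulOp hm' f), coeFn_mulOp hm' f, coeFn_mulOp hm'' f]
    with x h1 h2 h3
  rw [h1, h2, h3, ← h, Complex.ofReal_mul, mul_assoc]

theorem inner_mulOp (f g : L2 n) : ⟪mulOp hm f, g⟫ = ⟪f, mulOp hm g⟫ := by
  rw [L2.inner_def, L2.inner_def]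
  refine integral_congr_ae ?_
  filter_upwards [coeFn_mulOp hm f, coeFn_mulOp hm g] with x h1 h2
  rw [h1, h2, ← Complex.real_smul, ← Complex.real_smul, real_inner_smul_left,
    real_inner_smul_right]

theorem norm_mulOp_le (h : ∀ x, |m x| ≤ 1) (f : L2 n) : ‖mulOp hm f‖ ≤ ‖f‖ := by
  refine Lp.norm_le_norm_of_ae_le ?_
  filter_upwards [coeFn_mulOp hm f] with x h1
  rw [h1, norm_mul, Complex.norm_real, Real.norm_eq_abs]
  exact mul_le_of_le_one_left (norm_nonneg _) (h x)

theorem memLp_top_of_abs_le (hm : Measurable m) {C : ℝ} (h : ∀ x, |m x| ≤ C) :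
    MemLp (fun x ↦ (m x : ℂ)) ∞ :=
  memLp_top_of_bound (by fun_prop) C (ae_of_all _ fun x ↦ by simpa using h x)

/-- Dominated convergence for `∫ (1 - p j)² ‖f‖²`, with majorant `‖f‖²`. -/
theorem tendsto_mulOp {p : ℕ → Euc n → ℝ} (hp : ∀ j, MemLp (fun x ↦ (p j x : ℂ)) ∞)
    (h0 : ∀ j x, 0 ≤ p j x) (h1 : ∀ j x, p j x ≤ 1)
    (hlim : ∀ x, ∀ᶠ j in atTop, p j x = 1) (f : L2 n) :
    Tendsto (fun j ↦ mulOp (hp j) f) atTop (𝓝 f) := by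
  rw [tendsto_iff_norm_sub_tendsto_zero]
  have hsq : Tendsto (fun j ↦ ‖mulOp (hp j) f - f‖ ^ 2) atTop (𝓝 0) := by
    have he : ∀ j, ‖mulOp (hp j) f - f‖ ^ 2 = ∫ x, (1 - p j x) ^ 2 * ‖f x‖ ^ 2 := by
      intro j
      rw [← real_inner_self_eq_norm_sq, L2.inner_def]
      refine integral_congr_ae ?_
      filter_upwards [Lp.coeFn_sub (mulOp (hp j) f) f, coeFn_mulOp (hp j) f] with x h2 h3
      rw [h2, Pi.sub_apply, h3, real_inner_self_eq_norm_sq, ← sub_one_mul, norm_mul, mul_pow,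
        ← Complex.ofReal_one, ← Complex.ofReal_sub, Complex.norm_real, Real.norm_eq_abs, sq_abs]
      ring
    simp only [he]
    have hi : Integrable fun x ↦ ‖f x‖ ^ 2 := (Lp.memLp f).integrable_norm_pow (by simp)
    rw [← integral_zero (Euc n) ℝ]
    refine tendsto_integral_of_dominated_convergence (fun x ↦ ‖f x‖ ^ 2) (fun j ↦ ?_) hi
      (fun j ↦ ae_of_all _ fun x ↦ ?_) (ae_of_all _ fun x ↦ ?_)
    · have : AEStronglyMeasurable (fun x ↦ (p j x : ℂ).re) volume :=
        Complex.continuous_re.comp_aestronglyMeasurable (hp j).1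
      simp only [Complex.ofReal_re] at this
      exact ((aestronglyMeasurable_const.sub this).pow 2).mul hi.1
    · rw [Real.norm_of_nonneg (by positivity)]
      refine mul_le_of_le_one_left (by positivity) ?_
      have := h0 j x
      have := h1 j x
      rw [sq_le_one_iff₀ (by linarith)]
      linarith
    · refine tendsto_const_nhds.congr' ?_
      filter_upwards [hlim x] with j hj
      rw [hj]
      simp
  have := hsq.sqrt
  simpa using this

/-- The function `⟨ξ⟩⁻¹`. -/
def invBracket (x : Euc n) : ℝ := (1 + ‖x‖ ^ 2) ^ ((-1 : ℝ) / 2)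

theorem invBracket_pos (x : Euc n) : 0 < invBracket x := by
  unfold invBracket
  positivity

theorem invBracket_le_one (x : Euc n) : invBracket x ≤ 1 :=
  Real.rpow_le_one_of_one_le_of_nonpos (by simp) (by norm_num)

theorem measurable_invBracket : Measurable (invBracket (n := n)) := by
  unfold invBracket
  fun_prop

theorem memLp_invBracket : MemLp (fun x : Euc n ↦ (invBracket x : ℂ)) ∞ :=
  memLp_top_of_abs_le measurable_invBracket (C := 1) fun x ↦ by
    rw [abs_of_pos (invBracket_pos x)]
    exact invBracket_le_one x

/-- The set of frequencies with `⟨ξ⟩ ≤ j + 1`. -/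
def lowFreq (n j : ℕ) : Set (Euc n) := {x | (invBracket x)⁻¹ ≤ j + 1}

theorem measurableSet_lowFreq (j : ℕ) : MeasurableSet (lowFreq n j) :=
  measurableSet_le measurable_invBracket.inv measurable_const

/-- The indicator function of `⟨ξ⟩ ≤ j + 1`. -/
def lowCut (n j : ℕ) (x : Euc n) : ℝ := (lowFreq n j).indicator (fun _ ↦ 1) x

/-- The function `⟨ξ⟩`, cut off to `⟨ξ⟩ ≤ j + 1`. -/
def bracketCut (n j : ℕ) (x : Euc n) : ℝ := (lowFreq n j).indicator (fun x ↦ (invBracket x)⁻¹) x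

theorem measurable_lowCut (j : ℕ) : Measurable (lowCut n j) :=
  measurable_const.indicator (measurableSet_lowFreq j)

theorem memLp_lowCut (j : ℕ) : MemLp (fun x : Euc n ↦ (lowCut n j x : ℂ)) ∞ :=
  memLp_top_of_abs_le (measurable_lowCut j) (C := 1) fun x ↦ by
    by_cases h : x ∈ lowFreq n j <;> simp [lowCut, h]

theorem memLp_bracketCut (j : ℕ) : MemLp (fun x : Euc n ↦ (bracketCut n j x : ℂ)) ∞ :=
  memLp_top_of_abs_le (measurable_invBracket.inv.indicator (measurableSet_lowFreq j))
    (C := j + 1) fun x ↦ by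
    rw [bracketCut]
    by_cases h : x ∈ lowFreq n j
    · rw [indicator_of_mem h, abs_of_pos (inv_pos.2 (invBracket_pos x))]
      exact h
    · rw [indicator_of_notMem h, abs_zero]
      positivity

/-- The operator `⟨D⟩⁻¹` on the Fourier side. -/
def bracketInv (n : ℕ) : L2 n →L[ℝ] L2 n := mulOp memLp_invBracket

theorem isCutoff_bracketInv (n : ℕ) : IsCutoff (bracketInv n)
    (fun j ↦ mulOp (memLp_lowCut j)) (fun j ↦ mulOp (memLp_bracketCut j)) where
  norm_M_le := norm_mulOp_le _ fun x ↦ by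
    rw [abs_of_pos (invBracket_pos x)]
    exact invBracket_le_one x
  symm_P j := inner_mulOp _
  symm_B j := inner_mulOp _
  B_M j := mulOp_mulOp _ _ _ fun x ↦ by
    by_cases h : x ∈ lowFreq n j <;> simp [lowCut, bracketCut, h, (invBracket_pos x).ne']
  M_B j := mulOp_mulOp _ _ _ fun x ↦ by
    by_cases h : x ∈ lowFreq n j <;> simp [lowCut, bracketCut, h, (invBracket_pos x).ne']
  M_P j f := by
    have hC : MemLp (fun x : Euc n ↦ ((invBracket x * lowCut n j x : ℝ) : ℂ)) ∞ := by
      refine memLp_top_of_abs_le (measurable_invBracket.mul (measurable_lowCut j)) (C := 1)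
        fun x ↦ ?_
      by_cases h : x ∈ lowFreq n j
      · simpa [lowCut, h, abs_of_pos (invBracket_pos x)] using invBracket_le_one x
      · simp [lowCut, h]
    rw [bracketInv, mulOp_mulOp _ _ hC fun x ↦ rfl, mulOp_mulOp _ _ hC fun x ↦ mul_comm _ _]
  P_P j := mulOp_mulOp _ _ _ fun x ↦ by
    by_cases h : x ∈ lowFreq n j <;> simp [lowCut, h]
  P_B j := mulOp_mulOp _ _ _ fun x ↦ by
    by_cases h : x ∈ lowFreq n j <;> simp [lowCut, bracketCut, h]
  tendsto_P := tendsto_mulOp _ (fun j x ↦ indicator_nonneg (fun _ _ ↦ zero_le_one) x)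
    (fun j x ↦ indicator_le_self' (fun _ _ ↦ zero_le_one) x) fun x ↦ by
    obtain ⟨N, hN⟩ := exists_nat_ge (invBracket x)⁻¹
    filter_upwards [eventually_ge_atTop N] with j hj
    have : x ∈ lowFreq n j := hN.trans (by
      have : (N : ℝ) ≤ j := by exact_mod_cast hj
      linarith)
    simp [lowCut, this]

end Multiplication

/-! ### Sobolev spaces and the Cauchy problem on the Fourier side -/

section FourierSide

open FourierTransform TemperedDistribution

variable {n : ℕ}

/-- The distribution `⟨D⟩⁻ˢ 𝓕⁻¹ h`. -/
def sobDist (n : ℕ) (s : ℝ) : L2 n →ₗ[ℂ] 𝓢'(Euc n, ℂ) :=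
  (besselPotential (Euc n) ℂ (-s)).toLinearMap ∘ₗ
    (Lp.toTemperedDistributionCLM ℂ (volume : Measure (Euc n)) 2).toLinearMap ∘ₗ
    (Lp.fourierTransformₗᵢ (Euc n) ℂ).symm.toLinearEquiv.toLinearMap

theorem sobDist_apply (s : ℝ) (h : L2 n) : sobDist n s h =
    besselPotential (Euc n) ℂ (-s) (𝓕⁻ h : L2 n) := rfl

theorem besselPotential_sobDist (s : ℝ) (h : L2 n) :
    besselPotential (Euc n) ℂ s (sobDist n s h) = (𝓕⁻ h : L2 n) := by
  rw [sobDist_apply, besselPotential_besselPotential_apply]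
  simp

theorem sobDist_injective (s : ℝ) : Function.Injective (sobDist n s) := by
  intro h h' he
  have := congrArg (besselPotential (Euc n) ℂ s) he
  rw [besselPotential_sobDist, besselPotential_sobDist] at this
  have h1 : (𝓕⁻ h : L2 n) = 𝓕⁻ h' := Sobolev.toTemperedDistribution_injective this
  have := congrArg (fun f : L2 n ↦ (𝓕 f : L2 n)) h1
  simpa using this

theorem fourierInv_bracketInv (h : L2 n) :
    ((𝓕⁻ (bracketInv n h) : L2 n) : 𝓢'(Euc n, ℂ)) =
      besselPotential (Euc n) ℂ (-1) (𝓕⁻ h : L2 n) := by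
  rw [← Lp.fourierInv_toTemperedDistribution_eq, bracketInv, mulOp_eq_smul,
    Lp.toTemperedDistribution_smul_eq (by unfold invBracket; fun_prop), besselPotential,
    fourierMultiplierCLM_apply, Lp.fourier_toTemperedDistribution_eq, fourier_fourierInv_eq]
  rfl

/-- This is why `bracketInv` plays the role of `M`: the same distribution, regarded as an element of
the next larger Sobolev space, has its weighted Fourier transform multiplied by `⟨ξ⟩⁻¹`. -/
theorem sobDist_bracketInv (s : ℝ) (h : L2 n) : sobDist n (s - 1) (bracketInv n h) =
    sobDist n s h := by
  rw [sobDist_apply, sobDist_apply, fourierInv_bracketInv, besselPotential_besselPotential_apply]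
  congr 2
  ring

theorem sobDist_bracketInv_pow (s : ℝ) (k : ℕ) (h : L2 n) :
    sobDist n (s - k) ((bracketInv n ^ k) h) = sobDist n s h := by
  induction k generalizing h s with
  | zero => simp
  | succ k ih =>
    rw [pow_succ_apply', Nat.cast_succ, add_comm, ← sub_sub, ih, sobDist_bracketInv]

/-- With the Fourier kernel `e^{-2πi x·ξ}` the symbol of `Δ` is `-(2π)² ‖ξ‖²`, while the Bessel
potential of order `2` has symbol `1 + ‖ξ‖²`. This is the source of `κ = (2π)²`. -/
theorem laplacian_eq_besselPotential (f : 𝓢'(Euc n, ℂ)) :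
    Δ f = -((2 * Real.pi) ^ 2 : ℝ) • (besselPotential (Euc n) ℂ 2 f - f) := by
  have h : besselPotential (Euc n) ℂ 2 f =
      f + fourierMultiplierCLM ℂ (fun x : Euc n ↦ Complex.ofReal (‖x‖ ^ 2)) f := by
    have hs : (fun x : Euc n ↦ (((1 + ‖x‖ ^ 2) ^ ((2 : ℝ) / 2) : ℝ) : ℂ)) =
        (fun _ ↦ (1 : ℂ)) + fun x ↦ Complex.ofReal (‖x‖ ^ 2) := by
      ext x
      simp
    rw [besselPotential, hs, fourierMultiplierCLM_apply, smulLeftCLM_add (by fun_prop)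
      (by fun_prop), add_apply, FourierTransform.fourierInv_add, smulLeftCLM_const, one_smul,
      fourierInv_fourier_eq, fourierMultiplierCLM_apply]
  rw [h, add_sub_cancel_left, laplacian_eq_fourierMultiplierCLM]

theorem laplacian_sobDist (s : ℝ) (h : L2 n) :
    Δ (sobDist n s h) = sobDist n (s - 2)
      (-((2 * Real.pi) ^ 2 • (h - bracketInv n (bracketInv n h)))) := by
  have e1 : sobDist n (s - 2) (bracketInv n (bracketInv n h)) = sobDist n s h := by
    have := sobDist_bracketInv_pow s 2 h
    rwa [pow_two] at this
  have e2 : besselPotential (Euc n) ℂ 2 (sobDist n s h) = sobDist n (s - 2) h := by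
    rw [sobDist_apply, sobDist_apply, besselPotential_besselPotential_apply]
    congr 2
    ring
  rw [laplacian_eq_besselPotential, e2, map_neg, LinearMap.map_smul_of_tower, map_sub, e1, neg_smul]

namespace Sobolev

variable {s : ℝ}

/-- The function `⟨ξ⟩ˢ 𝓕 f ∈ L²` for `f ∈ H^s`. -/
def fourierLp (s : ℝ) : Sobolev n s →ₗᵢ[ℝ] L2 n where
  toFun f := 𝓕 f.toLp
  map_add' f g := by rw [map_add, FourierTransform.fourier_add]
  map_smul' c f := by
    rw [RingHom.id_apply, ← Complex.coe_smul, map_smul, FourierTransform.fourier_smul,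
      Complex.coe_smul]
    rfl
  norm_map' f := by
    change ‖𝓕 f.toLp‖ = _
    rw [Lp.norm_fourier_eq, norm_def]

theorem toDist_eq_sobDist (f : Sobolev n s) : f.toDist = sobDist n s (fourierLp s f) := by
  change _ = sobDist n s (𝓕 f.toLp)
  rw [sobDist_apply, fourierInv_fourier_eq, ← f.besselPotential_toDist]
  simp

theorem fourierLp_eq_iff {f : Sobolev n s} {h : L2 n} :
    fourierLp s f = h ↔ f.toDist = sobDist n s h := by
  rw [toDist_eq_sobDist]
  exact (sobDist_injective s).eq_iff.symm

theorem fourierLp_surjective : Function.Surjective (fourierLp s : Sobolev n s →ₗᵢ[ℝ] L2 n) :=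
  fun h ↦ ⟨⟨sobDist n s h, _, besselPotential_sobDist s h⟩, fourierLp_eq_iff.2 rfl⟩

/-- `H^s` is isometric to `L²` via the weighted Fourier transform. -/
def fourierEquiv (n : ℕ) (s : ℝ) : Sobolev n s ≃ₗᵢ[ℝ] L2 n :=
  LinearIsometryEquiv.ofSurjective (fourierLp s) fourierLp_surjective

theorem toDist_eq (f : Sobolev n s) : f.toDist = sobDist n s (fourierEquiv n s f) :=
  toDist_eq_sobDist f

theorem fourierEquiv_eq_iff {f : Sobolev n s} {h : L2 n} :
    fourierEquiv n s f = h ↔ f.toDist = sobDist n s h := fourierLp_eq_iff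

theorem fourierEquiv_incl (k : ℕ) (f : Sobolev n s) :
    fourierEquiv n (s - k) (incl k f) = (bracketInv n ^ k) (fourierEquiv n s f) := by
  rw [fourierEquiv_eq_iff, toDist_incl, sobDist_bracketInv_pow, toDist_eq]

end Sobolev

open Sobolev

variable {s : ℝ} {u : ℝ → Sobolev n s}

theorem isSmoothCurve_fourierEquiv_iff :
    IsSmoothCurve (bracketInv n) (fun t ↦ fourierEquiv n s (u t)) ↔
      ∀ k : ℕ, ContDiffOn ℝ k (fun t ↦ incl k (u t)) (Ici 0) := by
  refine forall_congr' fun k ↦ ?_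
  rw [← (fourierEquiv n (s - k)).toContinuousLinearEquiv.comp_contDiffOn_iff]
  simp only [← fourierEquiv_incl]
  rfl

theorem fourierEquiv_timeDeriv (hu : ∀ k : ℕ, ContDiffOn ℝ k (fun t ↦ incl k (u t)) (Ici 0))
    (k : ℕ) {t : ℝ} (ht : 0 ≤ t) : fourierEquiv n (s - k) (timeDeriv k u t) =
      curveDeriv (bracketInv n) k (fun t ↦ fourierEquiv n s (u t)) t := by
  simp only [curveDeriv, ← fourierEquiv_incl]
  exact (iteratedDerivWithin_clm_comp
    (fourierEquiv n (s - k)).toContinuousLinearEquiv.toContinuousLinearMap (hu k t ht)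
    (uniqueDiffOn_Ici 0) ht).symm

/-- All terms of the equation are moved to `H^{s-2}`: the term `∂ₜu ∈ H^{s-1}` costs one
`bracketInv`, and `Δu` becomes `-κ (1 - M²)` of the transform of `u`. Injectivity of `sobDist` then
turns the identity of distributions into one in `L²`. -/
theorem solvesCauchy_iff {β β' : ℝ → ℝ} {u₀ : Sobolev n s} {u₁ : Sobolev n (s - 1)}
    (hu : ∀ k : ℕ, ContDiffOn ℝ k (fun t ↦ incl k (u t)) (Ici 0)) :
    SolvesCauchy β β' u₀ u₁ u ↔
      (∀ t, 0 ≤ t → curveDeriv (bracketInv n) 2 (fun t ↦ fourierEquiv n s (u t)) t +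
        (2 * Real.pi) ^ 2 • (fourierEquiv n s (u t) -
          bracketInv n (bracketInv n (fourierEquiv n s (u t)))) +
        (β' t / β t) • bracketInv n
          (curveDeriv (bracketInv n) 1 (fun t ↦ fourierEquiv n s (u t)) t) = 0) ∧
      fourierEquiv n s (u 0) = fourierEquiv n s u₀ ∧
      curveDeriv (bracketInv n) 1 (fun t ↦ fourierEquiv n s (u t)) 0 =
        fourierEquiv n (s - 1) u₁ := by
  have e1 : ∀ t, 0 ≤ t → (timeDeriv 1 u t).toDist = sobDist n (s - 1)
      (curveDeriv (bracketInv n) 1 (fun t ↦ fourierEquiv n s (u t)) t) := by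
    intro t ht
    rw [toDist_eq, fourierEquiv_timeDeriv hu 1 ht, Nat.cast_one]
  have e2 : ∀ t, 0 ≤ t → (timeDeriv 2 u t).toDist = sobDist n (s - 2)
      (curveDeriv (bracketInv n) 2 (fun t ↦ fourierEquiv n s (u t)) t) := by
    intro t ht
    rw [toDist_eq, fourierEquiv_timeDeriv hu 2 ht, Nat.cast_ofNat]
  refine and_congr (forall₂_congr fun t ht ↦ ?_) (and_congr ?_ ?_)
  · have e3 : s - 1 - 1 = s - 2 := by ring
    rw [e2 t ht, e1 t ht, toDist_eq (u t), laplacian_sobDist,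
      ← sobDist_bracketInv (s - 1), e3, ← map_smul, ← map_sub, ← map_add, sub_neg_eq_add,
      map_eq_zero_iff _ (sobDist_injective _), Complex.coe_smul]
    rfl
  · exact (fourierEquiv n s).injective.eq_iff.symm
  · rw [e1 0 le_rfl, toDist_eq u₁, (sobDist_injective _).eq_iff]

end FourierSide

/-! ### Regularisation by convolution -/

section Regularisation

open scoped Convolution

open ContinuousLinearMap (lsmul)

/-- The function `x ↦ ε⁻¹ χ(x / ε)`. -/
def dilate (χ : ℝ → ℝ) (ε : Idx) (x : ℝ) : ℝ := (ε : ℝ)⁻¹ * χ ((ε : ℝ)⁻¹ * x)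

variable {χ : ℝ → ℝ} {f g F : ℝ → ℝ}

theorem contDiff_dilate {n : ℕ∞} (hχ : ContDiff ℝ n χ) (ε : Idx) : ContDiff ℝ n (dilate χ ε) :=
  contDiff_const.mul (hχ.comp (contDiff_const.mul contDiff_id))

theorem hasCompactSupport_dilate (hχ : HasCompactSupport χ) (ε : Idx) :
    HasCompactSupport (dilate χ ε) :=
  (hχ.comp_homeomorph (Homeomorph.mulLeft₀ _ (inv_ne_zero ε.2.1.ne'))).mul_left

theorem integral_dilate (χ : ℝ → ℝ) (ε : Idx) : ∫ x, dilate χ ε x = ∫ x, χ x := by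
  have hε : 0 < (ε : ℝ) := ε.2.1
  simp only [dilate]
  rw [integral_const_mul, Measure.integral_comp_mul_left, inv_inv, abs_of_pos hε, smul_eq_mul,
    inv_mul_cancel_left₀ hε.ne']

theorem deriv_dilate (hχ : Differentiable ℝ χ) (ε : Idx) :
    deriv (dilate χ ε) = fun x ↦ (ε : ℝ)⁻¹ * dilate (deriv χ) ε x := by
  ext x
  have h := (hχ ((ε : ℝ)⁻¹ * x)).hasDerivAt.comp x ((hasDerivAt_id x).const_mul (ε : ℝ)⁻¹)
  have h' := (h.const_mul (ε : ℝ)⁻¹).deriv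
  refine h'.trans ?_
  simp only [dilate, mul_one]
  ring

/-- The regularisation of a locally integrable function. -/
def regular (χ F : ℝ → ℝ) (ε : Idx) : ℝ → ℝ := dilate χ ε ⋆[lsmul ℝ ℝ, volume] F

theorem contDiff_regular (hχ : ContDiff ℝ ∞ χ) (hc : HasCompactSupport χ)
    (hF : LocallyIntegrable F) (ε : Idx) : ContDiff ℝ ∞ (regular χ F ε) :=
  (hasCompactSupport_dilate hc ε).contDiff_convolution_left _ (contDiff_dilate hχ ε) hF

theorem hasDerivAt_regular (hχ : ContDiff ℝ ∞ χ) (hc : HasCompactSupport χ)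
    (hF : LocallyIntegrable F) (ε : Idx) (t : ℝ) :
    HasDerivAt (regular χ F ε) ((ε : ℝ)⁻¹ * regular (deriv χ) F ε t) t := by
  have h := (hasCompactSupport_dilate hc ε).hasDerivAt_convolution_left (lsmul ℝ ℝ)
    ((contDiff_dilate hχ ε).of_le (by exact_mod_cast le_top)) hF t
  rw [deriv_dilate (hχ.differentiable (by simp))] at h
  refine h.congr_deriv ?_
  rw [regular, convolution_def, convolution_def, ← integral_const_mul]
  simp [mul_assoc]

/-- All derivatives fall on the mollifier, each at the price of a factor `ε⁻¹`; `F` need only be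
locally integrable. -/
theorem iteratedDeriv_regular (hχ : ContDiff ℝ ∞ χ) (hc : HasCompactSupport χ)
    (hF : LocallyIntegrable F) (ε : Idx) (k : ℕ) (t : ℝ) :
    iteratedDeriv k (regular χ F ε) t = (ε : ℝ)⁻¹ ^ k * regular (iteratedDeriv k χ) F ε t := by
  induction k generalizing χ t with
  | zero => simp
  | succ k ih =>
    have hχ' : ContDiff ℝ ∞ (deriv χ) := (contDiff_infty_iff_deriv.1 hχ).2
    rw [iteratedDeriv_succ', iteratedDeriv_succ',
      funext fun t ↦ (hasDerivAt_regular hχ hc hF ε t).deriv, iteratedDeriv_const_mul_field,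
      ih hχ' hc.deriv, pow_succ']
    ring

theorem modO_regular (hχ : Continuous χ) (hc : HasCompactSupport χ)
    (hF : LocallyIntegrable F) (T : ℝ) :
    ModO (𝓟 (univ ×ˢ Icc 0 T)) fun p ↦ regular χ F p.1 p.2 := by
  obtain ⟨C, hC⟩ := hχ.bounded_above_of_compact_support hc
  obtain ⟨R, hR⟩ := hc.isCompact.isBounded.subset_closedBall 0
  have hC0 : 0 ≤ C := (norm_nonneg _).trans (hC 0)
  have hFi : IntegrableOn F (Icc (-|R|) (T + |R|)) := hF.integrableOn_isCompact isCompact_Icc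
  -- The dilated kernel is at most `ε⁻¹ C`, and as `ε ≤ 1` its translates by `t ∈ [0, T]` live in
  -- the fixed interval `[-|R|, T + |R|]`. The summand `1` makes the constant positive.
  refine modO_principal_iff.2 ⟨1, C * (∫ r in Icc (-|R|) (T + |R|), ‖F r‖) + 1, ?_, ?_⟩
  · have : 0 ≤ ∫ r in Icc (-|R|) (T + |R|), ‖F r‖ := integral_nonneg fun _ ↦ norm_nonneg _
    positivity
  · intro ε _ t ht
    have hε : 0 < (ε : ℝ) := ε.2.1
    have hb : ∀ r, ‖dilate χ ε (t - r) • F r‖ ≤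
        (Icc (-|R|) (T + |R|)).indicator (fun r ↦ (ε : ℝ)⁻¹ * C * ‖F r‖) r := by
      intro r
      by_cases hr : r ∈ Icc (-|R|) (T + |R|)
      · rw [indicator_of_mem hr, norm_smul, dilate, norm_mul, norm_inv,
          Real.norm_of_nonneg hε.le]
        gcongr
        exact hC _
      · have : χ ((ε : ℝ)⁻¹ * (t - r)) = 0 := by
          by_contra hn
          have h1 := hR (subset_tsupport _ hn)
          rw [mem_closedBall_zero_iff, norm_mul, norm_inv, Real.norm_of_nonneg hε.le,
            inv_mul_le_iff₀ hε, Real.norm_eq_abs] at h1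
          have h2 : (ε : ℝ) * R ≤ |R| := by
            nlinarith [le_abs_self R, abs_nonneg R, ε.2.2, mul_le_mul_of_nonneg_left
              (le_abs_self R) hε.le]
          have h3 := abs_le.1 (h1.trans h2)
          exact hr ⟨by linarith [ht.1], by linarith [ht.2]⟩
        rw [dilate, this, mul_zero, zero_smul, norm_zero]
        exact indicator_nonneg (fun r _ ↦ by positivity) r
    rw [regular, convolution_lsmul_swap, pow_one]
    refine (norm_integral_le_of_norm_le
      (IntegrableOn.integrable_indicator (hFi.norm.const_mul ((ε : ℝ)⁻¹ * C)) measurableSet_Icc)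
      (ae_of_all _ hb)).trans ?_
    rw [integral_indicator measurableSet_Icc, integral_const_mul]
    have := inv_pos.2 hε
    nlinarith

theorem modO_iteratedDeriv_regular (hχ : ContDiff ℝ ∞ χ) (hc : HasCompactSupport χ)
    (hF : LocallyIntegrable F) (T : ℝ) (k : ℕ) :
    ModO (𝓟 (univ ×ˢ Icc 0 T)) fun p ↦ iteratedDeriv k (regular χ F p.1) p.2 := by
  simp only [iteratedDeriv_regular hχ hc hF]
  refine ModO.mul (f := fun p : Idx × ℝ ↦ (p.1 : ℝ)⁻¹ ^ k) ⟨k, Asymptotics.isBigO_refl _ _⟩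
    (modO_regular (hχ.continuous_iteratedDeriv k (by exact_mod_cast le_top)) ?_ hF T)
  clear hF
  induction k generalizing χ with
  | zero => simpa
  | succ k ih =>
    rw [iteratedDeriv_succ']
    exact ih (contDiff_infty_iff_deriv.1 hχ).2 hc.deriv

/-! ### The regularising embedding -/

theorem locallyIntegrable_indicator_Ici (hf : LocallyIntegrableOn f (Ici 0)) :
    LocallyIntegrable ((Ici 0).indicator f) := by
  rw [locallyIntegrable_iff]
  intro K hK
  rw [integrableOn_indicator_iff measurableSet_Ici]
  exact hf.integrableOn_compact_subset inter_subset_left (hK.inter_left isClosed_Ici)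

theorem testFunction_eq_zero (φ : 𝓓(halfLine, ℝ)) {x : ℝ} (hx : x ≤ 0) : φ x = 0 := by
  by_contra h
  exact absurd (φ.tsupport_subset (subset_tsupport _ h)) (not_lt.2 hx)

theorem distOf_eq_integral_indicator (hf : LocallyIntegrableOn f (Ici 0)) (φ : 𝓓(halfLine, ℝ)) :
    distOf f φ = ∫ x, (Ici 0).indicator f x * φ x := by
  rw [distOf_apply hf]
  refine integral_congr_ae (ae_of_all _ fun x ↦ ?_)
  by_cases hx : 0 ≤ x
  · simp [indicator_of_mem (mem_Ici.2 hx), mul_comm]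
  · simp [testFunction_eq_zero φ (not_le.1 hx).le]

theorem lineDeriv_testFunction (φ : 𝓓(halfLine, ℝ)) (x : ℝ) :
    (∂_{(1 : ℝ)} φ : 𝓓(halfLine, ℝ)) x = deriv φ x := by
  have hφ : DifferentiableAt ℝ φ x := φ.contDiff.differentiable (by simp) x
  rw [TestFunction.lineDerivOp_eq_lineDerivCLM ℝ, TestFunction.lineDerivCLM_apply_of_le (by simp),
    hφ.lineDeriv_eq_fderiv, fderiv_apply_one_eq_deriv]

theorem distDeriv_distOf_eq_integral (hg : LocallyIntegrableOn g (Ici 0)) (φ : 𝓓(halfLine, ℝ)) :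
    distDeriv (distOf g) φ = -∫ x, (Ici 0).indicator g x * deriv φ x := by
  rw [distDeriv, Distribution.lineDerivOp_apply_apply, map_neg, distOf_eq_integral_indicator hg]
  simp only [lineDeriv_testFunction]

namespace Mollifier

variable (ψ : Mollifier)

theorem coe_translate (ε : Idx) (t : ℝ) (ht : 0 ≤ t) :
    ⇑(ψ.translate ε t ht) = fun r ↦ dilate ψ.toFun ε (t - r) := rfl

theorem distOf_translate (hf : LocallyIntegrableOn f (Ici 0)) (ε : Idx) (t : ℝ) (ht : 0 ≤ t) :
    distOf f (ψ.translate ε t ht) = regular ψ.toFun ((Ici 0).indicator f) ε t := by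
  rw [distOf_eq_integral_indicator hf, regular, convolution_lsmul_swap]
  simp [coe_translate, mul_comm]

/-- The sign of the distributional derivative cancels against that of the inner derivative of `r ↦ t
- r`. The jump at `0` of the extension by zero is invisible, as the test function is supported in
`(0, ∞)`. -/
theorem distDeriv_distOf_translate (hg : LocallyIntegrableOn g (Ici 0)) (ε : Idx) (t : ℝ)
    (ht : 0 ≤ t) : distDeriv (distOf g) (ψ.translate ε t ht) =
      deriv (regular ψ.toFun ((Ici 0).indicator g) ε) t := by
  rw [distDeriv_distOf_eq_integral hg, (hasDerivAt_regular ψ.contDiff ψ.hasCompactSupport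
    (locallyIntegrable_indicator_Ici hg) ε t).deriv, regular, convolution_lsmul_swap,
    ← integral_const_mul, ← integral_neg]
  refine integral_congr_ae (ae_of_all _ fun r ↦ ?_)
  simp only [coe_translate]
  rw [deriv_comp_const_sub, deriv_dilate (ψ.contDiff.differentiable (by simp)), smul_eq_mul]
  ring

/-- The regularised net `(T * ψ_ε)_ε`, continued by zero to negative times. -/
def net (T : 𝓓'(halfLine, ℝ)) (ε : Idx) (t : ℝ) : ℝ :=
  if h : 0 ≤ t then T (ψ.translate ε t h) else 0

theorem net_apply (T : 𝓓'(halfLine, ℝ)) (ε : Idx) {t : ℝ} (ht : 0 ≤ t) :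
    ψ.net T ε t = T (ψ.translate ε t ht) := dif_pos ht

theorem net_eq (hf : LocallyIntegrableOn f (Ici 0)) (hg : LocallyIntegrableOn g (Ici 0)) (ε : Idx)
    {t : ℝ} (ht : 0 ≤ t) : ψ.net (distOf f + distDeriv (distOf g)) ε t =
      regular ψ.toFun ((Ici 0).indicator f) ε t +
        deriv (regular ψ.toFun ((Ici 0).indicator g) ε) t := by
  rw [net_apply _ _ _ ht, ← ψ.distOf_translate hf ε t ht, ← ψ.distDeriv_distOf_translate hg ε t ht]
  rfl

theorem isModerate_net (T : DistSpace) : IsModerate (ψ.net T.1) := by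
  obtain ⟨T, f, g, hf, hg, rfl⟩ := T
  have hf' := locallyIntegrable_indicator_Ici hf
  have hg' := locallyIntegrable_indicator_Ici hg
  have hF := contDiff_regular ψ.contDiff ψ.hasCompactSupport hf'
  have hG := contDiff_regular ψ.contDiff ψ.hasCompactSupport hg'
  have hG' : ∀ ε, ContDiff ℝ ∞ (deriv (regular ψ.toFun ((Ici 0).indicator g) ε)) := fun ε ↦
    (contDiff_infty_iff_deriv.1 (hG ε)).2
  have he : ∀ ε, EqOn (ψ.net (distOf f + distDeriv (distOf g)) ε)
      (regular ψ.toFun ((Ici 0).indicator f) ε +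
        deriv (regular ψ.toFun ((Ici 0).indicator g) ε)) (Ici 0) :=
    fun ε t ht ↦ ψ.net_eq hf hg ε ht
  refine isModerate_iff.2 ⟨fun ε ↦ ((hF ε).add (hG' ε)).contDiffOn.congr (he ε), fun T k ↦ ?_⟩
  refine ((modO_iteratedDeriv_regular ψ.contDiff ψ.hasCompactSupport hf' T k).add
    (modO_iteratedDeriv_regular ψ.contDiff ψ.hasCompactSupport hg' T (k + 1))).of_le ?_
  rw [eventually_principal]
  intro p hp
  have hp0 : p.2 ∈ Ici (0 : ℝ) := hp.2.1
  have hk : ∀ {h : ℝ → ℝ}, ContDiff ℝ ∞ h → ContDiffAt ℝ k h p.2 := fun h ↦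
    (h.of_le (by exact_mod_cast le_top)).contDiffAt
  rw [iteratedDerivWithin_congr (he p.1) hp0,
    iteratedDerivWithin_add hp0 (uniqueDiffOn_Ici 0) (hk (hF p.1)).contDiffWithinAt
      (hk (hG' p.1)).contDiffWithinAt,
    iteratedDerivWithin_eq_iteratedDeriv (uniqueDiffOn_Ici 0) (hk (hF p.1)) hp0,
    iteratedDerivWithin_eq_iteratedDeriv (uniqueDiffOn_Ici 0) (hk (hG' p.1)) hp0,
    iteratedDeriv_succ']

/-- The map `T ↦ [(T * ψ_ε)_ε]`. -/
def embedding : DistSpace →ₗ[ℝ] Colombeau where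
  toFun T := Colombeau.mk ⟨ψ.net T.1, ψ.isModerate_net T⟩
  map_add' S T := by
    have : Colombeau.mk ⟨ψ.net S.1, ψ.isModerate_net S⟩ +
        Colombeau.mk ⟨ψ.net T.1, ψ.isModerate_net T⟩ =
        Colombeau.mk (⟨ψ.net S.1, ψ.isModerate_net S⟩ + ⟨ψ.net T.1, ψ.isModerate_net T⟩) := rfl
    rw [this]
    congr 1
    ext ε t
    change ψ.net (S.1 + T.1) ε t = ψ.net S.1 ε t + ψ.net T.1 ε t
    by_cases ht : 0 ≤ t
    · simp only [net_apply _ _ _ ht]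
      rfl
    · simp [net, ht]
  map_smul' c T := by
    have : c • Colombeau.mk ⟨ψ.net T.1, ψ.isModerate_net T⟩ =
        Colombeau.mk (c • ⟨ψ.net T.1, ψ.isModerate_net T⟩) := rfl
    rw [RingHom.id_apply, this]
    congr 1
    ext ε t
    change ψ.net (c • T.1) ε t = c * ψ.net T.1 ε t
    by_cases ht : 0 ≤ t
    · simp only [net_apply _ _ _ ht]
      rfl
    · simp [net, ht]

/-- A sequence of parameters that tends to zero. -/
def idxSeq (j : ℕ) : Idx := ⟨1 / ((j : ℝ) + 1), by positivity, by
  rw [div_le_one (by positivity)]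
  have : (0 : ℝ) ≤ j := j.cast_nonneg
  linarith⟩

theorem tendsto_idxSeq : Tendsto (fun j ↦ (idxSeq j : ℝ)) atTop (𝓝 0) :=
  tendsto_one_div_add_atTop_nhds_zero_nat

/-- With `η'(x) = η(-x)` the pairing is `((ψ_ε * F) * η')(0) = (ψ_ε * (F * η'))(0)` by
associativity. Since `F * η'` is continuous, the approximate identity recovers its value at `0`, the
pairing of `F` and `η`. -/
theorem tendsto_integral_regular_mul (hF : LocallyIntegrable F) {η : ℝ → ℝ} (hη : Continuous η)
    (hηc : HasCompactSupport η) :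
    Tendsto (fun j ↦ ∫ t, regular ψ.toFun F (idxSeq j) t * η t) atTop (𝓝 (∫ t, F t * η t)) := by
  set η' : ℝ → ℝ := fun x ↦ η (-x) with hη'
  have hη'cont : Continuous η' := hη.comp continuous_neg
  have hη'c : HasCompactSupport η' := hηc.comp_homeomorph (Homeomorph.neg ℝ)
  have hψ := fun j ↦ (contDiff_dilate ψ.contDiff (idxSeq j)).continuous
  have hψc := fun j ↦ hasCompactSupport_dilate ψ.hasCompactSupport (idxSeq j)
  have hFn : LocallyIntegrable fun x ↦ ‖F x‖ :=
    locallyIntegrable_iff.2 fun K hK ↦ (hF.integrableOn_isCompact hK).norm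
  have hassoc : ∀ j, ∫ t, regular ψ.toFun F (idxSeq j) t * η t =
      (dilate ψ.toFun (idxSeq j) ⋆[lsmul ℝ ℝ, volume] (F ⋆[lsmul ℝ ℝ, volume] η')) 0 := by
    intro j
    rw [← convolution_assoc (lsmul ℝ ℝ) (lsmul ℝ ℝ) (lsmul ℝ ℝ) (lsmul ℝ ℝ)
      (fun x y z ↦ by simp [mul_assoc])
      (hψ j).aestronglyMeasurable hF.aestronglyMeasurable hη'cont.aestronglyMeasurable
      (ae_of_all _ fun x ↦ (hψc j).convolutionExists_left _ (hψ j) hF x)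
      (ae_of_all _ fun x ↦ hη'c.norm.convolutionExists_right _ hFn hη'cont.norm x)
      ((hψc j).norm.convolutionExists_left _ (hψ j).norm
        (hη'c.norm.continuous_convolution_right _ hFn hη'cont.norm).locallyIntegrable 0),
      convolution_def]
    simp [hη', regular]
  have hlim : ∫ t, F t * η t = (F ⋆[lsmul ℝ ℝ, volume] η') 0 := by
    rw [convolution_def]
    simp [hη']
  have hcont : Continuous (F ⋆[lsmul ℝ ℝ, volume] η') :=
    hη'c.continuous_convolution_right _ hF hη'cont
  simp only [hassoc, hlim]
  refine convolution_tendsto_right (g := fun _ ↦ F ⋆[lsmul ℝ ℝ, volume] η') (x₀ := 0)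
    (Eventually.of_forall fun j x ↦ ?_) (Eventually.of_forall fun j ↦ ?_) ?_
    (Eventually.of_forall fun j ↦ hcont.aestronglyMeasurable)
    ((hcont.tendsto 0).comp tendsto_snd) tendsto_const_nhds
  · exact mul_nonneg (inv_nonneg.2 (idxSeq j).2.1.le) (ψ.nonneg _)
  · rw [integral_dilate, ψ.integral_eq_one]
  · obtain ⟨R, hR⟩ := ψ.hasCompactSupport.isCompact.isBounded.subset_closedBall 0
    rw [tendsto_smallSets_iff]
    intro U hU
    obtain ⟨δ, hδ, hU⟩ := Metric.mem_nhds_iff.1 hU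
    have h0 : Tendsto (fun j ↦ (idxSeq j : ℝ) * |R|) atTop (𝓝 0) := by
      simpa using tendsto_idxSeq.mul_const |R|
    filter_upwards [h0.eventually (gt_mem_nhds hδ)] with j hj x hx
    have hε : 0 < (idxSeq j : ℝ) := (idxSeq j).2.1
    have h1 : ψ.toFun ((idxSeq j : ℝ)⁻¹ * x) ≠ 0 := right_ne_zero_of_mul hx
    have h2 := hR (subset_tsupport _ h1)
    rw [mem_closedBall_zero_iff, norm_mul, norm_inv, Real.norm_of_nonneg hε.le,
      inv_mul_le_iff₀ hε] at h2
    refine hU (mem_ball_zero_iff.2 (lt_of_le_of_lt h2 (lt_of_le_of_lt ?_ hj)))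
    gcongr
    exact le_abs_self R

theorem tendsto_integral_net_mul (T : DistSpace) (φ : 𝓓(halfLine, ℝ)) :
    Tendsto (fun j ↦ ∫ t, ψ.net T.1 (idxSeq j) t * φ t) atTop (𝓝 (T.1 φ)) := by
  obtain ⟨T, f, g, hf, hg, rfl⟩ := T
  have hf' := locallyIntegrable_indicator_Ici hf
  have hg' := locallyIntegrable_indicator_Ici hg
  have hF := contDiff_regular ψ.contDiff ψ.hasCompactSupport hf'
  have hG := contDiff_regular ψ.contDiff ψ.hasCompactSupport hg'
  have hφ : ContDiff ℝ ∞ φ := φ.contDiff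
  have hφ' : Continuous (deriv φ) := hφ.continuous_deriv (by simp)
  have hφc := φ.hasCompactSupport
  have hint : ∀ {u v : ℝ → ℝ}, Continuous u → Continuous v → HasCompactSupport v →
      Integrable (u * v) := fun hu hv hc ↦ (hu.mul hv).integrable_of_hasCompactSupport hc.mul_left
  have h1 : ∀ j, ∫ t, ψ.net (distOf f + distDeriv (distOf g)) (idxSeq j) t * φ t =
      (∫ t, regular ψ.toFun ((Ici 0).indicator f) (idxSeq j) t * φ t) -
        ∫ t, regular ψ.toFun ((Ici 0).indicator g) (idxSeq j) t * deriv φ t := by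
    intro j
    have hG1 : Continuous (deriv (regular ψ.toFun ((Ici 0).indicator g) (idxSeq j))) :=
      (hG _).continuous_deriv (by simp)
    have h3 : Integrable fun t ↦ regular ψ.toFun ((Ici 0).indicator f) (idxSeq j) t * φ t :=
      hint (hF _).continuous hφ.continuous hφc
    have h4 : Integrable fun t ↦
        deriv (regular ψ.toFun ((Ici 0).indicator g) (idxSeq j)) t * φ t :=
      hint hG1 hφ.continuous hφc
    -- Integration by parts has no boundary terms, as `φ` has compact support.
    rw [integral_mul_deriv_eq_deriv_mul_of_integrable
      (fun x _ ↦ ((hG (idxSeq j)).differentiable (by simp) x).hasDerivAt)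
      (fun x _ ↦ (hφ.differentiable (by simp) x).hasDerivAt)
      (hint (hG _).continuous hφ' hφc.deriv) (hint hG1 hφ.continuous hφc)
      (hint (hG _).continuous hφ.continuous hφc), sub_neg_eq_add, ← integral_add h3 h4]
    refine integral_congr_ae (ae_of_all _ fun t ↦ ?_)
    by_cases ht : 0 ≤ t
    · simp only [ψ.net_eq hf hg _ ht, add_mul]
    · simp [testFunction_eq_zero φ (not_le.1 ht).le]
  have h2 : (distOf f + distDeriv (distOf g)) φ =
      (∫ t, (Ici 0).indicator f t * φ t) - ∫ t, (Ici 0).indicator g t * deriv φ t := by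
    change distOf f φ + distDeriv (distOf g) φ = _
    rw [distOf_eq_integral_indicator hf, distDeriv_distOf_eq_integral hg, sub_eq_add_neg]
  change Tendsto _ _ (𝓝 ((distOf f + distDeriv (distOf g)) φ))
  rw [h2]
  simp only [h1]
  exact (ψ.tendsto_integral_regular_mul hf' hφ.continuous hφc).sub
    (ψ.tendsto_integral_regular_mul hg' hφ' hφc.deriv)

/-- The pairings of the net with `φ` converge to `T φ`, but are also `O(ε)`. The order `p = 1`
without derivatives is all that is needed. -/
theorem eq_zero_of_isNegligible_net (T : DistSpace) (h : IsNegligible (ψ.net T.1)) : T = 0 := by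
  refine Subtype.ext (DFunLike.ext _ _ fun φ ↦ ?_)
  change T.1 φ = 0
  have hφ : Continuous φ := φ.contDiff.continuous
  have hφc := φ.hasCompactSupport
  obtain ⟨R, hR⟩ := hφc.isCompact.bddAbove
  obtain ⟨c, hc, h⟩ := h (Icc 0 R) isCompact_Icc Icc_subset_Ici_self 0 1
  have hb : ∀ j t, ‖ψ.net T.1 (idxSeq j) t * φ t‖ ≤ c * idxSeq j * ‖φ t‖ := by
    intro j t
    by_cases ht : φ t = 0
    · simp [ht]
    · have h1 : t ∈ tsupport φ := subset_tsupport _ ht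
      have := h (idxSeq j) t ⟨(φ.tsupport_subset h1).le, hR h1⟩
      rw [iteratedDerivWithin_zero, pow_one] at this
      rw [norm_mul]
      gcongr
      exact this
  have hi : Integrable fun t ↦ ‖φ t‖ := (hφ.integrable_of_hasCompactSupport hφc).norm
  refine tendsto_nhds_unique (ψ.tendsto_integral_net_mul T φ) ?_
  refine squeeze_zero_norm (a := fun j ↦ c * idxSeq j * ∫ t, ‖φ t‖) (fun j ↦ ?_) ?_
  · rw [← integral_const_mul]
    exact norm_integral_le_of_norm_le (hi.const_mul _) (ae_of_all _ (hb j))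
  · simpa using (tendsto_idxSeq.const_mul c).mul_const (∫ t, ‖φ t‖)

theorem isRegularisingEmbedding : IsRegularisingEmbedding ψ ψ.embedding := by
  refine ⟨(injective_iff_map_eq_zero _).2 fun T hT ↦ ψ.eq_zero_of_isNegligible_net T ?_,
    fun T ↦ ⟨⟨ψ.net T.1, ψ.isModerate_net T⟩, rfl, fun ε t ht ↦ ψ.net_apply _ _ ht⟩⟩
  exact Ideal.Quotient.eq_zero_iff_mem.1 hT

theorem integral_translate (ε : Idx) (t : ℝ) (ht : 0 ≤ t) : ∫ r, ψ.translate ε t ht r = 1 := by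
  simp only [coe_translate]
  rw [integral_sub_left_eq_self (dilate ψ.toFun ε) volume t, integral_dilate, ψ.integral_eq_one]

theorem translate_nonneg (ε : Idx) (t : ℝ) (ht : 0 ≤ t) (r : ℝ) : 0 ≤ ψ.translate ε t ht r :=
  mul_nonneg (inv_nonneg.2 ε.2.1.le) (ψ.nonneg _)

/-- Averaging against a nonnegative kernel of integral `1` preserves lower bounds. For `t ≥ 0` the
average only involves values on `(0, ∞)`, so there is no loss near `t = 0`. -/
theorem le_net_distOf (hf : LocallyIntegrableOn f (Ici 0)) {c : ℝ} (hc : ∀ t, 0 ≤ t → c ≤ f t)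
    (ε : Idx) {t : ℝ} (ht : 0 ≤ t) : c ≤ ψ.net (distOf f) ε t := by
  have hi := TestFunction.integrable_bilin (ContinuousLinearMap.mul ℝ ℝ)
    (hf.mono_set Ioi_subset_Ici_self) (ψ.translate ε t ht)
  have hi' : Integrable fun r ↦ ψ.translate ε t ht r :=
    (ψ.translate ε t ht).continuous.integrable_of_hasCompactSupport
      (ψ.translate ε t ht).hasCompactSupport
  rw [net_apply _ _ _ ht, distOf_apply hf]
  calc c = ∫ r, ψ.translate ε t ht r * c := by rw [integral_mul_const, integral_translate, one_mul]
    _ ≤ _ := by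
      refine integral_mono (hi'.mul_const c) hi fun r ↦ ?_
      by_cases hr : 0 ≤ r
      · exact mul_le_mul_of_nonneg_left (hc r hr) (ψ.translate_nonneg ε t ht r)
      · have := testFunction_eq_zero (ψ.translate ε t ht) (not_le.1 hr).le
        simp [this]

theorem le_net_of_distGE {T : 𝓓'(halfLine, ℝ)} {c : ℝ} (hT : DistGE T c) (ε : Idx) {t : ℝ}
    (ht : 0 ≤ t) : c ≤ ψ.net T ε t := by
  have := hT (ψ.translate ε t ht) (ψ.translate_nonneg ε t ht)
  rwa [integral_translate, mul_one, ← net_apply _ _ _ ht] at this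

theorem nonempty : Nonempty Mollifier := by
  -- The support is `[-3, -1]`, inside the open negative half line.
  let f : ContDiffBump (-2 : ℝ) := ⟨1 / 2, 1, by norm_num, by norm_num⟩
  refine ⟨⟨f.normed volume, f.contDiff_normed, f.hasCompactSupport_normed, f.nonneg_normed,
    f.integral_normed, ?_⟩⟩
  rw [f.tsupport_normed_eq, Real.closedBall_eq_Icc]
  intro x hx
  have : x ≤ -2 + 1 := hx.2
  exact mem_Iio.2 (by linarith)

end Mollifier

end Regularisation

/-! ### Existence and uniqueness in the Colombeau spaces -/

section CauchyProblem

open Sobolev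

theorem eventually_nonneg (S : Set Idx) (T : ℝ) : ∀ᶠ p in 𝓟 (S ×ˢ Icc 0 T), 0 ≤ p.2 :=
  eventually_principal.2 fun _ hp ↦ hp.2.1

section Coefficient

variable {β β' β₁ β₁' : Idx → ℝ → ℝ} {c : ℝ}

theorem contDiffOn_div (hβ : IsModerate β) (hβ' : IsModerate β')
    (h0 : ∀ ε t, 0 ≤ t → β ε t ≠ 0) (ε : Idx) : ContDiffOn ℝ ∞ ((β' / β) ε) (Ici 0) :=
  (hβ'.1 ε).div (hβ.1 ε) (h0 ε)

theorem modD_div (hβ : IsModerate β) (hβ' : IsModerate β') (hc : 0 < c)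
    (hb : ∀ ε t, 0 ≤ t → c ≤ β ε t) (T : ℝ) : ModD (𝓟 (univ ×ˢ Icc 0 T)) (β' / β) := by
  have h0 : ∀ ε t, 0 ≤ t → β ε t ≠ 0 := fun ε t ht ↦ (hc.trans_le (hb ε t ht)).ne'
  have hl := eventually_nonneg univ T
  rw [div_eq_mul_inv]
  exact ((isModerate_iff.1 hβ').2 T).mul hl hβ'.1 (fun ε ↦ (hβ.1 ε).inv (h0 ε))
    (((isModerate_iff.1 hβ).2 T).inv hl hβ.1 h0 hc
      (hl.mono fun p hp ↦ (hb p.1 p.2 hp).trans (le_abs_self _)))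

/-- An arbitrary representative `β₁` is nonzero but may lack a uniform lower bound. On `[0, T]` it
differs from `β` by at most `d ε`, which is below `c / 2` as soon as `ε < c / (2 d)`. -/
theorem exists_lower_bound (hc : 0 < c) (hb : ∀ ε t, 0 ≤ t → c ≤ β ε t)
    (h : IsNegligible (β₁ - β)) (T : ℝ) : ∃ ε₀ : ℝ, 0 < ε₀ ∧
      ∀ ε : Idx, (ε : ℝ) < ε₀ → ∀ t ∈ Icc 0 T, c / 2 ≤ |β₁ ε t| := by
  obtain ⟨d, hd, h⟩ := h (Icc 0 T) isCompact_Icc Icc_subset_Ici_self 0 1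
  refine ⟨c / (2 * d), by positivity, fun ε hε t ht ↦ ?_⟩
  have h1 := h ε t ht
  rw [iteratedDerivWithin_zero, pow_one] at h1
  rw [lt_div_iff₀ (by positivity)] at hε
  have h2 := (abs_le.1 h1).1
  have h3 := hb ε t ht.1
  have h4 : (β₁ - β) ε t = β₁ ε t - β ε t := rfl
  have h5 := le_abs_self (β₁ ε t)
  linarith

/-- The difference `β' / β - β₁' / β₁` of two representatives of the damping coefficient. -/
def quotientDiff (β β' β₁ β₁' : Idx → ℝ → ℝ) : Idx → ℝ → ℝ :=
  ((β₁ - β) * β' + (β' - β₁') * β) * (β⁻¹ * β₁⁻¹)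

theorem quotientDiff_apply {ε : Idx} {t : ℝ} (h : β ε t ≠ 0) (h₁ : β₁ ε t ≠ 0) :
    quotientDiff β β' β₁ β₁' ε t = β' ε t / β ε t - β₁' ε t / β₁ ε t := by
  simp only [quotientDiff, Pi.mul_apply, Pi.add_apply, Pi.sub_apply, Pi.inv_apply]
  field_simp
  ring

theorem contDiffOn_quotientDiff (hβ : IsModerate β) (hβ' : IsModerate β') (hβ₁ : IsModerate β₁)
    (hβ₁' : IsModerate β₁') (h0 : ∀ ε t, 0 ≤ t → β ε t ≠ 0) (h0₁ : ∀ ε t, 0 ≤ t → β₁ ε t ≠ 0)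
    (ε : Idx) : ContDiffOn ℝ ∞ (quotientDiff β β' β₁ β₁' ε) (Ici 0) :=
  ((((hβ₁.1 ε).sub (hβ.1 ε)).mul (hβ'.1 ε)).add (((hβ'.1 ε).sub (hβ₁'.1 ε)).mul (hβ.1 ε))).mul
    (((hβ.1 ε).inv (h0 ε)).mul ((hβ₁.1 ε).inv (h0₁ ε)))

/-- The numerator is negligible, each difference being multiplied by a moderate net. The factor
`β₁⁻¹` is moderate only where `β₁` is bounded below, whence the restriction to `ε < ε₀`. -/
theorem negD_quotientDiff (hβ : IsModerate β) (hβ' : IsModerate β') (hβ₁ : IsModerate β₁)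
    (hβ₁' : IsModerate β₁') (hc : 0 < c) (hb : ∀ ε t, 0 ≤ t → c ≤ β ε t)
    (h0₁ : ∀ ε t, 0 ≤ t → β₁ ε t ≠ 0) (hn : IsNegligible (β₁ - β)) (hn' : IsNegligible (β' - β₁'))
    {T ε₀ : ℝ} (hε₀ : ∀ ε : Idx, (ε : ℝ) < ε₀ → ∀ t ∈ Icc 0 T, c / 2 ≤ |β₁ ε t|) :
    NegD (𝓟 ({ε : Idx | (ε : ℝ) < ε₀} ×ˢ Icc 0 T)) (quotientDiff β β' β₁ β₁') := by
  have h0 : ∀ ε t, 0 ≤ t → β ε t ≠ 0 := fun ε t ht ↦ (hc.trans_le (hb ε t ht)).ne'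
  have hl := eventually_nonneg {ε : Idx | (ε : ℝ) < ε₀} T
  have hle : 𝓟 ({ε : Idx | (ε : ℝ) < ε₀} ×ˢ Icc 0 T) ≤ 𝓟 (univ ×ˢ Icc 0 T) :=
    principal_mono.2 (prod_mono_left (subset_univ _))
  have hm : ∀ {φ}, IsModerate φ → ModD (𝓟 ({ε : Idx | (ε : ℝ) < ε₀} ×ˢ Icc 0 T)) φ :=
    fun h k ↦ ((isModerate_iff.1 h).2 T k).mono hle
  have hs := fun ε ↦ (hβ₁.1 ε).sub (hβ.1 ε)
  have hs' := fun ε ↦ (hβ'.1 ε).sub (hβ₁'.1 ε)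
  have h1 : NegD (𝓟 ({ε : Idx | (ε : ℝ) < ε₀} ×ˢ Icc 0 T)) ((β₁ - β) * β') :=
    NegD.mul_modD hl hs hβ'.1 (fun k ↦ (hn.negD T k).mono hle) (hm hβ')
  have h2 : NegD (𝓟 ({ε : Idx | (ε : ℝ) < ε₀} ×ˢ Icc 0 T)) ((β' - β₁') * β) :=
    NegD.mul_modD hl hs' hβ.1 (fun k ↦ (hn'.negD T k).mono hle) (hm hβ)
  have hi := (hm hβ).inv hl hβ.1 h0 hc (hl.mono fun p hp ↦ (hb p.1 p.2 hp).trans (le_abs_self _))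
  have hi₁ := (hm hβ₁).inv hl hβ₁.1 h0₁ (half_pos hc)
    (eventually_principal.2 fun p hp ↦ hε₀ p.1 hp.1 p.2 hp.2)
  have hsi := fun ε ↦ (hβ.1 ε).inv (h0 ε)
  have hsi₁ := fun ε ↦ (hβ₁.1 ε).inv (h0₁ ε)
  exact NegD.mul_modD hl (fun ε ↦ ((hs ε).mul (hβ'.1 ε)).add ((hs' ε).mul (hβ.1 ε)))
    (fun ε ↦ (hsi ε).mul (hsi₁ ε))
    (h1.add hl (fun ε ↦ (hs ε).mul (hβ'.1 ε)) (fun ε ↦ (hs' ε).mul (hβ.1 ε)) h2)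
    (hi.mul hl hsi hsi₁ hi₁)

end Coefficient

variable {n : ℕ} {s : ℝ} {u : Idx → ℝ → Sobolev n s}

theorem isModerateH_iff_curveDeriv : IsModerateH u ↔
    (∀ ε, IsSmoothCurve (bracketInv n) fun t ↦ fourierEquiv n s (u ε t)) ∧
    ∀ (T : ℝ) (k : ℕ), ModO (𝓟 (univ ×ˢ Icc 0 T)) fun p ↦
      curveDeriv (bracketInv n) k (fun t ↦ fourierEquiv n s (u p.1 t)) p.2 := by
  simp only [isModerateH_iff, IsSmoothNet, isSmoothCurve_fourierEquiv_iff]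
  refine and_congr_right fun hu ↦ forall₂_congr fun T k ↦ ?_
  have h : ∀ p ∈ univ ×ˢ Icc 0 T, ‖timeDeriv k (u p.1) p.2‖ =
      ‖curveDeriv (bracketInv n) k (fun t ↦ fourierEquiv n s (u p.1 t)) p.2‖ := fun p hp ↦ by
    rw [← fourierEquiv_timeDeriv (hu p.1) k hp.2.1, LinearIsometryEquiv.norm_map]
  exact ⟨fun hm ↦ hm.of_le (eventually_principal.2 fun p hp ↦ (h p hp).ge),
    fun hm ↦ hm.of_le (eventually_principal.2 fun p hp ↦ (h p hp).le)⟩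

theorem isNegligibleH_of_negO_curveDeriv (hu : IsSmoothNet u)
    (h : ∀ (T : ℝ) (k : ℕ), NegO (𝓟 (univ ×ˢ Icc 0 T)) fun p ↦
      curveDeriv (bracketInv n) k (fun t ↦ fourierEquiv n s (u p.1 t)) p.2) : IsNegligibleH u :=
  isNegligibleH_of_negO fun T k ↦ (h T k).of_le <| eventually_principal.2 fun p hp ↦ by
    rw [← fourierEquiv_timeDeriv (hu p.1) k hp.2.1, LinearIsometryEquiv.norm_map]

variable {β β' β₁ β₁' : Idx → ℝ → ℝ} {c : ℝ} {u₀ : Sobolev n s} {u₁ : Sobolev n (s - 1)}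

/-- The regularised Cauchy problems have a moderate net of solutions. -/
theorem exists_isModerateH_solvesCauchy (hβ : IsModerate β) (hβ' : IsModerate β') (hc : 0 < c)
    (hb : ∀ ε t, 0 ≤ t → c ≤ β ε t) (hb' : ∀ ε t, 0 ≤ t → 0 ≤ β' ε t) (u₀ : Sobolev n s)
    (u₁ : Sobolev n (s - 1)) :
    ∃ u : Idx → ℝ → Sobolev n s, IsModerateH u ∧
      ∀ ε, SolvesCauchy (β ε) (β' ε) u₀ u₁ (u ε) := by
  have hκ : (0 : ℝ) < (2 * Real.pi) ^ 2 := by positivity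
  have h0 : ∀ ε t, 0 ≤ t → β ε t ≠ 0 := fun ε t ht ↦ (hc.trans_le (hb ε t ht)).ne'
  have ha := contDiffOn_div hβ hβ' h0
  have ha0 : ∀ ε t, 0 ≤ t → 0 ≤ (β' / β) ε t := fun ε t ht ↦
    div_nonneg (hb' ε t ht) (hc.le.trans (hb ε t ht))
  choose V W hV0 hW0 hVc hWc hs using fun ε ↦ (isCutoff_bracketInv n).exists_isWaveSystem hκ
    (ha ε).continuousOn (ha0 ε) (fourierEquiv n s u₀) (fourierEquiv n (s - 1) u₁)
  have hsm := fun ε ↦ (hs ε).isSmoothCurve (ha ε) (hVc ε) (hWc ε)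
  have hmod : IsModerateH fun ε t ↦ (fourierEquiv n s).symm (V ε t) := by
    rw [isModerateH_iff_curveDeriv]
    simp only [LinearIsometryEquiv.apply_symm_apply]
    refine ⟨fun ε ↦ (hsm ε).1, fun T k ↦ ?_⟩
    obtain ⟨C, hC, hest⟩ := (isCutoff_bracketInv n).exists_norm_le hκ T
    -- The constant `C` is independent of the coefficient and so of `ε`; there is no source, whence
    -- `G = 0`.
    have hest' := fun (ε : Idx) ↦ hest _ _ _ _ 0 (hs ε) (fun t ht ↦ ha0 ε t ht.1) (by simp)
    have hbd := modO_const (l := 𝓟 (univ ×ˢ Icc 0 T))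
      (C * (‖fourierEquiv n s u₀‖ + ‖fourierEquiv n (s - 1) u₁‖ + 0))
    refine modO_curveDeriv (isCutoff_bracketInv n).norm_M_le (eventually_nonneg univ T) ha
      (fun ε ↦ (hsm ε).1) (fun ε ↦ (hsm ε).2.2) (modD_div hβ hβ' hc hb T)
      (hbd.of_le (eventually_principal.2 fun p hp ↦ ?_))
      (hbd.of_le (eventually_principal.2 fun p hp ↦ ?_)) k
    · have := (hest' p.1 p.2 hp.2).1
      rw [hV0, hW0] at this
      exact this.trans (le_abs_self _)
    · have := (hest' p.1 p.2 hp.2).2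
      rw [hV0, hW0] at this
      rw [(hsm p.1).2.1 p.2 hp.2.1]
      exact this.trans (le_abs_self _)
  refine ⟨_, hmod, fun ε ↦ (solvesCauchy_iff (hmod.1 ε)).2 ?_⟩
  simp only [LinearIsometryEquiv.apply_symm_apply]
  exact ⟨(hsm ε).2.2, hV0 ε, ((hsm ε).2.1 0 le_rfl).trans (hW0 ε)⟩

/-- Moderate nets of solutions for two representatives of the coefficients differ by a negligible
net. -/
theorem isNegligibleH_sub (hβ : IsModerate β) (hβ' : IsModerate β') (hβ₁ : IsModerate β₁)
    (hβ₁' : IsModerate β₁') (hc : 0 < c) (hb : ∀ ε t, 0 ≤ t → c ≤ β ε t)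
    (hb' : ∀ ε t, 0 ≤ t → 0 ≤ β' ε t) (h0₁ : ∀ ε t, 0 ≤ t → β₁ ε t ≠ 0)
    (hn : IsNegligible (β₁ - β)) (hn' : IsNegligible (β' - β₁')) (u v : ModerateH n s)
    (hu : ∀ ε, SolvesCauchy (β ε) (β' ε) u₀ u₁ (u.1 ε))
    (hv : ∀ ε, SolvesCauchy (β₁ ε) (β₁' ε) u₀ u₁ (v.1 ε)) : IsNegligibleH (v - u).1 := by
  have hκ : (0 : ℝ) < (2 * Real.pi) ^ 2 := by positivity
  have h0 : ∀ ε t, 0 ≤ t → β ε t ≠ 0 := fun ε t ht ↦ (hc.trans_le (hb ε t ht)).ne'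
  have ha := contDiffOn_div hβ hβ' h0
  have hq := contDiffOn_quotientDiff hβ hβ' hβ₁ hβ₁' h0 h0₁
  have ha0 : ∀ ε t, 0 ≤ t → 0 ≤ (β' / β) ε t := fun ε t ht ↦
    div_nonneg (hb' ε t ht) (hc.le.trans (hb ε t ht))
  have hU := isModerateH_iff_curveDeriv.1 u.2
  have hV := isModerateH_iff_curveDeriv.1 v.2
  have hW := isModerateH_iff_curveDeriv.1 (v - u).2
  have hsub : ∀ ε, (fun t ↦ fourierEquiv n s ((v - u).1 ε t)) =
      fun t ↦ fourierEquiv n s (v.1 ε t) - fourierEquiv n s (u.1 ε t) := fun ε ↦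
    funext fun t ↦ map_sub _ (v.1 ε t) (u.1 ε t)
  have hd : ∀ ε k t, 0 ≤ t →
      curveDeriv (bracketInv n) k (fun t ↦ fourierEquiv n s ((v - u).1 ε t)) t =
        curveDeriv (bracketInv n) k (fun t ↦ fourierEquiv n s (v.1 ε t)) t -
          curveDeriv (bracketInv n) k (fun t ↦ fourierEquiv n s (u.1 ε t)) t := fun ε k t ht ↦ by
    rw [hsub, (hV.1 ε).curveDeriv_sub (hU.1 ε) k ht]
  have hu' := fun ε ↦ (solvesCauchy_iff (u.2.1 ε)).1 (hu ε)
  have hv' := fun ε ↦ (solvesCauchy_iff (v.2.1 ε)).1 (hv ε)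
  -- The difference is written with the nonnegative damping `β' / β` of `u`; the discrepancy to the
  -- damping of `v` multiplies `∂ₜv` and becomes the source.
  have heq : ∀ ε t, 0 ≤ t →
      curveDeriv (bracketInv n) 2 (fun t ↦ fourierEquiv n s ((v - u).1 ε t)) t +
        (2 * Real.pi) ^ 2 • (fourierEquiv n s ((v - u).1 ε t) -
          bracketInv n (bracketInv n (fourierEquiv n s ((v - u).1 ε t)))) +
        (β' / β) ε t • bracketInv n
          (curveDeriv (bracketInv n) 1 (fun t ↦ fourierEquiv n s ((v - u).1 ε t)) t) =
      quotientDiff β β' β₁ β₁' ε t • bracketInv n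
        (curveDeriv (bracketInv n) 1 (fun t ↦ fourierEquiv n s (v.1 ε t)) t) := by
    intro ε t ht
    have h1 := (hu' ε).1 t ht
    have h2 := (hv' ε).1 t ht
    rw [quotientDiff_apply (h0 ε t ht) (h0₁ ε t ht), hd ε 2 t ht, hd ε 1 t ht,
      congrFun (hsub ε) t, ← sub_eq_zero]
    simp only [map_sub, smul_sub, sub_smul, Pi.div_apply] at h1 h2 ⊢
    refine Eq.trans ?_ ((congrArg₂ (· - ·) h2 h1).trans (sub_self 0))
    abel
  refine isNegligibleH_of_negO_curveDeriv (v - u).2.1 fun T k ↦ ?_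
  obtain ⟨ε₀, hε₀, hlow⟩ := exists_lower_bound hc hb hn T
  have hle : 𝓟 ({ε : Idx | (ε : ℝ) < ε₀} ×ˢ Icc 0 T) ≤ 𝓟 (univ ×ˢ Icc 0 T) :=
    principal_mono.2 (prod_mono_left (subset_univ _))
  have hqn := negD_quotientDiff hβ hβ' hβ₁ hβ₁' hc hb h0₁ hn hn' hlow
  have hVm := fun k ↦ (hV.2 T k).mono hle
  obtain ⟨C, hC, hest⟩ := (isCutoff_bracketInv n).exists_norm_le hκ T
  have hsmall : ∀ N : ℕ, ∃ d : ℝ, 0 < d ∧ ∀ ε : Idx, (ε : ℝ) < ε₀ → ∀ t ∈ Icc 0 T,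
      ‖fourierEquiv n s ((v - u).1 ε t)‖ ≤ d * (ε : ℝ) ^ N ∧
      ‖curveDeriv (bracketInv n) 1 (fun t ↦ fourierEquiv n s ((v - u).1 ε t)) t‖ ≤
        d * (ε : ℝ) ^ N := by
    intro N
    -- The source is negligible times moderate, hence at most `d ε ^ N`.
    obtain ⟨d, hd0, hg⟩ := negO_principal_iff.1 ((hqn 0).mul_modO (hVm 1).norm) N
    refine ⟨C * d, by positivity, fun ε hε t ht ↦ ?_⟩
    have hsys := (hW.1 ε).isWaveSystem (κ := (2 * Real.pi) ^ 2) (a := (β' / β) ε)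
      (g := fun t ↦ quotientDiff β β' β₁ β₁' ε t •
        curveDeriv (bracketInv n) 1 (fun t ↦ fourierEquiv n s (v.1 ε t)) t)
      (fun t ht ↦ by rw [heq ε t ht, map_smul])
    have h1 := hest _ _ _ _ (d * (ε : ℝ) ^ N) hsys (fun t ht ↦ ha0 ε t ht.1) (fun t ht ↦ by
      have := hg ε hε t ht
      rw [norm_smul]
      simpa using this) t ht
    -- Both nets have exactly the data `u₀, u₁`, so the initial values of the difference vanish and
    -- only the source remains in the estimate.
    rw [hd ε 1 0 le_rfl, congrFun (hsub ε) 0, (hu' ε).2.1, (hv' ε).2.1, (hu' ε).2.2,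
      (hv' ε).2.2, sub_self, sub_self, norm_zero, zero_add, zero_add, ← mul_assoc] at h1
    exact h1
  -- For `ε ≥ ε₀` nothing is known about `β₁⁻¹`; there the moderateness of `v - u` takes over.
  refine NegO.of_small hε₀ (hW.2 T k) (negO_curveDeriv (isCutoff_bracketInv n).norm_M_le
    (eventually_nonneg _ T) ha hq hW.1 hV.1 heq
    (fun k ↦ (modD_div hβ hβ' hc hb T k).mono hle) hqn hVm ?_ ?_ k)
  · refine negO_principal_iff.2 fun N ↦ ?_
    obtain ⟨d, hd0, h⟩ := hsmall N
    exact ⟨d, hd0, fun ε hε t ht ↦ (h ε hε t ht).1⟩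
  · refine negO_principal_iff.2 fun N ↦ ?_
    obtain ⟨d, hd0, h⟩ := hsmall N
    exact ⟨d, hd0, fun ε hε t ht ↦ (h ε hε t ht).2⟩

/-- Well-posedness for coefficients with representatives `β ≥ c > 0` and `β' ≥ 0`. -/
theorem existsUnique_isSolution (β β' : Moderate) (hc : 0 < c)
    (hb : ∀ ε t, 0 ≤ t → c ≤ β.1 ε t) (hb' : ∀ ε t, 0 ≤ t → 0 ≤ β'.1 ε t) (u₀ : Sobolev n s)
    (u₁ : Sobolev n (s - 1)) :
    ∃! U, IsSolution (Colombeau.mk β) (Colombeau.mk β') u₀ u₁ U := by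
  obtain ⟨u, hu, hsol⟩ := exists_isModerateH_solvesCauchy β.2 β'.2 hc hb hb' u₀ u₁
  refine ⟨ColombeauH.mk ⟨u, hu⟩, ⟨β, β', ⟨u, hu⟩, rfl, rfl, rfl,
    fun ε t ht ↦ (hc.trans_le (hb ε t ht)).ne', hsol⟩, ?_⟩
  -- A competing solution comes with its own representatives, known only to be equivalent to `β, β'`
  -- and zero-free in the denominator.
  rintro _ ⟨β₁, β₁', v, h, h', rfl, h0₁, hv⟩
  exact (Submodule.Quotient.eq _).2 (isNegligibleH_sub β.2 β'.2 β₁.2 β₁'.2 hc hb hb' h0₁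
    (Ideal.Quotient.eq.1 h) (Ideal.Quotient.eq.1 h'.symm) ⟨u, hu⟩ v hsol hv)

end CauchyProblem

end VeryWeak

end

theorem mainTheorem6 (n : ℕ) (hn : 1 ≤ n) (b : ℝ → ℝ) (b₀ b₀' : ℝ)
    (hb₀ : 0 < b₀) (hb₀' : 0 < b₀')
    (hpc : VeryWeak.PiecewiseContinuous b)
    (hmono : MonotoneOn b (Set.Ici 0))
    (hb : ∀ t : ℝ, 0 ≤ t → b₀ ≤ b t)
    (hb' : VeryWeak.DistGE (VeryWeak.distDeriv (VeryWeak.distOf b)) b₀')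
    (s : ℝ) (u₀ : VeryWeak.Sobolev n s) (u₁ : VeryWeak.Sobolev n (s - 1)) :
    ∃ (ψ : VeryWeak.Mollifier) (ι : VeryWeak.DistSpace →ₗ[ℝ] VeryWeak.Colombeau),
      VeryWeak.IsRegularisingEmbedding ψ ι ∧
      ∃! U : VeryWeak.ColombeauH n s,
        VeryWeak.IsSolution
          (ι ⟨VeryWeak.distOf b, VeryWeak.distOf_mem hmono⟩)
          (ι ⟨VeryWeak.distDeriv (VeryWeak.distOf b), VeryWeak.distDeriv_distOf_mem hmono⟩)
          u₀ u₁ U := by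
  -- Every mollifier serves, since the lower bounds on `b` and `b'` pass to all regularisations.
  obtain ⟨ψ⟩ := VeryWeak.Mollifier.nonempty
  exact ⟨ψ, ψ.embedding, ψ.isRegularisingEmbedding, VeryWeak.existsUnique_isSolution
    ⟨_, ψ.isModerate_net ⟨_, VeryWeak.distOf_mem hmono⟩⟩
    ⟨_, ψ.isModerate_net ⟨_, VeryWeak.distDeriv_distOf_mem hmono⟩⟩ hb₀
    (fun ε _ ht ↦ ψ.le_net_distOf (VeryWeak.locallyIntegrableOn_of_monotoneOn hmono) hb ε ht)
    (fun ε _ ht ↦ hb₀'.le.trans (ψ.le_net_of_distGE hb' ε ht)) u₀ u₁⟩
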